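/- Let $G$ be a Lie group acting smoothly and properly on a smooth $n$-manifold $M$ (Hausdorff, second countable), equipped with a $G$-invariant Riemannian metric with Riemannian measure $dx$. Let $Y\subset M$ be compact with $G\cdot Y=M$, let $U,U'\subset M$ be open with compact closures such that $Y\subset U$ and $\overline U\subset U'$, and let $f:M\to[0,1]$ be a smooth function with $f|_U=1$ and $\operatorname{supp} f\subset U'$. Let $dg=dm(g)$ be a right-invariant Haar measure on $G$ and let $\chi:G\to(0,\infty)$ be the continuous function with $dm(g^{-1})=\chi(g)\,dm(g)$. Let $L^2(M,\Lambda^*)$ be the space of square integrable (real) sections of $\Lambda^*T^*M$ (modulo equality almost everywhere) with inner product $\langle\alpha,\beta\rangle_0=\int_M\langle\alpha,\beta\rangle_x\,dx=\int_M\alpha\wedge *\beta$. For a form $\mu$ on $M$ write $\mu(gx)$ for $(g^*\mu)(x)\in\Lambda^*T_x^*M$. For every smooth $G$-invariant form $s$ on $M$ the form $fs$ belongs to $L^2(M,\Lambda^*)$; let $\mathbf H^0_f$ be the closure in $L^2(M,\Lambda^*)$ of the space of all such $fs$. Proposition. The function $$A(x)=\Bigl(\int_G\chi(g)\,f(gx)^2\,dg\Bigr)^{1/2}\qquad(x\in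 M)$$ is well defined (the integral is finite), strictly positive, and satisfies $A(gx)^2=\chi(g)^{-1}A(x)^2$ for all $g\in G$, $x\in M$. For every square integrable section $\mu$, the integral in $$(P_f\mu)(x)=\frac{f(x)}{A(x)^2}\int_G\chi(g)\,f(gx)\,\mu(gx)\,dg$$ converges absolutely for almost every $x\in M$, $P_f\mu$ is square integrable, and its class in $L^2(M,\Lambda^*)$ depends only on the class of $\mu$. The resulting map $P_f:L^2(M,\Lambda^*)\to L^2(M,\Lambda^*)$ is a bounded linear operator, and it is the orthogonal projection of $L^2(M,\Lambda^*)$ onto $\mathbf H^0_f$; that is, $P_f^2=P_f$, $\langle P_f\mu,\nu\rangle_0=\langle\mu,P_f\nu\rangle_0$ for all $\mu,\nu$, and the range of $P_f$ is $\mathbf H^0_f$. -/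

import Mathlib

open scoped Manifold ContDiff
open MeasureTheory Bundle

noncomputable section

namespace EquivariantForms

/-! ### Haar measure -/

section Haar

variable {G : Type*} [Group G] [TopologicalSpace G] [MeasurableSpace G]

/-- `χ` is the continuous positive function with `dm(g⁻¹) = χ(g) dm(g)`. -/
structure IsInversionDensity (m : Measure G) (χ : G → ℝ) : Prop where
  continuous : Continuous χ
  pos : ∀ g, 0 < χ g
  inv_eq : m.inv = m.withDensity (fun g => ENNReal.ofReal (χ g))

/-- The function `χ : G → ℝ⁺` defined by `dm(g⁻¹) = χ(g) dm(g)`, for a right Haar measure `m`.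
It exists (`isInversionDensity_modularFn`) and is unique (`IsInversionDensity.unique`). -/
def modularFn (m : Measure G) : G → ℝ :=
  Classical.epsilon (IsInversionDensity m)

theorem exists_isInversionDensity [IsTopologicalGroup G] [T2Space G] [LocallyCompactSpace G]
    [SecondCountableTopology G] [BorelSpace G] (m : Measure G) [m.IsMulRightInvariant]
    [IsFiniteMeasureOnCompacts m] [m.IsOpenPosMeasure] :
    ∃ χ : G → ℝ, IsInversionDensity m χ := by
  obtain ⟨⟨p, p_cont⟩, p_comp, p_nonneg, p_one⟩ :
    ∃ p : C(G, ℝ), HasCompactSupport p ∧ 0 ≤ p ∧ p 1 ≠ 0 := exists_continuous_nonneg_pos 1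
  have hopen : (m.inv).IsOpenPosMeasure :=
    (Homeomorph.inv G).continuous.isOpenPosMeasure_map (Homeomorph.inv G).surjective
  have hfin : IsFiniteMeasureOnCompacts m.inv := by
    refine ⟨fun K hK => ?_⟩
    rw [Measure.inv_apply]
    exact hK.inv.measure_lt_top
  let D : G → ℝ := fun x => ∫ y, p (y⁻¹ * x) ∂m
  have D_cont : Continuous D := continuous_integral_apply_inv_mul p_cont p_comp
  have D_pos : ∀ x, 0 < D x := by
    intro x
    have C : Continuous (fun y => p (y⁻¹ * x)) := by fun_prop
    refine C.integral_pos_of_hasCompactSupport_nonneg_nonzero (x := x) ?_ ?_ ?_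
    · exact p_comp.comp_homeomorph ((Homeomorph.inv G).trans (Homeomorph.mulRight x))
    · exact fun y => p_nonneg _
    · simpa using p_one
  have hc : 0 < ∫ x, p x ∂m.inv :=
    p_cont.integral_pos_of_hasCompactSupport_nonneg_nonzero p_comp p_nonneg p_one
  have χ_cont : Continuous (fun x => (D x)⁻¹ * ∫ y, p y ∂m.inv) :=
    (D_cont.inv₀ fun x => (D_pos x).ne').mul continuous_const
  have χ_pos : ∀ x, 0 < (D x)⁻¹ * ∫ y, p y ∂m.inv := fun x => mul_pos (inv_pos.2 (D_pos x)) hc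
  refine ⟨_, χ_cont, χ_pos, ?_⟩
  have hloc : IsLocallyFiniteMeasure
      (m.withDensity (fun g => ENNReal.ofReal ((D g)⁻¹ * ∫ y, p y ∂m.inv))) :=
    IsLocallyFiniteMeasure.withDensity_ofReal χ_cont
  have := hloc
  apply Measure.ext_of_integral_eq_on_compactlySupported
  intro q
  rw [integral_withDensity_eq_integral_toReal_smul (by fun_prop) (by simp)]
  change ∫ x, q x ∂m.inv = _
  rw [Measure.integral_isMulLeftInvariant_isMulRightInvariant_combo (μ := m.inv) (ν := m) (f := q) q.continuous
    q.hasCompactSupport p_cont p_comp p_nonneg p_one, ← integral_mul_const]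
  refine integral_congr_ae (Filter.Eventually.of_forall fun x => ?_)
  simp only [smul_eq_mul, ENNReal.toReal_ofReal (χ_pos x).le]
  simp only [D]
  ring

theorem isInversionDensity_modularFn [IsTopologicalGroup G] [T2Space G] [LocallyCompactSpace G]
    [SecondCountableTopology G] [BorelSpace G] (m : Measure G) [m.IsMulRightInvariant]
    [IsFiniteMeasureOnCompacts m] [m.IsOpenPosMeasure] :
    IsInversionDensity m (modularFn m) :=
  Classical.epsilon_spec (exists_isInversionDensity m)

theorem IsInversionDensity.unique [T2Space G] [LocallyCompactSpace G]
    [SecondCountableTopology G] [BorelSpace G] {m : Measure G}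
    [IsFiniteMeasureOnCompacts m] [m.IsOpenPosMeasure] {χ₁ χ₂ : G → ℝ}
    (h₁ : IsInversionDensity m χ₁) (h₂ : IsInversionDensity m χ₂) : χ₁ = χ₂ := by
  have c₁ := h₁.continuous
  have c₂ := h₂.continuous
  refine Measure.eq_of_ae_eq (μ := m) ?_ h₁.continuous h₂.continuous
  have h := h₁.inv_eq.symm.trans h₂.inv_eq
  rw [withDensity_eq_iff_of_sigmaFinite (by fun_prop) (by fun_prop)] at h
  filter_upwards [h] with x hx
  exact (ENNReal.ofReal_eq_ofReal_iff (h₁.pos x).le (h₂.pos x).le).1 hx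

end Haar

/-! ### Pointwise inner product of alternating forms -/

section Pointwise

variable {V : Type*} [AddCommGroup V] [Module ℝ V] [TopologicalSpace V] {n k : ℕ}

/-- Gram matrix `g_{ij} = B(b_i, b_j)`. -/
def gram (B : V → V → ℝ) (b : Fin n → V) : Matrix (Fin n) (Fin n) ℝ :=
  Matrix.of fun i j => B (b i) (b j)

/-- The inner product induced on `Λ^k V*` by the inner product `B` of `V`, in terms of a basis `b`
of `V`:  `(1/k!) ∑ g^{i₁j₁} ⋯ g^{i_k j_k} α_{i₁…i_k} β_{j₁…j_k}`, where `g^{ij}` is the inverse of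
the Gram matrix. It does not depend on `b` (`altInner_eq`); for an orthonormal basis it is
`∑_{i₁<⋯<i_k} α_{i₁…i_k} β_{i₁…i_k}`. -/
def altInner (B : V → V → ℝ) (b : Fin n → V) (α β : V [⋀^Fin k]→L[ℝ] ℝ) : ℝ :=
  (Nat.factorial k : ℝ)⁻¹ * ∑ I : Fin k → Fin n, ∑ J : Fin k → Fin n,
    (∏ a, (gram B b)⁻¹ (I a) (J a)) * α (fun a => b (I a)) * β (fun a => b (J a))

theorem alt_map_sum (α : V [⋀^Fin k]→L[ℝ] ℝ) (b : Fin n → V) (L : Matrix (Fin n) (Fin n) ℝ)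
    (I : Fin k → Fin n) :
    α (fun a => ∑ i, L i (I a) • b i) =
      ∑ I' : Fin k → Fin n, (∏ a, L (I' a) (I a)) * α (fun a => b (I' a)) := by
  classical
  have h := α.toMultilinearMap.map_sum (fun a i => L i (I a) • b i)
  have h2 : ∀ I' : Fin k → Fin n, α.toMultilinearMap (fun a => L (I' a) (I a) • b (I' a)) =
      (∏ a, L (I' a) (I a)) * α (fun a => b (I' a)) := fun I' => by
    have := α.toMultilinearMap.map_smul_univ (fun a => L (I' a) (I a)) (fun a => b (I' a))
    simpa using this
  simp only [h2] at h
  exact h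

theorem sum_prod_matrix (P Q R : Matrix (Fin n) (Fin n) ℝ) (I' J' : Fin k → Fin n) :
    ∑ I : Fin k → Fin n, ∑ J : Fin k → Fin n,
      (∏ a, P (I' a) (I a)) * (∏ a, Q (I a) (J a)) * (∏ a, R (J a) (J' a)) =
    ∏ a, (P * Q * R) (I' a) (J' a) := by
  classical
  have h1 : ∀ a, (P * Q * R) (I' a) (J' a) = ∑ j, ∑ i, P (I' a) i * Q i j * R j (J' a) := by
    intro a
    simp [Matrix.mul_apply, Finset.sum_mul]
  simp only [h1, Finset.prod_univ_sum, Fintype.piFinset_univ, Finset.prod_mul_distrib]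
  exact Finset.sum_comm

theorem sum_four_comm {ι : Type*} [Fintype ι] (F : ι → ι → ι → ι → ℝ) :
    ∑ I, ∑ J, ∑ I', ∑ J', F I J I' J' = ∑ I', ∑ J', ∑ I, ∑ J, F I J I' J' := by
  calc _ = ∑ I, ∑ I', ∑ J, ∑ J', F I J I' J' :=
        Finset.sum_congr rfl fun I _ => Finset.sum_comm
    _ = ∑ I', ∑ I, ∑ J, ∑ J', F I J I' J' := Finset.sum_comm
    _ = ∑ I', ∑ I, ∑ J', ∑ J, F I J I' J' :=
        Finset.sum_congr rfl fun I' _ => Finset.sum_congr rfl fun I _ => Finset.sum_comm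
    _ = _ := Finset.sum_congr rfl fun I' _ => Finset.sum_comm

theorem altInner_change (B : LinearMap.BilinForm ℝ V) (b b' : Fin n → V)
    (L : Matrix (Fin n) (Fin n) ℝ) (hL : IsUnit L.det) (hb : ∀ j, b' j = ∑ i, L i j • b i)
    (α β : V [⋀^Fin k]→L[ℝ] ℝ) :
    altInner (fun v w => B v w) b' α β = altInner (fun v w => B v w) b α β := by
  classical
  have hG : gram (fun v w => B v w) b' = L.transpose * gram (fun v w => B v w) b * L := by
    ext i j
    simp only [gram, Matrix.of_apply, hb, map_sum, LinearMap.sum_apply, map_smul,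
      LinearMap.smul_apply, smul_eq_mul, Matrix.mul_apply, Matrix.transpose_apply,
      Finset.sum_mul, Finset.mul_sum]
    refine Finset.sum_congr rfl fun x _ => Finset.sum_congr rfl fun y _ => by ring
  have hinv : L * (gram (fun v w => B v w) b')⁻¹ * L.transpose =
      (gram (fun v w => B v w) b)⁻¹ := by
    rw [hG, Matrix.mul_inv_rev, Matrix.mul_inv_rev, ← Matrix.mul_assoc,
      Matrix.mul_nonsing_inv L hL, Matrix.one_mul, Matrix.mul_assoc,
      Matrix.nonsing_inv_mul _ (by rwa [Matrix.det_transpose]), Matrix.mul_one]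
  unfold altInner
  congr 1
  simp only [← hinv, ← sum_prod_matrix]
  have e : ∀ (γ : V [⋀^Fin k]→L[ℝ] ℝ) (I : Fin k → Fin n), γ (fun a => b' (I a)) =
      ∑ I' : Fin k → Fin n, (∏ a, L (I' a) (I a)) * γ (fun a => b (I' a)) := by
    intro γ I
    rw [← alt_map_sum]
    simp only [hb]
  simp only [e, Finset.sum_mul, Finset.mul_sum]
  calc _ = ∑ I : Fin k → Fin n, ∑ J : Fin k → Fin n, ∑ I' : Fin k → Fin n,
        ∑ J' : Fin k → Fin n, (∏ a, (gram (fun v w => B v w) b')⁻¹ (I a) (J a)) *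
          ((∏ a, L (I' a) (I a)) * α (fun a => b (I' a))) *
          ((∏ a, L (J' a) (J a)) * β (fun a => b (J' a))) :=
        Finset.sum_congr rfl fun I _ => Finset.sum_congr rfl fun J _ => Finset.sum_comm
    _ = _ := by
        rw [sum_four_comm]
        refine Finset.sum_congr rfl fun I' _ => Finset.sum_congr rfl fun J' _ =>
          Finset.sum_congr rfl fun I _ => Finset.sum_congr rfl fun J _ => ?_
        simp only [Matrix.transpose_apply]
        ring

/-- The inner product on `Λ^k V*` is the same in all bases. -/
theorem altInner_eq (B : LinearMap.BilinForm ℝ V) (b b' : Module.Basis (Fin n) ℝ V)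
    (α β : V [⋀^Fin k]→L[ℝ] ℝ) :
    altInner (fun v w => B v w) b' α β = altInner (fun v w => B v w) b α β := by
  refine altInner_change B b b' (b.toMatrix b') ?_ (fun j => ?_) α β
  · have h := b.toMatrix_mul_toMatrix_flip b'
    exact (Matrix.isUnit_iff_isUnit_det _).1 (IsUnit.of_mul_eq_one _ h)
  · exact (b.sum_toMatrix_smul_self b' j).symm

theorem altInner_comm (B : LinearMap.BilinForm ℝ V) (hB : ∀ v w, B v w = B w v) (b : Fin n → V)
    (α β : V [⋀^Fin k]→L[ℝ] ℝ) :
    altInner (fun v w => B v w) b α β = altInner (fun v w => B v w) b β α := by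
  have hG : (gram (fun v w => B v w) b).transpose = gram (fun v w => B v w) b := by
    ext i j
    simp [gram, hB (b i)]
  have hG' : ∀ i j, (gram (fun v w => B v w) b)⁻¹ i j = (gram (fun v w => B v w) b)⁻¹ j i := by
    intro i j
    conv_lhs => rw [← hG, ← Matrix.transpose_nonsing_inv]
    rfl
  unfold altInner
  congr 1
  rw [Finset.sum_comm]
  refine Finset.sum_congr rfl fun I _ => Finset.sum_congr rfl fun J _ => ?_
  simp only [fun a => hG' (J a) (I a)]
  ring

theorem altInner_add_left (B : V → V → ℝ) (b : Fin n → V) (α α' β : V [⋀^Fin k]→L[ℝ] ℝ) :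
    altInner B b (α + α') β = altInner B b α β + altInner B b α' β := by
  simp only [altInner, ← mul_add, ← Finset.sum_add_distrib, ContinuousAlternatingMap.add_apply]
  congr 1
  refine Finset.sum_congr rfl fun I _ => Finset.sum_congr rfl fun J _ => by ring

theorem altInner_smul_left (B : V → V → ℝ) (b : Fin n → V) (r : ℝ) (α β : V [⋀^Fin k]→L[ℝ] ℝ) :
    altInner B b (r • α) β = r * altInner B b α β := by
  simp only [altInner, Finset.mul_sum, ContinuousAlternatingMap.smul_apply, smul_eq_mul]
  refine Finset.sum_congr rfl fun I _ => Finset.sum_congr rfl fun J _ => by ring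

open scoped MatrixOrder Matrix.Norms.L2Operator in
theorem altInner_self_nonneg (B : LinearMap.BilinForm ℝ V) (hB : ∀ v w, B v w = B w v)
    (hpos : ∀ v, 0 ≤ B v v) (b : Fin n → V) (α : V [⋀^Fin k]→L[ℝ] ℝ) :
    0 ≤ altInner (fun v w => B v w) b α α := by
  classical
  have hG : (gram (fun v w => B v w) b).PosSemidef := by
    refine Matrix.PosSemidef.of_dotProduct_mulVec_nonneg ?_ fun x => ?_
    · ext i j
      simp [gram, hB (b i)]
    · have h := hpos (∑ i, x i • b i)
      simp only [map_sum, LinearMap.sum_apply, map_smul, LinearMap.smul_apply, smul_eq_mul] at h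
      simp only [dotProduct, Matrix.mulVec, gram, Matrix.of_apply, Pi.star_apply, star_trivial,
        Finset.mul_sum] at h ⊢
      rw [Finset.sum_comm]
      refine h.trans_eq (Finset.sum_congr rfl fun x _ => Finset.sum_congr rfl fun y _ => by ring)
  obtain ⟨S, hS⟩ := CStarAlgebra.nonneg_iff_eq_star_mul_self.1 hG.inv.nonneg
  unfold altInner
  refine mul_nonneg (by positivity) ?_
  have h1 : ∀ I J : Fin k → Fin n, (∏ a, (gram (fun v w => B v w) b)⁻¹ (I a) (J a)) =
      ∑ l : Fin k → Fin n, (∏ a, S (l a) (I a)) * ∏ a, S (l a) (J a) := by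
    intro I J
    simp only [hS, Matrix.mul_apply, Finset.prod_univ_sum, Fintype.piFinset_univ,
      Matrix.star_apply, star_trivial, Finset.prod_mul_distrib]
  have h2 : ∑ I : Fin k → Fin n, ∑ J : Fin k → Fin n,
      (∏ a, (gram (fun v w => B v w) b)⁻¹ (I a) (J a)) * α (fun a => b (I a)) *
        α (fun a => b (J a)) =
      ∑ l : Fin k → Fin n, (∑ I : Fin k → Fin n, (∏ a, S (l a) (I a)) * α (fun a => b (I a))) ^ 2 := by
    simp only [h1, sq, Finset.sum_mul, Finset.mul_sum]
    refine ((Finset.sum_congr rfl fun I _ => Finset.sum_comm).trans Finset.sum_comm).trans ?_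
    refine Finset.sum_congr rfl fun l _ => ?_
    refine Finset.sum_congr rfl fun I _ => Finset.sum_congr rfl fun J _ => by ring
  rw [h2]
  exact Finset.sum_nonneg fun l _ => sq_nonneg _

end Pointwise

/-! ### Differential forms on a Riemannian manifold -/

section Manifold

variable {n : ℕ} {M : Type*} [TopologicalSpace M] [ChartedSpace (EuclideanSpace ℝ (Fin n)) M]
  [IsManifold (𝓡 n) ∞ M]

variable (n M) in
/-- Smooth Riemannian metrics on the `n`-manifold `M`. -/
abbrev Metric : Type _ :=
  ContMDiffRiemannianMetric (𝓡 n) ∞ (EuclideanSpace ℝ (Fin n))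
    (fun x : M => TangentSpace (𝓡 n) x)

/-- The coordinate vector `∂/∂x_i` at `x` of the chart centred at `c` (for `x` in its domain). -/
def coordVec (c x : M) (i : Fin n) : TangentSpace (𝓡 n) x :=
  (trivializationAt (EuclideanSpace ℝ (Fin n)) (fun x : M => TangentSpace (𝓡 n) x) c).localFrame
    (EuclideanSpace.basisFun (Fin n) ℝ).toBasis i x

/-- The Riemannian measure of a chart: `√det(g_{ij}) dx₁⋯dx_n`, transported to the domain of the
chart centred at `c`. -/
def chartVolume [MeasurableSpace M] (γ : Metric n M) (c : M) : Measure M :=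
  ((volume.restrict (chartAt (EuclideanSpace ℝ (Fin n)) c).target).withDensity fun y =>
    let x := (chartAt (EuclideanSpace ℝ (Fin n)) c).symm y
    ENNReal.ofReal √(gram (fun v w => γ.inner x v w) (coordVec c x)).det).map
    (chartAt (EuclideanSpace ℝ (Fin n)) c).symm

/-- The Riemannian measure of `M`. The measures of the charts agree on overlaps; their supremum is
the measure whose restriction to the domain of every chart is the measure of that chart. -/
def riemVolume [MeasurableSpace M] (γ : Metric n M) : Measure M :=
  ⨆ c : M, chartVolume γ c

variable (n) in
/-- The fibre `Λ* T_x^* M = ⨁_{k=0}^n Λ^k T_x^* M`. -/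
def FormFiber (x : M) : Type :=
  ∀ k : Fin (n + 1), TangentSpace (𝓡 n) x [⋀^Fin k]→L[ℝ] ℝ

instance (x : M) : NormedAddCommGroup (FormFiber n x) :=
  inferInstanceAs (NormedAddCommGroup
    (∀ k : Fin (n + 1), EuclideanSpace ℝ (Fin n) [⋀^Fin k]→L[ℝ] ℝ))

instance (x : M) : NormedSpace ℝ (FormFiber n x) :=
  inferInstanceAs (NormedSpace ℝ
    (∀ k : Fin (n + 1), EuclideanSpace ℝ (Fin n) [⋀^Fin k]→L[ℝ] ℝ))

variable (n M) in
/-- Arbitrary (not necessarily measurable) sections of `Λ* T^* M`. -/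
def RoughForm : Type _ := ∀ x : M, FormFiber n x

instance : AddCommGroup (RoughForm n M) := inferInstanceAs (AddCommGroup (∀ x : M, FormFiber n x))

instance : Module ℝ (RoughForm n M) := inferInstanceAs (Module ℝ (∀ x : M, FormFiber n x))

/-- The coefficient `η(∂_{I 1}, …, ∂_{I k})` of the degree `k` part of `η` in the chart centred at
`c`, as a function on the domain of that chart. -/
def coeff (η : RoughForm n M) (c : M) (k : Fin (n + 1)) (I : Fin k → Fin n) (x : M) : ℝ :=
  η x k (fun a => coordVec c x (I a))

/-- Smooth differential forms: the coefficients in every chart are smooth. -/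
def IsSmoothForm (η : RoughForm n M) : Prop :=
  ∀ (c : M) (k : Fin (n + 1)) (I : Fin k → Fin n),
    ContMDiffOn (𝓡 n) 𝓘(ℝ, ℝ) ∞ (coeff η c k I) (chartAt (EuclideanSpace ℝ (Fin n)) c).source

/-- Measurable sections: the coefficients in every chart are (a.e. strongly) measurable. -/
def IsMeasurableForm [MeasurableSpace M] (γ : Metric n M) (η : RoughForm n M) : Prop :=
  ∀ (c : M) (k : Fin (n + 1)) (I : Fin k → Fin n),
    AEStronglyMeasurable (coeff η c k I)
      ((riemVolume γ).restrict (chartAt (EuclideanSpace ℝ (Fin n)) c).source)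

/-- The pointwise inner product `⟨α, β⟩_x` on `Λ* T_x^* M` induced by the metric; different degrees
are orthogonal. (It is computed in the chart centred at `x`; every chart gives the same value,
see `formInner_eq`.) -/
def formInner (γ : Metric n M) (x : M) (α β : FormFiber n x) : ℝ :=
  ∑ k : Fin (n + 1), altInner (fun v w => γ.inner x v w) (coordVec x x) (α k) (β k)

/-! Proofs that square integrable forms make up a pre-Hilbert space. -/

theorem coordVec_eq {c x : M} (hx : x ∈ (chartAt (EuclideanSpace ℝ (Fin n)) c).source) :
    ∃ b : Module.Basis (Fin n) ℝ (TangentSpace (𝓡 n) x), coordVec c x = b := by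
  have hx' : x ∈ (trivializationAt (EuclideanSpace ℝ (Fin n))
      (fun x : M => TangentSpace (𝓡 n) x) c).baseSet := by
    simpa using hx
  refine ⟨Trivialization.basisAt _ (EuclideanSpace.basisFun (Fin n) ℝ).toBasis hx', ?_⟩
  funext i
  exact Trivialization.localFrame_apply_of_mem_baseSet _ _ hx'

/-- The scalar product of `T_x M` as a bilinear form. -/
def metricForm (γ : Metric n M) (x : M) : LinearMap.BilinForm ℝ (TangentSpace (𝓡 n) x) :=
  LinearMap.mk₂ ℝ (fun v w => γ.inner x v w) (by simp) (by simp) (by simp) (by simp)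

theorem formInner_eq (γ : Metric n M) {c x : M}
    (hx : x ∈ (chartAt (EuclideanSpace ℝ (Fin n)) c).source) (α β : FormFiber n x) :
    formInner γ x α β =
      ∑ k : Fin (n + 1), altInner (fun v w => γ.inner x v w) (coordVec c x) (α k) (β k) := by
  obtain ⟨b, hb⟩ := coordVec_eq (mem_chart_source (EuclideanSpace ℝ (Fin n)) x)
  obtain ⟨b', hb'⟩ := coordVec_eq hx
  refine Finset.sum_congr rfl fun k _ => ?_
  rw [hb, hb']
  exact altInner_eq (metricForm γ x) b' b (α k) (β k)

theorem formInner_comm (γ : Metric n M) (x : M) (α β : FormFiber n x) :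
    formInner γ x α β = formInner γ x β α :=
  Finset.sum_congr rfl fun k _ =>
    altInner_comm (metricForm γ x) (fun v w => γ.symm x v w) (coordVec x x) (α k) (β k)

theorem formInner_add_left (γ : Metric n M) (x : M) (α α' β : FormFiber n x) :
    formInner γ x (α + α') β = formInner γ x α β + formInner γ x α' β := by
  unfold formInner
  rw [← Finset.sum_add_distrib]
  exact Finset.sum_congr rfl fun k _ => altInner_add_left _ _ (α k) (α' k) (β k)

theorem formInner_smul_left (γ : Metric n M) (x : M) (r : ℝ) (α β : FormFiber n x) :
    formInner γ x (r • α) β = r * formInner γ x α β := by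
  unfold formInner
  rw [Finset.mul_sum]
  exact Finset.sum_congr rfl fun k _ => altInner_smul_left _ _ r (α k) (β k)

theorem formInner_self_nonneg (γ : Metric n M) (x : M) (α : FormFiber n x) :
    0 ≤ formInner γ x α α := by
  refine Finset.sum_nonneg fun k _ =>
    altInner_self_nonneg (metricForm γ x) (fun v w => γ.symm x v w) (fun v => ?_) (coordVec x x)
      (α k)
  rcases eq_or_ne v 0 with rfl | hv
  · simp
  · exact (γ.pos x v hv).le

theorem formInner_add_self (γ : Metric n M) (x : M) (α β : FormFiber n x) :
    formInner γ x (α + β) (α + β) =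
      formInner γ x α α + 2 * formInner γ x α β + formInner γ x β β := by
  rw [formInner_add_left, formInner_comm γ x α (α + β), formInner_comm γ x β (α + β),
    formInner_add_left, formInner_add_left, formInner_comm γ x β α]
  ring

theorem abs_formInner_le (γ : Metric n M) (x : M) (α β : FormFiber n x) :
    |formInner γ x α β| ≤ formInner γ x α α + formInner γ x β β := by
  have h1 := formInner_self_nonneg γ x (α + β)
  have h2 := formInner_self_nonneg γ x (α + (-1 : ℝ) • β)
  have e : formInner γ x α ((-1 : ℝ) • β) = - formInner γ x α β := by
    rw [formInner_comm, formInner_smul_left, formInner_comm]; ring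
  have e' : formInner γ x ((-1 : ℝ) • β) ((-1 : ℝ) • β) = formInner γ x β β := by
    rw [formInner_smul_left, formInner_comm, formInner_smul_left]; ring
  rw [formInner_add_self] at h1 h2
  rw [e, e'] at h2
  have h3 := formInner_self_nonneg γ x α
  have h4 := formInner_self_nonneg γ x β
  rw [abs_le]
  constructor <;> linarith

theorem continuousOn_metric (γ : Metric n M) (c : M) (i j : Fin n) :
    ContinuousOn (fun x => γ.inner x (coordVec c x i) (coordVec c x j))
      (chartAt (EuclideanSpace ℝ (Fin n)) c).source := by
  intro x hx
  have hx' : x ∈ (trivializationAt (EuclideanSpace ℝ (Fin n))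
      (fun x : M => TangentSpace (𝓡 n) x) c).baseSet := by
    simpa using hx
  have hv := fun i => contMDiffAt_localFrame_of_mem (I := 𝓡 n) ∞
    (trivializationAt (EuclideanSpace ℝ (Fin n)) (fun x : M => TangentSpace (𝓡 n) x) c)
    (EuclideanSpace.basisFun (Fin n) ℝ).toBasis i hx'
  have : ContMDiffAt (𝓡 n) ((𝓡 n).prod 𝓘(ℝ)) ∞
      (fun m ↦ TotalSpace.mk' ℝ (E := Bundle.Trivial M ℝ) m
        (γ.inner m (coordVec c m i) (coordVec c m j))) x := by
    apply ContMDiffAt.clm_bundle_apply₂ (F₁ := EuclideanSpace ℝ (Fin n))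
      (F₂ := EuclideanSpace ℝ (Fin n))
    · exact γ.contMDiff.contMDiffAt
    · exact hv i
    · exact hv j
  rw [contMDiffAt_totalSpace] at this
  exact this.2.continuousAt.continuousWithinAt

/-- Pairings of measurable sections are measurable. -/
theorem aestronglyMeasurable_formInner [SecondCountableTopology M] [MeasurableSpace M]
    [BorelSpace M] (γ : Metric n M) {α β : RoughForm n M} (hα : IsMeasurableForm γ α)
    (hβ : IsMeasurableForm γ β) :
    AEStronglyMeasurable (fun x => formInner γ x (α x) (β x)) (riemVolume γ) := by
  have key : ∀ c : M, AEStronglyMeasurable (fun x => formInner γ x (α x) (β x))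
      ((riemVolume γ).restrict (chartAt (EuclideanSpace ℝ (Fin n)) c).source) := by
    intro c
    have hs : MeasurableSet (chartAt (EuclideanSpace ℝ (Fin n)) c).source :=
      (chartAt (EuclideanSpace ℝ (Fin n)) c).open_source.measurableSet
    let A : M → Matrix (Fin n) (Fin n) ℝ := fun x =>
      gram (fun v w => γ.inner x v w) (coordVec c x)
    have hA : ContinuousOn A (chartAt (EuclideanSpace ℝ (Fin n)) c).source :=
      continuousOn_pi.2 fun i => continuousOn_pi.2 fun j => continuousOn_metric γ c i j
    have hinv : ∀ i j, AEStronglyMeasurable (fun x => (A x)⁻¹ i j)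
        ((riemVolume γ).restrict (chartAt (EuclideanSpace ℝ (Fin n)) c).source) := by
      intro i j
      have h1 : ContinuousOn (fun x => (A x).det)
          (chartAt (EuclideanSpace ℝ (Fin n)) c).source :=
        (Continuous.matrix_det continuous_id).comp_continuousOn hA
      have h2 : ContinuousOn (fun x => (A x).adjugate i j)
          (chartAt (EuclideanSpace ℝ (Fin n)) c).source :=
        ((Continuous.matrix_adjugate continuous_id).matrix_elem i j).comp_continuousOn hA
      have h3 := (h1.aemeasurable (μ := riemVolume γ) hs).inv.mul
        (h2.aemeasurable (μ := riemVolume γ) hs)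
      refine h3.aestronglyMeasurable.congr (Filter.Eventually.of_forall fun x => ?_)
      simp [Matrix.inv_def, Ring.inverse_eq_inv']
    have hsum : AEStronglyMeasurable (fun x => ∑ k : Fin (n + 1),
        altInner (fun v w => γ.inner x v w) (coordVec c x) (α x k) (β x k))
        ((riemVolume γ).restrict (chartAt (EuclideanSpace ℝ (Fin n)) c).source) := by
      refine Finset.aestronglyMeasurable_fun_sum _ fun k _ => ?_
      unfold altInner
      refine AEStronglyMeasurable.const_mul ?_ _
      refine Finset.aestronglyMeasurable_fun_sum _ fun I _ =>
        Finset.aestronglyMeasurable_fun_sum _ fun J _ => ?_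
      refine (AEStronglyMeasurable.mul ?_ (hα c k I)).mul (hβ c k J)
      exact Finset.aestronglyMeasurable_fun_prod _ fun a _ => hinv _ _
    refine hsum.congr ?_
    filter_upwards [ae_restrict_mem hs] with x hx
    exact (formInner_eq γ hx (α x) (β x)).symm
  obtain ⟨s, hs, hU⟩ := TopologicalSpace.countable_cover_nhds
    (f := fun c : M => (chartAt (EuclideanSpace ℝ (Fin n)) c).source)
    (fun c => chart_source_mem_nhds _ c)
  have : Countable s := hs.to_subtype
  rw [← Measure.restrict_univ (μ := riemVolume γ), ← hU, Set.biUnion_eq_iUnion,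
    aestronglyMeasurable_iUnion_iff]
  exact fun c => key c

/-! ### The Hilbert space `L²(M, Λ*)` -/

variable [SecondCountableTopology M] [MeasurableSpace M] [BorelSpace M]

theorem integrable_formInner (γ : Metric n M) {α β : RoughForm n M} (hα : IsMeasurableForm γ α)
    (hβ : IsMeasurableForm γ β)
    (hα' : Integrable (fun x => formInner γ x (α x) (α x)) (riemVolume γ))
    (hβ' : Integrable (fun x => formInner γ x (β x) (β x)) (riemVolume γ)) :
    Integrable (fun x => formInner γ x (α x) (β x)) (riemVolume γ) :=
  (hα'.add hβ').mono' (aestronglyMeasurable_formInner γ hα hβ)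
    (Filter.Eventually.of_forall fun x => abs_formInner_le γ x (α x) (β x))

/-- Measurable sections `η` of `Λ* T^* M` with `∫_M |η|² < ∞`. -/
def squareIntegrable (γ : Metric n M) : Submodule ℝ (RoughForm n M) where
  carrier := {η | IsMeasurableForm γ η ∧
    Integrable (fun x => formInner γ x (η x) (η x)) (riemVolume γ)}
  zero_mem' := by
    refine ⟨fun c k I => aestronglyMeasurable_const (b := (0 : ℝ)), ?_⟩
    have h : ∀ x, formInner γ x ((0 : RoughForm n M) x) ((0 : RoughForm n M) x) = 0 := fun x => by
      have := formInner_smul_left γ x 0 0 ((0 : RoughForm n M) x)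
      rwa [zero_smul, zero_mul] at this
    simp only [h]
    exact integrable_zero _ _ _
  add_mem' := by
    rintro α β ⟨hα, hα'⟩ ⟨hβ, hβ'⟩
    refine ⟨fun c k I => (hα c k I).add (hβ c k I), ?_⟩
    have h : ∀ x, formInner γ x ((α + β) x) ((α + β) x) =
        formInner γ x (α x) (α x) + 2 * formInner γ x (α x) (β x) + formInner γ x (β x) (β x) :=
      fun x => formInner_add_self γ x (α x) (β x)
    simp only [h]
    exact (hα'.add ((integrable_formInner γ hα hβ hα' hβ').const_mul 2)).add hβ'
  smul_mem' := by
    rintro r α ⟨hα, hα'⟩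
    refine ⟨fun c k I => (hα c k I).const_mul r, ?_⟩
    have h : ∀ x, formInner γ x ((r • α) x) ((r • α) x) =
        r * (r * formInner γ x (α x) (α x)) := fun x => by
      have := formInner_smul_left γ x r (α x) (r • α x)
      refine this.trans ?_
      rw [formInner_comm γ x (α x), formInner_smul_left]
    simp only [h]
    exact (hα'.const_mul r).const_mul r

/-- The inner product `⟨α, β⟩₀ = ∫_M α ∧ *β = ∫_M ⟨α, β⟩_x dx`. -/
abbrev l2Core (γ : Metric n M) : PreInnerProductSpace.Core ℝ (squareIntegrable γ) where
  inner α β := ∫ x, formInner γ x (α.1 x) (β.1 x) ∂riemVolume γ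
  conj_inner_symm α β := by
    simp only [conj_trivial]
    exact integral_congr_ae (Filter.Eventually.of_forall fun x => formInner_comm γ x _ _)
  re_inner_nonneg α := integral_nonneg fun x => formInner_self_nonneg γ x (α.1 x)
  add_left α α' β := by
    rw [← integral_add (integrable_formInner γ α.2.1 β.2.1 α.2.2 β.2.2)
      (integrable_formInner γ α'.2.1 β.2.1 α'.2.2 β.2.2)]
    exact integral_congr_ae (Filter.Eventually.of_forall fun x =>
      formInner_add_left γ x (α.1 x) (α'.1 x) (β.1 x))
  smul_left α β r := by
    rw [conj_trivial, ← integral_const_mul]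
    exact integral_congr_ae (Filter.Eventually.of_forall fun x =>
      formInner_smul_left γ x r (α.1 x) (β.1 x))

instance (γ : Metric n M) : SeminormedAddCommGroup (squareIntegrable γ) :=
  @InnerProductSpace.Core.toSeminormedAddCommGroup ℝ _ _ _ _ (l2Core γ)

instance (γ : Metric n M) : InnerProductSpace ℝ (squareIntegrable γ) :=
  InnerProductSpace.ofCore (l2Core γ)

/-- `L²(M, Λ*)`: square integrable sections of `Λ* T^* M`, where sections `α`, `β` with
`∫_M |α - β|² = 0` (that is, which agree almost everywhere) are identified. -/
abbrev L2Forms (γ : Metric n M) : Type _ := SeparationQuotient (squareIntegrable γ)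

/-- The class in `L²(M, Λ*)` of a square integrable section. -/
def toL2 (γ : Metric n M) (η : RoughForm n M) (h : η ∈ squareIntegrable γ) : L2Forms γ :=
  SeparationQuotient.mk ⟨η, h⟩

/-! ### Invariant forms, and the operator `P_f` -/

variable {G : Type*} [Group G] [MulAction G M]

/-- `(g^* η)(x) = η(gx) ∘ Λ*(dg_x)`. -/
def pullback (g : G) (η : RoughForm n M) : RoughForm n M := fun x k =>
  (η (g • x) k).compContinuousLinearMap (mfderiv (𝓡 n) (𝓡 n) (fun y : M => g • y) x)

variable (G) in
/-- Smooth `G`-invariant differential forms. -/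
def IsInvariantForm (s : RoughForm n M) : Prop :=
  IsSmoothForm s ∧ ∀ g : G, pullback g s = s

/-- The form `f s`. -/
def mulForm (f : M → ℝ) (s : RoughForm n M) : RoughForm n M := fun x => f x • s x

variable (G) in
/-- `H⁰_f(M, Λ*)^G`: the closure in `L²(M, Λ*)` of the space of all `f s`, for `s` a smooth
`G`-invariant form (with `f s` square integrable, which is automatic if `f` is continuous with
compact support). -/
def cutoffInvariant (γ : Metric n M) (f : M → ℝ) : Submodule ℝ (L2Forms γ) :=
  (Submodule.span ℝ {u : L2Forms γ | ∃ s : RoughForm n M, IsInvariantForm G s ∧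
    ∃ h : mulForm f s ∈ squareIntegrable γ, u = toL2 γ (mulForm f s) h}).topologicalClosure

variable [TopologicalSpace G] [MeasurableSpace G]

/-- `A(x) = (∫_G χ(g) f(gx)² dg)^{1/2}`. -/
def massFn (m : Measure G) (f : M → ℝ) (x : M) : ℝ :=
  √(∫ g, modularFn m g * f (g • x) ^ 2 ∂m)

/-- The integrand `χ(g) f(gx) μ(gx)`, an element of `Λ* T_x^* M`. -/
def projIntegrand (m : Measure G) (f : M → ℝ) (μ : RoughForm n M) (x : M) (g : G) :
    FormFiber n x :=
  (modularFn m g * f (g • x)) • pullback g μ x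

/-- `(P_f μ)(x) = f(x) A(x)^{-2} ∫_G χ(g) f(gx) μ(gx) dg`. -/
def projForm (m : Measure G) (f : M → ℝ) (μ : RoughForm n M) : RoughForm n M := fun x =>
  (f x / massFn m f x ^ 2) • ∫ g, projIntegrand m f μ x g ∂m

end Manifold

end EquivariantForms

set_option linter.unusedSectionVars false

namespace EquivariantForms

/-! ### Coordinate frames, Jacobians and Gram matrices -/

section Frames

variable {n : ℕ} {M : Type*} [TopologicalSpace M] [ChartedSpace (EuclideanSpace ℝ (Fin n)) M]
  [IsManifold (𝓡 n) ∞ M]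

/-! Write `P_f μ = f · E μ`, where `E μ` (`avgForm`) is the weighted average of `μ` along the orbit.
Because `χ` is multiplicative (`modularFn_mul`) and `dg` is right invariant, translating `x` by `h`
multiplies both `A(x)²` and the orbit integral by `χ(h)⁻¹`. The factors cancel and `E μ` is an
invariant form, whatever `μ` is (`pullback_avgForm`). Conversely, if `s` is invariant, the integrand
defining `P_f (f s)` is a scalar multiple of `s(x)` and the scalars integrate to `A(x)²`, so `P_f (f
s) = f s` (`projForm_mulForm_of_invariant`). Together these give `P_f² = P_f`, already for sections
and at every point.

The analysis takes place on `M × G` with the measure `χ(g) A(x)⁻² dx dg` (`kernelMeasure`). Since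
`A(gx)² = χ(g)⁻¹ A(x)²`, this measure is `A(gx)⁻² dx dg`. The involution `(x, g) ↦ (gx, g⁻¹)`
preserves it, because `G` preserves `dx` and inversion turns `dg` into `χ(g) dg`
(`measurePreserving_smulInv_kernelMeasure`). By Fubini, `⟨P_f μ, ν⟩₀` is the integral of `f(x) f(gx)
⟨μ(gx), ν(x)⟩_x` against this measure. As `G` acts by isometries, the involution exchanges `μ` and
`ν` in the integrand, and `P_f` is symmetric (`integral_formInner_projForm_comm`).

Boundedness uses the same measure. The fibre weights `χ(g) A(x)⁻² f(gx)² dg` have total mass one, so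
Cauchy–Schwarz on the orbit bounds `|P_f μ|²(x)` by `f(x)² A(x)⁻² ∫ χ(g) |μ(gx)|² dg`. By the
involution, the integral of this bound over `M` is exactly `‖μ‖²`
(`lintegral_normSqFn_projForm_le`). Finiteness of the total also gives convergence of the orbit
integral for almost every `x` with `f(x) ≠ 0`, and equivariance carries this to all of `M`, since
`f` vanishes identically on no orbit (`ae_lintegral_orbit_lt_top`).

For the range, properness makes the averaging integral locally an integral over a fixed compact
subset of `G`. So `E μ` is smooth when `μ` is (`isSmoothForm_avgForm`), and `P_f` maps smooth forms
to products `f s` with `s` smooth and invariant. Smooth forms are dense (`toL2_mem_of_isClosed`) and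
`P_f` is continuous, so the range lies in the closure of these products. The range is the closed
fixed space of `P_f` and contains every `f s`, which gives the other inclusion. -/

theorem coordVec_eq_mfderiv {c x : M} (hx : x ∈ (chartAt (EuclideanSpace ℝ (Fin n)) c).source)
    (i : Fin n) :
    coordVec c x i = mfderiv 𝓘(ℝ, EuclideanSpace ℝ (Fin n)) (𝓡 n)
      (chartAt (EuclideanSpace ℝ (Fin n)) c).symm (chartAt (EuclideanSpace ℝ (Fin n)) c x)
      (EuclideanSpace.basisFun (Fin n) ℝ i) := by
  have hx' : x ∈ (trivializationAt (EuclideanSpace ℝ (Fin n))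
      (fun x : M => TangentSpace (𝓡 n) x) c).baseSet := by
    simpa using hx
  have h := TangentBundle.symmL_trivializationAt (I := 𝓡 n) hx
  have h2 : coordVec c x i = (trivializationAt (EuclideanSpace ℝ (Fin n))
      (TangentSpace (𝓡 n)) c).symmL ℝ x (EuclideanSpace.basisFun (Fin n) ℝ i) := by
    unfold coordVec
    rw [Trivialization.localFrame_apply_of_mem_baseSet _ _ hx']
    simp only [Trivialization.basisAt, Module.Basis.map_apply, OrthonormalBasis.coe_toBasis]
    rw [Trivialization.symmL_apply _ hx']
    exact Trivialization.linearEquivAt_symm_apply _ _ _ _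
  rw [h2, h]
  simp only [mfderivWithin_univ, modelWithCornersSelf_coe, Set.range_id]
  rfl

/-- The Jacobian matrix of `φ : M → M` at `x` with respect to the charts centred at `c` and `c'`. -/
def jacobian (φ : M → M) (c c' x : M) : Matrix (Fin n) (Fin n) ℝ :=
  Matrix.of fun i j => (fderiv ℝ (chartAt (EuclideanSpace ℝ (Fin n)) c' ∘ φ ∘
    (chartAt (EuclideanSpace ℝ (Fin n)) c).symm) (chartAt (EuclideanSpace ℝ (Fin n)) c x)
      (EuclideanSpace.basisFun (Fin n) ℝ j)) i

/-- Chain rule for `φ ∘ e⁻¹ = e'⁻¹ ∘ (e' ∘ φ ∘ e⁻¹)`, valid near `e x`: coordinate vectors are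
derivatives of inverse charts, and the middle factor has the Jacobian as its matrix. -/
theorem mfderiv_coordVec {φ : M → M} {c c' x : M}
    (hx : x ∈ (chartAt (EuclideanSpace ℝ (Fin n)) c).source)
    (hx' : φ x ∈ (chartAt (EuclideanSpace ℝ (Fin n)) c').source)
    (hφ : MDifferentiableAt (𝓡 n) (𝓡 n) φ x) (j : Fin n) :
    mfderiv (𝓡 n) (𝓡 n) φ x (coordVec c x j) =
      ∑ i, jacobian φ c c' x i j • coordVec c' (φ x) i := by
  set e := chartAt (EuclideanSpace ℝ (Fin n)) c
  set e' := chartAt (EuclideanSpace ℝ (Fin n)) c'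
  have hex : e.symm (e x) = x := e.left_inv hx
  have hs : MDifferentiableAt 𝓘(ℝ, EuclideanSpace ℝ (Fin n)) (𝓡 n) e.symm (e x) :=
    mdifferentiableAt_atlas_symm (chart_mem_atlas _ c) (e.map_source hx)
  have hs' : MDifferentiableAt 𝓘(ℝ, EuclideanSpace ℝ (Fin n)) (𝓡 n) e'.symm (e' (φ x)) :=
    mdifferentiableAt_atlas_symm (chart_mem_atlas _ c') (e'.map_source hx')
  have he' : MDifferentiableAt (𝓡 n) 𝓘(ℝ, EuclideanSpace ℝ (Fin n)) e' (φ x) :=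
    mdifferentiableAt_atlas (chart_mem_atlas _ c') hx'
  have hφ1 : MDifferentiableAt (𝓡 n) (𝓡 n) φ (e.symm (e x)) := by rwa [hex]
  have h1 : MDifferentiableAt 𝓘(ℝ, EuclideanSpace ℝ (Fin n)) (𝓡 n) (φ ∘ e.symm) (e x) :=
    hφ1.comp _ hs
  have he'1 : MDifferentiableAt (𝓡 n) 𝓘(ℝ, EuclideanSpace ℝ (Fin n)) e' ((φ ∘ e.symm) (e x)) := by
    simpa [hex] using he'
  have h2 : MDifferentiableAt 𝓘(ℝ, EuclideanSpace ℝ (Fin n)) 𝓘(ℝ, EuclideanSpace ℝ (Fin n))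
      (e' ∘ φ ∘ e.symm) (e x) := he'1.comp _ h1
  have hpt : (e' ∘ φ ∘ e.symm) (e x) = e' (φ x) := by simp [hex]
  have hs'1 : MDifferentiableAt 𝓘(ℝ, EuclideanSpace ℝ (Fin n)) (𝓡 n) e'.symm
      ((e' ∘ φ ∘ e.symm) (e x)) := by rwa [hpt]
  have hev : φ ∘ e.symm =ᶠ[nhds (e x)] e'.symm ∘ (e' ∘ φ ∘ e.symm) := by
    have : (φ ∘ e.symm) ⁻¹' e'.source ∈ nhds (e x) :=
      h1.continuousAt.preimage_mem_nhds (e'.open_source.mem_nhds (by simpa [hex] using hx'))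
    filter_upwards [this] with y hy
    exact (e'.left_inv hy).symm
  have hd := hev.mfderiv_eq (I := 𝓘(ℝ, EuclideanSpace ℝ (Fin n))) (I' := 𝓡 n)
  rw [mfderiv_comp _ hφ1 hs, mfderiv_comp _ hs'1 h2] at hd
  have hv := DFunLike.congr_fun hd (EuclideanSpace.basisFun (Fin n) ℝ j)
  rw [mfderiv_eq_fderiv] at hv
  rw [coordVec_eq_mfderiv hx]
  simp only [coordVec_eq_mfderiv hx']
  have hb : ∀ (L : EuclideanSpace ℝ (Fin n) →L[ℝ] EuclideanSpace ℝ (Fin n))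
      (v : EuclideanSpace ℝ (Fin n)),
      L v = ∑ i, v i • L (EuclideanSpace.basisFun (Fin n) ℝ i) := fun L v => by
    conv_lhs => rw [← (EuclideanSpace.basisFun (Fin n) ℝ).sum_repr v]
    simp
  -- The points `e⁻¹ (e x)` and `x` are equal only propositionally, so the two derivatives live on
  -- different tangent spaces. All of these are definitionally the model space, where the
  -- derivatives can be compared.
  have a1 : (mfderiv (𝓡 n) (𝓡 n) φ (e.symm (e x)) :
      EuclideanSpace ℝ (Fin n) →L[ℝ] EuclideanSpace ℝ (Fin n)) = mfderiv (𝓡 n) (𝓡 n) φ x :=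
    congrArg (β := EuclideanSpace ℝ (Fin n) →L[ℝ] EuclideanSpace ℝ (Fin n))
      (fun p : M => mfderiv (𝓡 n) (𝓡 n) φ p) hex
  have a2 : (mfderiv 𝓘(ℝ, EuclideanSpace ℝ (Fin n)) (𝓡 n) e'.symm ((e' ∘ φ ∘ e.symm) (e x)) :
      EuclideanSpace ℝ (Fin n) →L[ℝ] EuclideanSpace ℝ (Fin n)) =
      mfderiv 𝓘(ℝ, EuclideanSpace ℝ (Fin n)) (𝓡 n) e'.symm (e' (φ x)) :=
    congrArg (β := EuclideanSpace ℝ (Fin n) →L[ℝ] EuclideanSpace ℝ (Fin n))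
      (fun p => mfderiv 𝓘(ℝ, EuclideanSpace ℝ (Fin n)) (𝓡 n) e'.symm p) hpt
  have hv1 : (mfderiv (𝓡 n) (𝓡 n) φ x : EuclideanSpace ℝ (Fin n) →L[ℝ] EuclideanSpace ℝ (Fin n))
      (mfderiv 𝓘(ℝ, EuclideanSpace ℝ (Fin n)) (𝓡 n) e.symm (e x)
        (EuclideanSpace.basisFun (Fin n) ℝ j)) =
      (mfderiv 𝓘(ℝ, EuclideanSpace ℝ (Fin n)) (𝓡 n) e'.symm (e' (φ x)) :
        EuclideanSpace ℝ (Fin n) →L[ℝ] EuclideanSpace ℝ (Fin n))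
        (fderiv ℝ (e' ∘ φ ∘ e.symm) (e x) (EuclideanSpace.basisFun (Fin n) ℝ j)) := by
    rw [← a1, ← a2]
    exact hv
  exact hv1.trans (hb _ _)

theorem coeff_comp_mfderiv (η : RoughForm n M) {φ : M → M} {c c' x : M}
    (hx : x ∈ (chartAt (EuclideanSpace ℝ (Fin n)) c).source)
    (hx' : φ x ∈ (chartAt (EuclideanSpace ℝ (Fin n)) c').source)
    (hφ : MDifferentiableAt (𝓡 n) (𝓡 n) φ x) (k : Fin (n + 1)) (I : Fin k → Fin n) :
    ((η (φ x) k).compContinuousLinearMap (mfderiv (𝓡 n) (𝓡 n) φ x))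
      (fun a => coordVec c x (I a)) =
      ∑ J : Fin k → Fin n, (∏ a, jacobian φ c c' x (J a) (I a)) * coeff η c' k J (φ x) := by
  refine Eq.trans ?_ (alt_map_sum (η (φ x) k) (coordVec c' (φ x)) (jacobian φ c c' x) I)
  simp only [← mfderiv_coordVec hx hx' hφ]
  rfl

/-- Bilinearity applied to the Jacobian expansion of both arguments. Its determinant supplies both
the change of variables for the Riemannian density and the invertibility of the Jacobian. -/
theorem gram_eq_jacobian (γ : Metric n M) {φ : M → M} {c c' x : M}
    (hx : x ∈ (chartAt (EuclideanSpace ℝ (Fin n)) c).source)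
    (hx' : φ x ∈ (chartAt (EuclideanSpace ℝ (Fin n)) c').source)
    (hφ : MDifferentiableAt (𝓡 n) (𝓡 n) φ x)
    (hiso : ∀ v w : TangentSpace (𝓡 n) x, γ.inner (φ x) (mfderiv (𝓡 n) (𝓡 n) φ x v)
      (mfderiv (𝓡 n) (𝓡 n) φ x w) = γ.inner x v w) :
    gram (fun v w => γ.inner x v w) (coordVec c x) =
      (jacobian φ c c' x).transpose *
        gram (fun v w => γ.inner (φ x) v w) (coordVec c' (φ x)) * jacobian φ c c' x := by
  ext i j
  simp only [gram, Matrix.of_apply]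
  rw [← hiso, mfderiv_coordVec hx hx' hφ, mfderiv_coordVec hx hx' hφ]
  change metricForm γ (φ x) _ _ = _
  simp only [map_sum, LinearMap.sum_apply, map_smul,
      LinearMap.smul_apply, smul_eq_mul, Matrix.mul_apply, Matrix.transpose_apply,
      Finset.sum_mul, Finset.mul_sum, Matrix.of_apply]
  refine Finset.sum_congr rfl fun x _ => Finset.sum_congr rfl fun y _ => ?_
  simp only [metricForm, LinearMap.mk₂_apply]
  ring

theorem gram_posDef (γ : Metric n M) (x : M) {b : Fin n → TangentSpace (𝓡 n) x}
    (hb : LinearIndependent ℝ b) : (gram (fun v w => γ.inner x v w) b).PosDef := by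
  refine Matrix.PosDef.of_dotProduct_mulVec_pos ?_ fun v hv => ?_
  · ext i j
    simp [gram, γ.symm x (b i)]
  · have hne : ∑ i, v i • b i ≠ 0 := fun h0 =>
      hv (funext (Fintype.linearIndependent_iff.1 hb v h0))
    have h := γ.pos x _ hne
    change 0 < metricForm γ x _ _ at h
    simp only [map_sum, LinearMap.sum_apply, map_smul, LinearMap.smul_apply, smul_eq_mul] at h
    simp only [dotProduct, Matrix.mulVec, gram, Matrix.of_apply, Pi.star_apply, star_trivial,
      Finset.mul_sum] at h ⊢
    rw [Finset.sum_comm]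
    refine h.trans_eq (Finset.sum_congr rfl fun x _ => Finset.sum_congr rfl fun y _ => ?_)
    simp only [metricForm, LinearMap.mk₂_apply]
    ring

theorem exists_orthonormal_frame (γ : Metric n M) (x : M) :
    ∃ u : Module.Basis (Fin n) ℝ (TangentSpace (𝓡 n) x),
      ∀ i j, γ.inner x (u i) (u j) = if i = j then 1 else 0 := by
  have hfin : FiniteDimensional ℝ (TangentSpace (𝓡 n) x) :=
    inferInstanceAs (FiniteDimensional ℝ (EuclideanSpace ℝ (Fin n)))
  have hrank : Module.finrank ℝ (TangentSpace (𝓡 n) x) = n :=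
    finrank_euclideanSpace_fin (𝕜 := ℝ) (n := n)
  have hsymm : LinearMap.IsSymm (metricForm γ x) := ⟨fun v w => γ.symm x v w⟩
  obtain ⟨v, hv⟩ := LinearMap.BilinForm.exists_orthogonal_basis (K := ℝ)
    (V := TangentSpace (𝓡 n) x) (B := metricForm γ x) hsymm
  let w := v.reindex (finCongr hrank)
  have hw : ∀ i j, i ≠ j → γ.inner x (w i) (w j) = 0 := fun i j hij => by
    have := hv (i := (finCongr hrank).symm i) (j := (finCongr hrank).symm j) (by simpa using hij)
    simpa [w, metricForm, Function.onFun] using this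
  have hpos : ∀ i, 0 < γ.inner x (w i) (w i) := fun i => γ.pos x _ (w.ne_zero i)
  refine ⟨w.isUnitSMul (w := fun i => (√(γ.inner x (w i) (w i)))⁻¹)
    fun i => (inv_ne_zero (Real.sqrt_pos.2 (hpos i)).ne').isUnit, fun i j => ?_⟩
  simp only [Module.Basis.isUnitSMul_apply, map_smul, smul_apply, smul_eq_mul]
  split_ifs with h
  · subst h
    have := Real.mul_self_sqrt (hpos i).le
    have h0 := (Real.sqrt_pos.2 (hpos i)).ne'
    field_simp
    nlinarith
  · simp [hw i j h]

/-- In an orthonormal frame the Gram matrix is the identity, so only the diagonal terms `I = J`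
survive. -/
theorem altInner_orthonormal (γ : Metric n M) (x : M) {k : ℕ}
    (u : Module.Basis (Fin n) ℝ (TangentSpace (𝓡 n) x))
    (hu : ∀ i j, γ.inner x (u i) (u j) = if i = j then 1 else 0)
    (b : Module.Basis (Fin n) ℝ (TangentSpace (𝓡 n) x))
    (α β : TangentSpace (𝓡 n) x [⋀^Fin k]→L[ℝ] ℝ) :
    altInner (fun v w => γ.inner x v w) b α β =
      (Nat.factorial k : ℝ)⁻¹ * ∑ I : Fin k → Fin n, α (fun a => u (I a)) * β (fun a => u (I a)) := by
  refine (altInner_eq (metricForm γ x) u b α β).trans ?_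
  have hG : gram (fun v w => metricForm γ x v w) u = 1 := by
    ext i j
    simp [gram, metricForm, hu, Matrix.one_apply]
  unfold altInner
  congr 1
  refine Finset.sum_congr rfl fun I _ => ?_
  rw [Finset.sum_eq_single I]
  · simp [hG]
  · intro J _ hJ
    obtain ⟨a, ha⟩ := Function.ne_iff.1 hJ
    rw [hG, inv_one, Finset.prod_eq_zero (Finset.mem_univ a), zero_mul, zero_mul]
    exact Matrix.one_apply_ne ha.symm
  · simp

/-- Hadamard's inequality for the coefficients of an alternating form. -/
theorem sq_apply_le_altInner (γ : Metric n M) (x : M) {k : ℕ}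
    (b : Module.Basis (Fin n) ℝ (TangentSpace (𝓡 n) x))
    (α : TangentSpace (𝓡 n) x [⋀^Fin k]→L[ℝ] ℝ) (v : Fin k → TangentSpace (𝓡 n) x) :
    α v ^ 2 ≤ Nat.factorial k * (∏ a, γ.inner x (v a) (v a)) *
      altInner (fun v w => γ.inner x v w) b α α := by
  obtain ⟨u, hu⟩ := exists_orthonormal_frame γ x
  rw [altInner_orthonormal γ x u hu]
  have hexp : ∀ a, v a = ∑ i, u.repr (v a) i • u i := fun a => (u.sum_repr (v a)).symm
  have hnorm : ∀ a, γ.inner x (v a) (v a) = ∑ i, u.repr (v a) i ^ 2 := fun a => by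
    conv_lhs => rw [hexp a]
    change metricForm γ x _ _ = _
    simp only [map_sum, LinearMap.sum_apply, map_smul, LinearMap.smul_apply, smul_eq_mul]
    simp [metricForm, hu, sq]
  have hα : α v = ∑ I : Fin k → Fin n, (∏ a, u.repr (v a) (I a)) * α (fun a => u (I a)) := by
    have h := α.toMultilinearMap.map_sum (fun a i => u.repr (v a) i • u i)
    have h2 : ∀ I : Fin k → Fin n, α.toMultilinearMap (fun a => u.repr (v a) (I a) • u (I a)) =
        (∏ a, u.repr (v a) (I a)) * α (fun a => u (I a)) := fun I => by
      have := α.toMultilinearMap.map_smul_univ (fun a => u.repr (v a) (I a)) (fun a => u (I a))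
      simpa using this
    simp only [h2, ← hexp] at h
    exact h
  have hprod : ∏ a, γ.inner x (v a) (v a) = ∑ I : Fin k → Fin n, (∏ a, u.repr (v a) (I a)) ^ 2 := by
    simp only [hnorm, Finset.prod_univ_sum, Fintype.piFinset_univ, Finset.prod_pow]
  have hfac : (Nat.factorial k : ℝ) ≠ 0 := by positivity
  rw [hα, hprod]
  -- Cauchy–Schwarz over multi-indices; the factor `k!` of the bound cancels the normalisation of
  -- the inner product.
  refine (Finset.sum_mul_sq_le_sq_mul_sq _ _ _).trans (le_of_eq ?_)
  simp only [sq]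
  field_simp

end Frames
end EquivariantForms

namespace EquivariantForms

/-! ### Riemannian measure: independence of charts, invariance under isometries, local finiteness -/

section Volume

variable {n : ℕ} {M : Type*} [TopologicalSpace M] [ChartedSpace (EuclideanSpace ℝ (Fin n)) M]
  [IsManifold (𝓡 n) ∞ M]

/-- The density `√det(g_{ij})` in the chart centred at `c`. -/
def chartDensity (γ : Metric n M) (c : M) (y : EuclideanSpace ℝ (Fin n)) : ENNReal :=
  ENNReal.ofReal √(gram (fun v w => γ.inner ((chartAt (EuclideanSpace ℝ (Fin n)) c).symm y) v w)
    (coordVec c ((chartAt (EuclideanSpace ℝ (Fin n)) c).symm y))).det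

theorem continuousOn_chartDensity_real (γ : Metric n M) (c : M) :
    ContinuousOn (fun y => √(gram
      (fun v w => γ.inner ((chartAt (EuclideanSpace ℝ (Fin n)) c).symm y) v w)
      (coordVec c ((chartAt (EuclideanSpace ℝ (Fin n)) c).symm y))).det)
      (chartAt (EuclideanSpace ℝ (Fin n)) c).target := by
  have hA : ContinuousOn (fun x => gram (fun v w => γ.inner x v w) (coordVec c x))
      (chartAt (EuclideanSpace ℝ (Fin n)) c).source :=
    continuousOn_pi.2 fun i => continuousOn_pi.2 fun j => continuousOn_metric γ c i j
  have h1 : ContinuousOn (fun x => √(gram (fun v w => γ.inner x v w) (coordVec c x)).det)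
      (chartAt (EuclideanSpace ℝ (Fin n)) c).source :=
    (Real.continuous_sqrt.comp (Continuous.matrix_det continuous_id)).comp_continuousOn hA
  exact h1.comp (chartAt (EuclideanSpace ℝ (Fin n)) c).continuousOn_symm
    (chartAt (EuclideanSpace ℝ (Fin n)) c).mapsTo_symm

theorem aemeasurable_chartDensity (γ : Metric n M) (c : M) :
    AEMeasurable (chartDensity γ c)
      (volume.restrict (chartAt (EuclideanSpace ℝ (Fin n)) c).target) :=
  ((continuousOn_chartDensity_real γ c).aemeasurable
    (chartAt (EuclideanSpace ℝ (Fin n)) c).open_target.measurableSet).ennreal_ofReal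

variable [MeasurableSpace M] [BorelSpace M]

theorem aemeasurable_chart_symm (c : M) (μ : Measure (EuclideanSpace ℝ (Fin n))) :
    AEMeasurable (chartAt (EuclideanSpace ℝ (Fin n)) c).symm
      (μ.restrict (chartAt (EuclideanSpace ℝ (Fin n)) c).target) :=
  (chartAt (EuclideanSpace ℝ (Fin n)) c).continuousOn_symm.aemeasurable
    (chartAt (EuclideanSpace ℝ (Fin n)) c).open_target.measurableSet

theorem lintegral_chartVolume (γ : Metric n M) (c : M) {F : M → ENNReal} (hF : Measurable F) :
    ∫⁻ x, F x ∂chartVolume γ c = ∫⁻ y in (chartAt (EuclideanSpace ℝ (Fin n)) c).target,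
      chartDensity γ c y * F ((chartAt (EuclideanSpace ℝ (Fin n)) c).symm y) := by
  have h1 := aemeasurable_chart_symm c (volume : Measure (EuclideanSpace ℝ (Fin n)))
  have h2 := aemeasurable_chartDensity γ c
  unfold chartVolume
  rw [lintegral_map' hF.aemeasurable (h1.mono_ac (withDensity_absolutelyContinuous _ _))]
  exact lintegral_withDensity_eq_lintegral_mul₀ h2 (hF.comp_aemeasurable h1)

theorem setLIntegral_eq_of_vanish {α : Type*} [MeasurableSpace α] {μ : Measure α} {s t : Set α}
    (hs : MeasurableSet s) (ht : MeasurableSet t) (hst : s ⊆ t) {h : α → ENNReal}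
    (h0 : ∀ y ∈ t, y ∉ s → h y = 0) : ∫⁻ y in t, h y ∂μ = ∫⁻ y in s, h y ∂μ := by
  rw [← lintegral_indicator ht, ← lintegral_indicator hs]
  congr 1
  ext y
  by_cases hy : y ∈ s
  · simp [hy, hst hy]
  · by_cases hy' : y ∈ t
    · simp [hy, hy', h0 y hy' hy]
    · simp [hy, hy']

/-- Change of variables for `φ` read in the two charts: by `gram_eq_jacobian`, the absolute Jacobian
determinant times the density at the image point is the density at the source. The vanishing of `F`
confines both integrals to the part of the charts matched by `φ`. -/
theorem lintegral_chartVolume_isometry (γ : Metric n M) {φ : M → M}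
    (hφ : MDifferentiable (𝓡 n) (𝓡 n) φ) (hinj : Function.Injective φ)
    (hiso : ∀ (x : M) (v w : TangentSpace (𝓡 n) x), γ.inner (φ x) (mfderiv (𝓡 n) (𝓡 n) φ x v)
      (mfderiv (𝓡 n) (𝓡 n) φ x w) = γ.inner x v w) (c c' : M) {F : M → ENNReal}
    (hF : Measurable F)
    (hF0 : ∀ x, x ∉ (chartAt (EuclideanSpace ℝ (Fin n)) c').source ∩
      φ '' (chartAt (EuclideanSpace ℝ (Fin n)) c).source → F x = 0) :
    ∫⁻ x, F x ∂chartVolume γ c' = ∫⁻ x, F (φ x) ∂chartVolume γ c := by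
  have hφc : Continuous φ := hφ.continuous
  rw [lintegral_chartVolume γ c' hF, lintegral_chartVolume γ c (F := fun x => F (φ x))
    (hF.comp hφc.measurable)]
  set e := chartAt (EuclideanSpace ℝ (Fin n)) c with he
  set e' := chartAt (EuclideanSpace ℝ (Fin n)) c' with he'
  set ψ : EuclideanSpace ℝ (Fin n) → EuclideanSpace ℝ (Fin n) := e' ∘ φ ∘ e.symm with hψ
  set s : Set (EuclideanSpace ℝ (Fin n)) := e.target ∩ e.symm ⁻¹' (φ ⁻¹' e'.source) with hs
  have hso : IsOpen s := e.isOpen_inter_preimage_symm (e'.open_source.preimage hφc)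
  have hdiff : ∀ y ∈ s, DifferentiableAt ℝ ψ y := fun y hy => by
    have h1 : MDifferentiableAt 𝓘(ℝ, EuclideanSpace ℝ (Fin n)) (𝓡 n) e.symm y :=
      mdifferentiableAt_atlas_symm (chart_mem_atlas _ c) hy.1
    have h2 : MDifferentiableAt (𝓡 n) 𝓘(ℝ, EuclideanSpace ℝ (Fin n)) e' (φ (e.symm y)) :=
      mdifferentiableAt_atlas (chart_mem_atlas _ c') hy.2
    exact (h2.comp y ((hφ _).comp y h1)).differentiableAt
  have hmaps : ∀ y ∈ s, e'.symm (ψ y) = φ (e.symm y) := fun y hy => e'.left_inv hy.2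
  have hψinj : Set.InjOn ψ s := fun y hy z hz h => by
    have h1 := congrArg e'.symm h
    rw [hmaps y hy, hmaps z hz] at h1
    exact e.symm.injOn hy.1 hz.1 (hinj h1)
  have hψm : MeasurableSet (ψ '' s) := measurable_image_of_fderivWithin hso.measurableSet
    (fun y hy => (hdiff y hy).hasFDerivAt.hasFDerivWithinAt) hψinj
  have hψt : ψ '' s ⊆ e'.target := by
    rintro _ ⟨y, hy, rfl⟩
    exact e'.map_source hy.2
  have hdens : ∀ y ∈ s, ENNReal.ofReal |(fderiv ℝ ψ y).det| * chartDensity γ c' (ψ y) =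
      chartDensity γ c y := fun y hy => by
    have hx : e.symm y ∈ e.source := e.map_target hy.1
    have hg := gram_eq_jacobian γ (c := c) (c' := c') hx hy.2 (hφ _) (hiso _)
    have hdet : (fderiv ℝ ψ y).det = (jacobian (n := n) φ c c' (e.symm y)).det := by
      rw [ContinuousLinearMap.det,
        ← LinearMap.det_toMatrix (EuclideanSpace.basisFun (Fin n) ℝ).toBasis]
      congr 1
      ext i j
      simp [LinearMap.toMatrix_apply, jacobian, ← he, ← he', e.right_inv hy.1, hψ]
    unfold chartDensity
    rw [← he, ← he', hmaps y hy, hg, Matrix.det_mul, Matrix.det_mul, Matrix.det_transpose, hdet,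
      ← ENNReal.ofReal_mul (abs_nonneg _)]
    congr 1
    rw [mul_comm (_ * _) (Matrix.det (jacobian _ _ _ _)), ← mul_assoc, Real.sqrt_mul (mul_self_nonneg _),
      Real.sqrt_mul_self_eq_abs]
  rw [setLIntegral_eq_of_vanish hψm e'.open_target.measurableSet hψt
      (h := fun y => chartDensity γ c' y * F (e'.symm y)),
    lintegral_image_eq_lintegral_abs_det_fderiv_mul volume hso.measurableSet
      (fun y hy => (hdiff y hy).hasFDerivAt.hasFDerivWithinAt) hψinj,
    setLIntegral_eq_of_vanish hso.measurableSet e.open_target.measurableSet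
      Set.inter_subset_left]
  · refine setLIntegral_congr_fun hso.measurableSet fun y hy => ?_
    rw [← mul_assoc, hdens y hy, hmaps y hy]
  · intro y hy hys
    rw [hF0, mul_zero]
    exact fun h => hys ⟨hy, h.1⟩
  · intro y hy hys
    rw [hF0, mul_zero]
    rintro ⟨-, x, hx, hxy⟩
    refine hys ⟨e x, ⟨e.map_source hx, ?_⟩, ?_⟩
    · simp only [Set.mem_preimage, e.left_inv hx, hxy]
      exact e'.map_target hy
    · simp only [hψ, Function.comp_apply, e.left_inv hx, hxy]
      exact e'.right_inv hy

theorem chartVolume_compl_source (γ : Metric n M) (c : M) :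
    chartVolume γ c (chartAt (EuclideanSpace ℝ (Fin n)) c).sourceᶜ = 0 := by
  have hm : MeasurableSet (chartAt (EuclideanSpace ℝ (Fin n)) c).sourceᶜ :=
    (chartAt (EuclideanSpace ℝ (Fin n)) c).open_source.measurableSet.compl
  rw [← lintegral_indicator_one hm, lintegral_chartVolume γ c (measurable_one.indicator hm)]
  rw [setLIntegral_congr_fun (g := 0)
    (chartAt (EuclideanSpace ℝ (Fin n)) c).open_target.measurableSet fun y hy => ?_]
  · simp
  · have := (chartAt (EuclideanSpace ℝ (Fin n)) c).map_target hy
    simp [this]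

theorem chartVolume_isometry (γ : Metric n M) {φ : M → M}
    (hφ : MDifferentiable (𝓡 n) (𝓡 n) φ) (hinj : Function.Injective φ)
    (hiso : ∀ (x : M) (v w : TangentSpace (𝓡 n) x), γ.inner (φ x) (mfderiv (𝓡 n) (𝓡 n) φ x v)
      (mfderiv (𝓡 n) (𝓡 n) φ x w) = γ.inner x v w) (c c' : M) {E : Set M}
    (hE : MeasurableSet E)
    (hE0 : E ⊆ (chartAt (EuclideanSpace ℝ (Fin n)) c').source ∩
      φ '' (chartAt (EuclideanSpace ℝ (Fin n)) c).source) :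
    chartVolume γ c' E = chartVolume γ c (φ ⁻¹' E) := by
  rw [← lintegral_indicator_one hE,
    ← lintegral_indicator_one (hφ.continuous.measurable hE),
    lintegral_chartVolume_isometry γ hφ hinj hiso c c' (measurable_one.indicator hE)]
  · rfl
  · intro x hx
    exact Set.indicator_of_notMem (fun h => hx (hE0 h)) _

/-- The identity is an isometry, so this is a case of the preceding change of variables. -/
theorem chartVolume_eq_of_subset (γ : Metric n M) (c c' : M) {E : Set M} (hE : MeasurableSet E)
    (hc : E ⊆ (chartAt (EuclideanSpace ℝ (Fin n)) c).source)
    (hc' : E ⊆ (chartAt (EuclideanSpace ℝ (Fin n)) c').source) :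
    chartVolume γ c' E = chartVolume γ c E :=
  chartVolume_isometry γ (φ := id) mdifferentiable_id Function.injective_id
    (fun x v w => by simp) c c' hE (by simpa using ⟨hc', hc⟩)

/-- The supremum clearly dominates each chart measure. For the converse, the chart measures are
glued along a countable measurable partition into a measure `ρ`; by agreement on overlaps `ρ`
restricts to each of them, so it dominates the supremum. -/
theorem riemVolume_apply_of_subset [SecondCountableTopology M] (γ : Metric n M) (c : M) {E : Set M}
    (hE : MeasurableSet E) (hc : E ⊆ (chartAt (EuclideanSpace ℝ (Fin n)) c).source) :
    riemVolume γ E = chartVolume γ c E := by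
  refine le_antisymm ?_ (Measure.le_iff'.1 (le_iSup (chartVolume γ) c) E)
  obtain ⟨s, hs, hU⟩ := TopologicalSpace.countable_cover_nhds
    (f := fun c : M => (chartAt (EuclideanSpace ℝ (Fin n)) c).source)
    (fun c => chart_source_mem_nhds _ c)
  have hne : s.Nonempty := by
    have : c ∈ ⋃ x ∈ s, (chartAt (EuclideanSpace ℝ (Fin n)) x).source := hU ▸ Set.mem_univ c
    simp only [Set.mem_iUnion] at this
    obtain ⟨x, hx, -⟩ := this
    exact ⟨x, hx⟩
  obtain ⟨u, rfl⟩ := hs.exists_eq_range hne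
  set D := disjointed (fun i => (chartAt (EuclideanSpace ℝ (Fin n)) (u i)).source) with hD
  have hDm : ∀ i, MeasurableSet (D i) := MeasurableSet.disjointed fun i =>
    (chartAt (EuclideanSpace ℝ (Fin n)) (u i)).open_source.measurableSet
  have hDu : ⋃ i, D i = Set.univ := by
    rw [hD, iUnion_disjointed, ← hU, Set.biUnion_range]
  have hDd : Pairwise (Function.onFun Disjoint D) := disjoint_disjointed _
  let ρ : Measure M := Measure.sum fun i => (chartVolume γ (u i)).restrict (D i)
  have key : ∀ (d : M) {E : Set M}, MeasurableSet E →
      E ⊆ (chartAt (EuclideanSpace ℝ (Fin n)) d).source → ρ E = chartVolume γ d E := by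
    intro d E hE hd
    simp only [ρ]
    rw [Measure.sum_apply _ hE]
    have h1 : ∀ i, (chartVolume γ (u i)).restrict (D i) E = chartVolume γ d (E ∩ D i) := fun i => by
      rw [Measure.restrict_apply hE]
      exact chartVolume_eq_of_subset γ d (u i) (hE.inter (hDm i))
        (Set.inter_subset_left.trans hd) (Set.inter_subset_right.trans (disjointed_subset _ i))
    simp only [h1]
    rw [← measure_iUnion (fun i j hij => (hDd hij).mono Set.inter_subset_right
      Set.inter_subset_right) fun i => hE.inter (hDm i), ← Set.inter_iUnion, hDu, Set.inter_univ]
  have hle : riemVolume γ ≤ ρ := by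
    refine iSup_le fun d => Measure.le_iff.2 fun E hE => ?_
    have hsm := (chartAt (EuclideanSpace ℝ (Fin n)) d).open_source.measurableSet
    calc chartVolume γ d E ≤ chartVolume γ d (E ∩ (chartAt (EuclideanSpace ℝ (Fin n)) d).source) +
          chartVolume γ d (chartAt (EuclideanSpace ℝ (Fin n)) d).sourceᶜ :=
          (measure_mono fun x hx => by
            by_cases h : x ∈ (chartAt (EuclideanSpace ℝ (Fin n)) d).source
            · exact Or.inl ⟨hx, h⟩
            · exact Or.inr h).trans (measure_union_le _ _)
      _ = ρ (E ∩ (chartAt (EuclideanSpace ℝ (Fin n)) d).source) := by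
          rw [chartVolume_compl_source, add_zero, key d (hE.inter hsm) Set.inter_subset_right]
      _ ≤ ρ E := measure_mono Set.inter_subset_left
  exact (hle E).trans_eq (key c hE hc)

theorem measurePreserving_isometry [SecondCountableTopology M] (γ : Metric n M) (φ : M ≃ₜ M)
    (hφ : MDifferentiable (𝓡 n) (𝓡 n) φ)
    (hiso : ∀ (x : M) (v w : TangentSpace (𝓡 n) x), γ.inner (φ x) (mfderiv (𝓡 n) (𝓡 n) φ x v)
      (mfderiv (𝓡 n) (𝓡 n) φ x w) = γ.inner x v w) :
    MeasurePreserving φ (riemVolume γ) (riemVolume γ) := by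
  refine ⟨φ.continuous.measurable, ?_⟩
  -- A neighbourhood of `x` lying in one chart whose preimage under `φ` also lies in one chart.
  -- Countably many of these cover `M`, and on each the claim is the chart computation.
  let V : M → Set M := fun x => (chartAt (EuclideanSpace ℝ (Fin n)) x).source ∩
    φ '' (chartAt (EuclideanSpace ℝ (Fin n)) (φ.symm x)).source
  have hVo : ∀ x, IsOpen (V x) := fun x => (chartAt (EuclideanSpace ℝ (Fin n)) x).open_source.inter
    (φ.isOpenMap _ (chartAt (EuclideanSpace ℝ (Fin n)) (φ.symm x)).open_source)
  have hVx : ∀ x, x ∈ V x := fun x =>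
    ⟨mem_chart_source _ x, φ.symm x, mem_chart_source _ _, φ.apply_symm_apply x⟩
  obtain ⟨s, hs, hU⟩ := TopologicalSpace.countable_cover_nhds (f := V)
    (fun c => (hVo c).mem_nhds (hVx c))
  have : Countable s := hs.to_subtype
  rw [Set.biUnion_eq_iUnion] at hU
  refine Measure.ext_of_iUnion_eq_univ hU fun x => Measure.ext fun E hE => ?_
  have hEV := hE.inter (hVo x).measurableSet
  rw [Measure.restrict_apply hE, Measure.restrict_apply hE,
    Measure.map_apply φ.continuous.measurable hEV,
    riemVolume_apply_of_subset γ x.1 hEV (Set.inter_subset_right.trans Set.inter_subset_left),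
    chartVolume_isometry γ hφ φ.injective hiso (φ.symm x) x hEV Set.inter_subset_right]
  refine riemVolume_apply_of_subset γ _ (φ.continuous.measurable hEV) ?_
  rintro y ⟨-, -, z, hz, hzy⟩
  rwa [← φ.injective hzy]

/-- On the compact image of a small neighbourhood the chart density is continuous, hence integrable.
This makes the measure σ-finite, as Fubini requires, and makes continuous functions of compact
support integrable. -/
instance isLocallyFiniteMeasure_riemVolume [SecondCountableTopology M] [T2Space M] (γ : Metric n M) :
    IsLocallyFiniteMeasure (riemVolume γ) := by
  have : LocallyCompactSpace M := Manifold.locallyCompact_of_finiteDimensional (𝓡 n)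
  refine ⟨fun x => ?_⟩
  set e := chartAt (EuclideanSpace ℝ (Fin n)) x
  obtain ⟨K, hKx, hKs, hK⟩ := local_compact_nhds (chart_source_mem_nhds (EuclideanSpace ℝ (Fin n)) x)
  refine ⟨K, hKx, ?_⟩
  have hKim : IsCompact (e '' K) := hK.image_of_continuousOn (e.continuousOn.mono hKs)
  rw [riemVolume_apply_of_subset γ x hK.measurableSet hKs,
    ← lintegral_indicator_one hK.measurableSet,
    lintegral_chartVolume γ x (measurable_one.indicator hK.measurableSet)]
  have hsub : e '' K ⊆ e.target := by
    rintro _ ⟨y, hy, rfl⟩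
    exact e.map_source (hKs hy)
  rw [setLIntegral_eq_of_vanish hKim.measurableSet e.open_target.measurableSet hsub]
  · have hint := (((continuousOn_chartDensity_real γ x).mono hsub).integrableOn_compact hKim
      (μ := volume)).hasFiniteIntegral
    refine lt_of_le_of_lt (lintegral_mono fun y => ?_) hint
    refine (mul_le_of_le_one_right' (Set.indicator_le_self' (s := K) (f := 1)
      (fun _ _ => zero_le) (e.symm y))).trans ?_
    rw [← ofReal_norm]
    exact ENNReal.ofReal_le_ofReal (Real.le_norm_self _)
  · intro y hy hyK
    have : e.symm y ∉ K := fun h => hyK ⟨_, h, e.right_inv hy⟩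
    change _ * K.indicator 1 (e.symm y) = 0
    simp [this]

end Volume
end EquivariantForms

namespace EquivariantForms

/-! ### The function `χ` is a character -/

section Modular

variable {G : Type*} [Group G] [TopologicalSpace G] [MeasurableSpace G] [IsTopologicalGroup G]
  [T2Space G] [LocallyCompactSpace G] [SecondCountableTopology G] [BorelSpace G]
  (m : Measure G) [m.IsMulRightInvariant] [IsFiniteMeasureOnCompacts m] [m.IsOpenPosMeasure]

theorem modularFn_pos (g : G) : 0 < modularFn m g := (isInversionDensity_modularFn m).pos g

theorem continuous_modularFn : Continuous (modularFn m) := (isInversionDensity_modularFn m).continuous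

theorem lintegral_inv_eq (F : G → ENNReal) (hF : Measurable F) :
    ∫⁻ g, F g⁻¹ ∂m = ∫⁻ g, ENNReal.ofReal (modularFn m g) * F g ∂m := by
  have h := (isInversionDensity_modularFn m).inv_eq
  have h1 : ∫⁻ g, F g ∂m.inv = ∫⁻ g, F g⁻¹ ∂m := lintegral_map hF measurable_inv
  rw [← h1, h]
  exact lintegral_withDensity_eq_lintegral_mul _
    (continuous_modularFn m).measurable.ennreal_ofReal hF

/-- Equal densities agree almost everywhere, and continuous functions that agree almost everywhere
coincide because `m` charges open sets. Identities for `χ` can thus be checked under the integral.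
-/
theorem eq_of_lintegral_mul_eq {u v : G → ℝ} (hu : Continuous u) (hv : Continuous v)
    (hu0 : ∀ g, 0 ≤ u g) (hv0 : ∀ g, 0 ≤ v g)
    (h : ∀ F : G → ENNReal, Measurable F →
      ∫⁻ g, ENNReal.ofReal (u g) * F g ∂m = ∫⁻ g, ENNReal.ofReal (v g) * F g ∂m) : u = v := by
  refine Measure.eq_of_ae_eq (μ := m) ?_ hu hv
  have hw : m.withDensity (fun g => ENNReal.ofReal (u g)) =
      m.withDensity (fun g => ENNReal.ofReal (v g)) := by
    refine Measure.ext fun s hs => ?_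
    have := h (s.indicator 1) (measurable_one.indicator hs)
    rw [withDensity_apply _ hs, withDensity_apply _ hs, ← lintegral_indicator hs,
      ← lintegral_indicator hs]
    convert this using 2 <;> ext g <;> by_cases hg : g ∈ s <;> simp [hg]
  rw [withDensity_eq_iff_of_sigmaFinite (by fun_prop) (by fun_prop)] at hw
  filter_upwards [hw] with x hx
  exact (ENNReal.ofReal_eq_ofReal_iff (hu0 x) (hv0 x)).1 hx

/-- Inverting the variable twice returns the original integral and produces the factor `χ(g⁻¹)
χ(g)`. -/
theorem modularFn_inv_mul_self (g : G) : modularFn m g⁻¹ * modularFn m g = 1 := by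
  have hc := continuous_modularFn m
  refine congrFun (eq_of_lintegral_mul_eq m (u := fun g => modularFn m g⁻¹ * modularFn m g)
    (v := fun _ => 1) (by fun_prop) continuous_const
    (fun g => (mul_pos (modularFn_pos m _) (modularFn_pos m _)).le) (fun _ => zero_le_one)
    fun F hF => ?_) g
  have h1 := lintegral_inv_eq m (fun g => ENNReal.ofReal (modularFn m g⁻¹) * F g) (by fun_prop)
  have h2 := lintegral_inv_eq m (fun g => F g⁻¹) (by fun_prop)
  simp only [inv_inv] at h1 h2
  simp only [ENNReal.ofReal_one, one_mul, h2, h1, ENNReal.ofReal_mul (modularFn_pos m _).le]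
  refine lintegral_congr fun g => ?_
  ring

theorem modularFn_one : modularFn m (1 : G) = 1 := by
  have h := modularFn_inv_mul_self m (1 : G)
  have h0 := modularFn_pos m (1 : G)
  rw [inv_one] at h
  nlinarith

/-- The inverted measure is a left Haar measure, and so is its right translate by `h⁻¹`. Uniqueness
makes them proportional with some factor `c`; comparing densities gives `χ(gh) = c χ(g)`, and `g =
1` identifies `c = χ(h)`. -/
theorem modularFn_mul (g h : G) : modularFn m (g * h) = modularFn m g * modularFn m h := by
  have hc := continuous_modularFn m
  have hHaar : m.inv.IsHaarMeasure := {}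
  have hm : (m.inv.map (· * h⁻¹)).IsHaarMeasure := inferInstance
  obtain ⟨c, hct, hcm⟩ : ∃ c : ENNReal, c ≠ ⊤ ∧ m.inv.map (· * h⁻¹) = c • m.inv := by
    refine ⟨(Measure.haarScalarFactor (m.inv.map (· * h⁻¹)) m.inv : NNReal),
      ENNReal.coe_ne_top, Measure.isMulLeftInvariant_eq_smul _ _⟩
  have key : ∀ g, modularFn m (g * h) = c.toReal * modularFn m g := fun g => by
    refine congrFun (eq_of_lintegral_mul_eq m (u := fun g => modularFn m (g * h))
      (v := fun g => c.toReal * modularFn m g) (by fun_prop) (by fun_prop)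
      (fun g => (modularFn_pos m _).le)
      (fun g => mul_nonneg ENNReal.toReal_nonneg (modularFn_pos m _).le) fun F hF => ?_) g
    have h1 : ∫⁻ g, F g ∂(m.inv.map (· * h⁻¹)) = ∫⁻ g, F (g⁻¹ * h⁻¹) ∂m := by
      rw [lintegral_map hF (measurable_mul_const _)]
      exact lintegral_map (by fun_prop) measurable_inv
    have h2 := lintegral_inv_eq m (fun g => F (g * h⁻¹)) (by fun_prop)
    have h3 := lintegral_mul_right_eq_self (μ := m)
      (fun g => ENNReal.ofReal (modularFn m g) * F (g * h⁻¹)) h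
    have h4 : ∫⁻ g, F g ∂m.inv = ∫⁻ g, F g⁻¹ ∂m := lintegral_map hF measurable_inv
    simp only [mul_inv_cancel_right] at h3
    rw [h3, ← h2, ← h1, hcm, lintegral_smul_measure, h4, lintegral_inv_eq m F hF, smul_eq_mul,
      ← lintegral_const_mul _ (by fun_prop)]
    refine lintegral_congr fun g => ?_
    rw [ENNReal.ofReal_mul ENNReal.toReal_nonneg, ENNReal.ofReal_toReal hct, mul_assoc]
  have h1 := key 1
  rw [one_mul, modularFn_one, mul_one] at h1
  rw [key g, h1, mul_comm]

end Modular

/-! ### The involution of the product of space and group -/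

section Action

variable {G : Type*} [Group G] [TopologicalSpace G] [MeasurableSpace G] [IsTopologicalGroup G]
  [T2Space G] [LocallyCompactSpace G] [SecondCountableTopology G] [BorelSpace G]
  (m : Measure G) [m.IsMulRightInvariant] [IsFiniteMeasureOnCompacts m] [m.IsOpenPosMeasure]
  {X : Type*} [MeasurableSpace X] [MulAction G X]

/-- The involution `(x, g) ↦ (g x, g⁻¹)` of `X × G`. -/
def smulInv (p : X × G) : X × G := (p.2 • p.1, p.2⁻¹)

theorem smulInv_smulInv (p : X × G) : smulInv (smulInv p) = p := by
  simp [smulInv]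

/-- The measure `χ(g) a(x)⁻¹ dx dg` on `X × G`. -/
def weightedProd (ν : Measure X) (a : X → ℝ) : Measure (X × G) :=
  (ν.prod m).withDensity fun p => ENNReal.ofReal (modularFn m p.2 / a p.1)

variable [MeasurableSMul₂ G X]

theorem measurable_smulInv : Measurable (smulInv : X × G → X × G) :=
  (measurable_snd.smul measurable_fst).prodMk measurable_snd.inv

/-- A skew product: the base map is inversion, from `m` to `m.inv`, and each fibre map `x ↦ gx`
preserves `ν`. -/
theorem measurePreserving_smulInv (ν : Measure X) [SFinite ν]
    (hν : ∀ g : G, MeasurePreserving (fun x : X => g • x) ν ν) :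
    MeasurePreserving (smulInv : X × G → X × G) (ν.prod m) (ν.prod m.inv) := by
  have h1 : MeasurePreserving (fun p : G × X => (p.1⁻¹, p.1 • p.2)) (m.prod ν) (m.inv.prod ν) :=
    MeasurePreserving.skew_product ⟨measurable_inv, rfl⟩ measurable_smul
      (Filter.Eventually.of_forall fun g => (hν g).map_eq)
  exact (Measure.measurePreserving_swap.comp h1).comp Measure.measurePreserving_swap

theorem prod_inv_eq (ν : Measure X) [SFinite ν] :
    ν.prod m.inv = (ν.prod m).withDensity fun p => ENNReal.ofReal (modularFn m p.2) := by
  rw [(isInversionDensity_modularFn m).inv_eq,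
    prod_withDensity_right (continuous_modularFn m).measurable.ennreal_ofReal]

/-- By the transformation law of `a`, the weight at `(x, g)` equals `a(gx)⁻¹`, which depends only on
the first coordinate of the image point. The involution turns it into `a(x)⁻¹`, and the missing
factor `χ(g)` comes from the inverted Haar measure. -/
theorem measurePreserving_smulInv_weightedProd (ν : Measure X) [SFinite ν]
    (hν : ∀ g : G, MeasurePreserving (fun x : X => g • x) ν ν) {a : X → ℝ} (ha : Measurable a)
    (hainv : ∀ (g : G) x, a (g • x) = (modularFn m g)⁻¹ * a x) :
    MeasurePreserving (smulInv : X × G → X × G) (weightedProd m ν a) (weightedProd m ν a) := by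
  have hχ := (continuous_modularFn m).measurable
  have hw : Measurable fun p : X × G => ENNReal.ofReal (modularFn m p.2 / a p.1) := by fun_prop
  have hv : Measurable fun p : X × G => ENNReal.ofReal (a p.1)⁻¹ := by fun_prop
  have hT := measurePreserving_smulInv m ν hν
  refine ⟨measurable_smulInv, Measure.ext_of_lintegral _ fun Φ hΦ => ?_⟩
  rw [lintegral_map hΦ measurable_smulInv]
  unfold weightedProd
  rw [lintegral_withDensity_eq_lintegral_mul _ hw (g := fun p => Φ (smulInv p))
      (hΦ.comp measurable_smulInv),
    lintegral_withDensity_eq_lintegral_mul _ hw hΦ]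
  have e1 : ∀ p : X × G, ENNReal.ofReal (modularFn m p.2 / a p.1) =
      ENNReal.ofReal (a (smulInv p).1)⁻¹ := fun p => by
    simp only [smulInv, hainv, mul_inv, inv_inv]
    rfl
  have e2 := hT.lintegral_comp (f := fun p => ENNReal.ofReal (a p.1)⁻¹ * Φ p) (by fun_prop)
  rw [prod_inv_eq, lintegral_withDensity_eq_lintegral_mul _ (by fun_prop) (by fun_prop)] at e2
  refine Eq.trans ?_ (e2.trans ?_)
  · refine lintegral_congr fun p => ?_
    simp [e1]
  · refine lintegral_congr fun p => ?_
    simp only [Pi.mul_apply]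
    rw [← mul_assoc, ← ENNReal.ofReal_mul (modularFn_pos m _).le]
    rfl

theorem lintegral_weightedProd (ν : Measure X) [SFinite ν] {a : X → ℝ} (ha : Measurable a)
    {Φ : X × G → ENNReal} (hΦ : AEMeasurable Φ (ν.prod m)) :
    ∫⁻ p, Φ p ∂weightedProd m ν a =
      ∫⁻ x, ∫⁻ g, ENNReal.ofReal (modularFn m g / a x) * Φ (x, g) ∂m ∂ν := by
  have hχ := (continuous_modularFn m).measurable
  have hw : Measurable fun p : X × G => ENNReal.ofReal (modularFn m p.2 / a p.1) := by fun_prop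
  unfold weightedProd
  rw [lintegral_withDensity_eq_lintegral_mul₀ hw.aemeasurable hΦ,
    lintegral_prod _ (hw.aemeasurable.mul hΦ)]
  rfl

end Action
end EquivariantForms

namespace EquivariantForms

/-! ### The fibres of the form bundle: coefficients, integrals, norms -/

section Fiber

variable {n : ℕ}

variable (n) in
/-- The values of an alternating form on the tuples of standard basis vectors. -/
def modelCoeff : (∀ k : Fin (n + 1), EuclideanSpace ℝ (Fin n) [⋀^Fin k]→L[ℝ] ℝ) →ₗ[ℝ]
    ((Σ k : Fin (n + 1), Fin k → Fin n) → ℝ) where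
  toFun w i := w i.1 fun a => EuclideanSpace.basisFun (Fin n) ℝ (i.2 a)
  map_add' _ _ := rfl
  map_smul' _ _ := rfl

theorem modelCoeff_injective : Function.Injective (modelCoeff n) := by
  intro w w' h
  funext k
  apply ContinuousAlternatingMap.toAlternatingMap_injective
  refine Module.Basis.ext_alternating (EuclideanSpace.basisFun (Fin n) ℝ).toBasis fun I _ => ?_
  have := congrFun h ⟨k, I⟩
  simpa [modelCoeff] using this

variable {M : Type*} [TopologicalSpace M] [ChartedSpace (EuclideanSpace ℝ (Fin n)) M]
  [IsManifold (𝓡 n) ∞ M]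

instance (x : M) : FiniteDimensional ℝ (FormFiber n x) :=
  FiniteDimensional.of_injective (V := FormFiber n x) (modelCoeff n) modelCoeff_injective

/-- The coefficients of a form with respect to the frame of the chart centred at `c`. -/
def fiberCoeff (c x : M) : FormFiber n x →ₗ[ℝ] ((Σ k : Fin (n + 1), Fin k → Fin n) → ℝ) where
  toFun w i := w i.1 fun a => coordVec c x (i.2 a)
  map_add' _ _ := rfl
  map_smul' _ _ := rfl

theorem fiberCoeff_injective {c x : M} (hx : x ∈ (chartAt (EuclideanSpace ℝ (Fin n)) c).source) :
    Function.Injective (fiberCoeff (n := n) c x) := by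
  intro w w' h
  obtain ⟨b, hb⟩ := coordVec_eq hx
  funext k
  apply ContinuousAlternatingMap.toAlternatingMap_injective
  refine Module.Basis.ext_alternating b fun I _ => ?_
  have := congrFun h ⟨k, I⟩
  simpa [fiberCoeff, hb] using this

theorem exists_fiberCoeff_leftInverse {c x : M}
    (hx : x ∈ (chartAt (EuclideanSpace ℝ (Fin n)) c).source) :
    ∃ R : ((Σ k : Fin (n + 1), Fin k → Fin n) → ℝ) →ₗ[ℝ] FormFiber n x,
      ∀ w, R (fiberCoeff c x w) = w := by
  obtain ⟨R, hR⟩ := (fiberCoeff c x).exists_leftInverse_of_injective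
    (LinearMap.ker_eq_bot.2 (fiberCoeff_injective hx))
  exact ⟨R, fun w => LinearMap.congr_fun hR w⟩

/-- The coefficient map is injective on a finite-dimensional fibre and so has a continuous left
inverse. Fibre-valued integrals can therefore be studied through scalar coefficients. -/
theorem integrable_fiber_iff {Ω : Type*} [MeasurableSpace Ω] {μ : Measure Ω} {c x : M}
    (hx : x ∈ (chartAt (EuclideanSpace ℝ (Fin n)) c).source) {F : Ω → FormFiber n x} :
    Integrable F μ ↔ ∀ i, Integrable (fun t => fiberCoeff c x (F t) i) μ := by
  constructor
  · intro h i
    exact ((LinearMap.toContinuousLinearMap (LinearMap.proj i ∘ₗ fiberCoeff c x))).integrable_comp h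
  · intro h
    obtain ⟨R, hR⟩ := exists_fiberCoeff_leftInverse hx
    have h1 : Integrable (fun t => fiberCoeff c x (F t)) μ := Integrable.of_eval h
    have := (LinearMap.toContinuousLinearMap R).integrable_comp h1
    simpa [hR] using this

theorem fiberCoeff_integral {Ω : Type*} [MeasurableSpace Ω] {μ : Measure Ω} (c x : M)
    {F : Ω → FormFiber n x} (hF : Integrable F μ) (i) :
    fiberCoeff c x (∫ t, F t ∂μ) i = ∫ t, fiberCoeff c x (F t) i ∂μ :=
  ((LinearMap.toContinuousLinearMap
    (LinearMap.proj (R := ℝ) (φ := fun _ => ℝ) i ∘ₗ fiberCoeff c x)).integral_comp_comm hF).symm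

/-- The linear functional `⟨·, β⟩_x`. -/
def formInnerLeft (γ : Metric n M) (x : M) (β : FormFiber n x) : FormFiber n x →ₗ[ℝ] ℝ where
  toFun α := formInner γ x α β
  map_add' α α' := formInner_add_left γ x α α' β
  map_smul' r α := formInner_smul_left γ x r α β

theorem formInner_integral {Ω : Type*} [MeasurableSpace Ω] {μ : Measure Ω} (γ : Metric n M) (x : M)
    {F : Ω → FormFiber n x} (hF : Integrable F μ) (β : FormFiber n x) :
    formInner γ x (∫ t, F t ∂μ) β = ∫ t, formInner γ x (F t) β ∂μ :=
  ((LinearMap.toContinuousLinearMap (formInnerLeft γ x β)).integral_comp_comm hF).symm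

theorem integrable_formInner_left {Ω : Type*} [MeasurableSpace Ω] {μ : Measure Ω} (γ : Metric n M)
    (x : M) {F : Ω → FormFiber n x} (hF : Integrable F μ) (β : FormFiber n x) :
    Integrable (fun t => formInner γ x (F t) β) μ :=
  (LinearMap.toContinuousLinearMap (formInnerLeft γ x β)).integrable_comp hF

theorem altInner_le_formInner (γ : Metric n M) (x : M) (α : FormFiber n x) (k : Fin (n + 1)) :
    altInner (fun v w => γ.inner x v w) (coordVec x x) (α k) (α k) ≤ formInner γ x α α := by
  refine Finset.single_le_sum (f := fun k => altInner (fun v w => γ.inner x v w) (coordVec x x)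
    (α k) (α k)) (fun k _ => ?_) (Finset.mem_univ k)
  refine altInner_self_nonneg (metricForm γ x) (fun v w => γ.symm x v w) (fun v => ?_) (coordVec x x)
      (α k)
  rcases eq_or_ne v 0 with rfl | hv
  · simp
  · exact (γ.pos x v hv).le

theorem inner_self_nonneg' (γ : Metric n M) (x : M) (v : TangentSpace (𝓡 n) x) :
    0 ≤ γ.inner x v v := by
  rcases eq_or_ne v 0 with rfl | hv
  · simp
  · exact (γ.pos x v hv).le

theorem sq_apply_le_formInner (γ : Metric n M) (x : M) (α : FormFiber n x) (k : Fin (n + 1))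
    (v : Fin k → TangentSpace (𝓡 n) x) :
    α k v ^ 2 ≤ Nat.factorial k * (∏ a, γ.inner x (v a) (v a)) * formInner γ x α α := by
  obtain ⟨b, hb⟩ := coordVec_eq (mem_chart_source (EuclideanSpace ℝ (Fin n)) x)
  refine (sq_apply_le_altInner γ x b (α k) v).trans ?_
  refine mul_le_mul_of_nonneg_left ?_ (mul_nonneg (by positivity)
    (Finset.prod_nonneg fun a _ => inner_self_nonneg' γ x _))
  rw [← hb]
  exact altInner_le_formInner γ x α k

/-- Definiteness follows from the Hadamard bound, which controls every value of the form by its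
norm. -/
theorem formInner_self_eq_zero (γ : Metric n M) (x : M) {α : FormFiber n x}
    (h : formInner γ x α α = 0) : α = 0 := by
  funext k
  refine ContinuousAlternatingMap.ext fun v => ?_
  have := sq_apply_le_formInner γ x α k v
  rw [h, mul_zero] at this
  exact pow_eq_zero_iff two_ne_zero |>.1 (le_antisymm this (sq_nonneg _))

/-- The Gram constant bounding the coefficients in the chart centred at `c`. -/
def coeffBound (γ : Metric n M) (c : M) (k : Fin (n + 1)) (I : Fin k → Fin n) (x : M) : ℝ :=
  Nat.factorial k * ∏ a, γ.inner x (coordVec c x (I a)) (coordVec c x (I a))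

theorem continuousOn_coeffBound (γ : Metric n M) (c : M) (k : Fin (n + 1)) (I : Fin k → Fin n) :
    ContinuousOn (coeffBound γ c k I) (chartAt (EuclideanSpace ℝ (Fin n)) c).source :=
  continuousOn_const.mul (continuousOn_finsetProd _ fun _ _ => continuousOn_metric γ c _ _)

theorem sq_coeff_le (γ : Metric n M) (η : RoughForm n M) (c : M) (k : Fin (n + 1))
    (I : Fin k → Fin n) (x : M) :
    coeff η c k I x ^ 2 ≤ coeffBound γ c k I x * formInner γ x (η x) (η x) :=
  sq_apply_le_formInner γ x (η x) k _

theorem isUnit_det_jacobian (γ : Metric n M) {φ : M → M} {c c' x : M}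
    (hx : x ∈ (chartAt (EuclideanSpace ℝ (Fin n)) c).source)
    (hx' : φ x ∈ (chartAt (EuclideanSpace ℝ (Fin n)) c').source)
    (hφ : MDifferentiableAt (𝓡 n) (𝓡 n) φ x)
    (hiso : ∀ v w : TangentSpace (𝓡 n) x, γ.inner (φ x) (mfderiv (𝓡 n) (𝓡 n) φ x v)
      (mfderiv (𝓡 n) (𝓡 n) φ x w) = γ.inner x v w) :
    IsUnit (jacobian (n := n) φ c c' x).det := by
  obtain ⟨b, hb⟩ := coordVec_eq hx
  have h := (gram_posDef γ x b.linearIndependent).det_pos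
  rw [← hb, gram_eq_jacobian γ hx hx' hφ hiso, Matrix.det_mul] at h
  exact isUnit_iff_ne_zero.2 (right_ne_zero_of_mul h.ne')

/-- Isometries preserve the pointwise inner product. -/
theorem formInner_comp_mfderiv (γ : Metric n M) {φ : M → M} {x : M}
    (hφ : MDifferentiableAt (𝓡 n) (𝓡 n) φ x)
    (hiso : ∀ v w : TangentSpace (𝓡 n) x, γ.inner (φ x) (mfderiv (𝓡 n) (𝓡 n) φ x v)
      (mfderiv (𝓡 n) (𝓡 n) φ x w) = γ.inner x v w) (α β : FormFiber n (φ x)) :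
    formInner γ x (fun k => (α k).compContinuousLinearMap (mfderiv (𝓡 n) (𝓡 n) φ x))
      (fun k => (β k).compContinuousLinearMap (mfderiv (𝓡 n) (𝓡 n) φ x)) =
      formInner γ (φ x) α β := by
  have hx := mem_chart_source (EuclideanSpace ℝ (Fin n)) x
  have hx' := mem_chart_source (EuclideanSpace ℝ (Fin n)) (φ x)
  refine Finset.sum_congr rfl fun k _ => ?_
  -- The inner product at `φ x` is computed in the image of the coordinate frame at `x`. The
  -- isometry condition says that this frame has the same Gram matrix as the original one.
  have h := altInner_change (metricForm γ (φ x)) (coordVec (φ x) (φ x))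
    (fun j => mfderiv (𝓡 n) (𝓡 n) φ x (coordVec x x j)) (jacobian φ x (φ x) x)
    (isUnit_det_jacobian γ hx hx' hφ hiso) (fun j => mfderiv_coordVec hx hx' hφ j) (α k) (β k)
  refine Eq.trans ?_ h
  have hG : gram (fun v w => metricForm γ (φ x) v w)
      (fun j => mfderiv (𝓡 n) (𝓡 n) φ x (coordVec x x j)) =
      gram (fun v w => γ.inner x v w) (coordVec x x) := by
    ext i j
    exact hiso _ _
  unfold altInner
  rw [hG]
  rfl

end Fiber
end EquivariantForms

namespace EquivariantForms

/-! ### Pullback of forms by group elements -/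

section Pullback

variable {n : ℕ} {M : Type*} [TopologicalSpace M] [ChartedSpace (EuclideanSpace ℝ (Fin n)) M]
  [IsManifold (𝓡 n) ∞ M] {G : Type*} [Group G] [MulAction G M]

/-- The pullback of covectors by the differential of `y ↦ g y` at `x`. -/
def pullbackFiber (g : G) (x : M) : FormFiber n (g • x) →ₗ[ℝ] FormFiber n x where
  toFun w k := (w k).compContinuousLinearMap (mfderiv (𝓡 n) (𝓡 n) (fun y : M => g • y) x)
  map_add' _ _ := rfl
  map_smul' _ _ := rfl

theorem pullback_apply (g : G) (η : RoughForm n M) (x : M) :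
    pullback g η x = pullbackFiber g x (η (g • x)) := rfl

/-- Serves to move between points such as `(gh)x` and `g(hx)`: their fibres are indexed by different
expressions, but values on vectors of the model space can be compared without casts. -/
theorem RoughForm.apply_congr (η : RoughForm n M) {y y' : M} (h : y = y') (k : Fin (n + 1))
    (w : Fin k → EuclideanSpace ℝ (Fin n)) :
    (η y k : EuclideanSpace ℝ (Fin n) [⋀^Fin k]→L[ℝ] ℝ) w =
      (η y' k : EuclideanSpace ℝ (Fin n) [⋀^Fin k]→L[ℝ] ℝ) w := by
  subst h; rfl

theorem pullback_pullback (hd : ∀ g : G, MDifferentiable (𝓡 n) (𝓡 n) (fun y : M => g • y))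
    (g h : G) (η : RoughForm n M) : pullback h (pullback g η) = pullback (g * h) η := by
  funext x k
  refine ContinuousAlternatingMap.ext fun v => ?_
  have hcomp : (fun y : M => (g * h) • y) = (fun y : M => g • y) ∘ fun y : M => h • y := by
    funext y; exact mul_smul g h y
  have h1 : (mfderiv (𝓡 n) (𝓡 n) (fun y : M => (g * h) • y) x :
      EuclideanSpace ℝ (Fin n) →L[ℝ] EuclideanSpace ℝ (Fin n)) =
      (mfderiv (𝓡 n) (𝓡 n) (fun y : M => g • y) (h • x)).comp
        (mfderiv (𝓡 n) (𝓡 n) (fun y : M => h • y) x) :=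
    (congrArg (β := EuclideanSpace ℝ (Fin n) →L[ℝ] EuclideanSpace ℝ (Fin n))
      (fun φ : M → M => mfderiv (𝓡 n) (𝓡 n) φ x) hcomp).trans
      (mfderiv_comp x (hd g (h • x)) (hd h x))
  have h2 := RoughForm.apply_congr η (mul_smul g h x) k
    (fun a => mfderiv (𝓡 n) (𝓡 n) (fun y : M => (g * h) • y) x (v a))
  refine Eq.trans ?_ h2.symm
  change (η (g • h • x) k : EuclideanSpace ℝ (Fin n) [⋀^Fin k]→L[ℝ] ℝ) _ =
    (η (g • h • x) k : EuclideanSpace ℝ (Fin n) [⋀^Fin k]→L[ℝ] ℝ) _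
  congr 1
  funext a
  exact (congrArg (fun L : EuclideanSpace ℝ (Fin n) →L[ℝ] EuclideanSpace ℝ (Fin n) => L (v a))
    h1).symm

theorem pullback_one (η : RoughForm n M) : pullback (1 : G) η = η := by
  funext x k
  refine ContinuousAlternatingMap.ext fun v => ?_
  have hid : (fun y : M => (1 : G) • y) = id := by
    funext y; exact one_smul G y
  have h1 : (mfderiv (𝓡 n) (𝓡 n) (fun y : M => (1 : G) • y) x :
      EuclideanSpace ℝ (Fin n) →L[ℝ] EuclideanSpace ℝ (Fin n)) =
      ContinuousLinearMap.id ℝ (EuclideanSpace ℝ (Fin n)) := by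
    rw [hid]
    exact mfderiv_id
  have h2 := RoughForm.apply_congr η (one_smul G x) k
    (fun a => mfderiv (𝓡 n) (𝓡 n) (fun y : M => (1 : G) • y) x (v a))
  refine Eq.trans h2 ?_
  congr 1
  funext a
  exact congrArg (fun L : EuclideanSpace ℝ (Fin n) →L[ℝ] EuclideanSpace ℝ (Fin n) => L (v a)) h1

theorem formInner_pullback (γ : Metric n M)
    (hd : ∀ g : G, MDifferentiable (𝓡 n) (𝓡 n) (fun y : M => g • y))
    (hγ : ∀ (g : G) (x : M) (v w : TangentSpace (𝓡 n) x),
      γ.inner (g • x) (mfderiv (𝓡 n) (𝓡 n) (fun y : M => g • y) x v)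
        (mfderiv (𝓡 n) (𝓡 n) (fun y : M => g • y) x w) = γ.inner x v w)
    (g : G) (x : M) (α β : RoughForm n M) :
    formInner γ x (pullback g α x) (pullback g β x) =
      formInner γ (g • x) (α (g • x)) (β (g • x)) :=
  formInner_comp_mfderiv γ (hd g x) (hγ g x) (α (g • x)) (β (g • x))

/-- Pullback by an isometry preserves the pointwise norm, which is definite. -/
theorem pullbackFiber_injective (γ : Metric n M)
    (hd : ∀ g : G, MDifferentiable (𝓡 n) (𝓡 n) (fun y : M => g • y))
    (hγ : ∀ (g : G) (x : M) (v w : TangentSpace (𝓡 n) x),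
      γ.inner (g • x) (mfderiv (𝓡 n) (𝓡 n) (fun y : M => g • y) x v)
        (mfderiv (𝓡 n) (𝓡 n) (fun y : M => g • y) x w) = γ.inner x v w) (g : G) (x : M) :
    Function.Injective (pullbackFiber (n := n) g x) := by
  refine (injective_iff_map_eq_zero _).2 fun w hw => formInner_self_eq_zero γ (g • x) ?_
  have h := formInner_comp_mfderiv γ (hd g x) (hγ g x) w w
  rw [← h]
  change formInner γ x (pullbackFiber g x w) (pullbackFiber g x w) = 0
  rw [hw]
  simpa using formInner_smul_left γ x 0 0 0

/-- Pullback commutes with all (also divergent) integrals. -/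
theorem pullbackFiber_integral (γ : Metric n M)
    (hd : ∀ g : G, MDifferentiable (𝓡 n) (𝓡 n) (fun y : M => g • y))
    (hγ : ∀ (g : G) (x : M) (v w : TangentSpace (𝓡 n) x),
      γ.inner (g • x) (mfderiv (𝓡 n) (𝓡 n) (fun y : M => g • y) x v)
        (mfderiv (𝓡 n) (𝓡 n) (fun y : M => g • y) x w) = γ.inner x v w) (g : G) (x : M)
    {Ω : Type*} [MeasurableSpace Ω] (μ : Measure Ω) (F : Ω → FormFiber n (g • x)) :
    pullbackFiber g x (∫ t, F t ∂μ) = ∫ t, pullbackFiber g x (F t) ∂μ := by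
  have hfin : Module.finrank ℝ (FormFiber n (g • x)) = Module.finrank ℝ (FormFiber n x) := rfl
  -- An injection between fibres of equal finite dimension is an equivalence. Equivalences commute
  -- with the Bochner integral even when the integrand is not integrable, both sides then being the
  -- default value zero.
  exact ((LinearEquiv.ofInjectiveOfFinrankEq (pullbackFiber g x)
    (pullbackFiber_injective γ hd hγ g x) hfin).toContinuousLinearEquiv.integral_comp_comm F).symm

end Pullback

/-! ### The normalising function `A` -/

section Mass

variable {G : Type*} [Group G] [TopologicalSpace G] [MeasurableSpace G] [IsTopologicalGroup G]
  [T2Space G] [LocallyCompactSpace G] [SecondCountableTopology G] [BorelSpace G]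
  (m : Measure G) [m.IsMulRightInvariant] [IsFiniteMeasureOnCompacts m] [m.IsOpenPosMeasure]
  {M : Type*} [TopologicalSpace M] [T2Space M] [MulAction G M] [ProperSMul G M]

/-- Properness: the group elements that carry `x` into the compact support of `f` form a compact
set. -/
theorem hasCompactSupport_comp_smul {f : M → ℝ} (hfc : HasCompactSupport f)
    (x : M) : HasCompactSupport fun g : G => f (g • x) := by
  have hK := ProperSMul.isCompact_setOfPred_inter_nonempty (G := G) (isCompact_singleton (x := x))
    hfc
  refine HasCompactSupport.intro hK fun g hg => ?_
  by_contra h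
  refine hg ⟨g • x, Set.smul_mem_smul_set rfl, subset_tsupport f h⟩

theorem integrable_modularFn_mul {f : M → ℝ} (hf : Continuous f) (hfc : HasCompactSupport f)
    (x : M) : Integrable (fun g : G => modularFn m g * f (g • x) ^ 2) m := by
  have hχ := continuous_modularFn m
  refine Continuous.integrable_of_hasCompactSupport (by fun_prop) ?_
  refine (hasCompactSupport_comp_smul hfc x).mono fun g hg => ?_
  simp only [Function.mem_support] at hg ⊢
  exact fun h => hg (by simp [h])

theorem massFn_sq (f : M → ℝ) (x : M) :
    massFn m f x ^ 2 = ∫ g, modularFn m g * f (g • x) ^ 2 ∂m :=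
  Real.sq_sqrt (integral_nonneg fun g => mul_nonneg (modularFn_pos m g).le (sq_nonneg _))

theorem massFn_pos {f : M → ℝ} (hf : Continuous f) (hfc : HasCompactSupport f) {x : M} {g₀ : G}
    (hg₀ : f (g₀ • x) ≠ 0) : 0 < massFn m f x := by
  have hχ := continuous_modularFn m
  refine Real.sqrt_pos.2 ?_
  refine Continuous.integral_pos_of_hasCompactSupport_nonneg_nonzero (x := g₀) (by fun_prop) ?_
    (fun g => mul_nonneg (modularFn_pos m g).le (sq_nonneg _)) ?_
  · refine (hasCompactSupport_comp_smul hfc x).mono fun g hg => ?_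
    simp only [Function.mem_support] at hg ⊢
    exact fun h => hg (by simp [h])
  · exact mul_ne_zero (modularFn_pos m g₀).ne' (pow_ne_zero 2 hg₀)

/-- Substitute `h ↦ hg` in the right-invariant integral and use `χ(hg) = χ(h) χ(g)`. -/
theorem massFn_smul_sq (f : M → ℝ) (g : G) (x : M) :
    massFn m f (g • x) ^ 2 = (modularFn m g)⁻¹ * massFn m f x ^ 2 := by
  rw [massFn_sq, massFn_sq, ← integral_const_mul,
    ← integral_mul_right_eq_self (fun h => (modularFn m g)⁻¹ * (modularFn m h * f (h • x) ^ 2)) g]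
  refine integral_congr_ae (Filter.Eventually.of_forall fun h => ?_)
  have := (modularFn_pos m g).ne'
  simp only [modularFn_mul, mul_smul]
  field_simp

theorem measurable_massFn_sq [MeasurableSpace M] [BorelSpace M] [SecondCountableTopology M]
    {f : M → ℝ} (hf : Continuous f) : Measurable fun x => massFn m f x ^ 2 := by
  have hχ := continuous_modularFn m
  have hc : Continuous fun p : M × G => modularFn m p.2 * f (p.2 • p.1) ^ 2 := by fun_prop
  simp only [massFn_sq]
  exact (hc.stronglyMeasurable.integral_prod_right' (ν := m)).measurable

end Mass

/-! ### Averaging over orbits yields invariant forms -/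

section Average

variable {n : ℕ} {G : Type*} [Group G] [TopologicalSpace G] [MeasurableSpace G]
  [IsTopologicalGroup G]
  [T2Space G] [LocallyCompactSpace G] [SecondCountableTopology G] [BorelSpace G]
  (m : Measure G) [m.IsMulRightInvariant] [IsFiniteMeasureOnCompacts m] [m.IsOpenPosMeasure]
  {M : Type*} [TopologicalSpace M] [T2Space M] [ChartedSpace (EuclideanSpace ℝ (Fin n)) M]
  [IsManifold (𝓡 n) ∞ M] [MulAction G M] [ProperSMul G M]

/-- The weighted average `A(x)⁻² ∫_G χ(g) f(gx) μ(gx) dg`. -/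
def avgForm (f : M → ℝ) (μ : RoughForm n M) : RoughForm n M := fun x =>
  (massFn m f x ^ 2)⁻¹ • ∫ g, projIntegrand m f μ x g ∂m

theorem projForm_eq_mulForm (f : M → ℝ) (μ : RoughForm n M) :
    projForm m f μ = mulForm f (avgForm m f μ) := by
  funext x
  simp only [projForm, mulForm, avgForm, smul_smul, div_eq_mul_inv]

theorem pullbackFiber_projIntegrand
    (hd : ∀ g : G, MDifferentiable (𝓡 n) (𝓡 n) (fun y : M => g • y)) (f : M → ℝ)
    (μ : RoughForm n M) (g h : G) (x : M) :
    pullbackFiber h x (projIntegrand m f μ (h • x) g) =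
      (modularFn m h)⁻¹ • projIntegrand m f μ x (g * h) := by
  have h1 : pullbackFiber h x (pullback g μ (h • x)) = pullback (g * h) μ x :=
    congrFun (pullback_pullback hd g h μ) x
  have := (modularFn_pos m h).ne'
  rw [projIntegrand, projIntegrand, map_smul, h1, smul_smul (modularFn m h)⁻¹, modularFn_mul, mul_smul g h x]
  congr 1
  field_simp

/-- The orbit integral and `A²` both pick up the factor `χ(h)⁻¹`. The identity holds at every point,
including those where the integral diverges, because `pullbackFiber_integral` needs no
integrability. -/
theorem pullback_avgForm (γ : Metric n M)
    (hd : ∀ g : G, MDifferentiable (𝓡 n) (𝓡 n) (fun y : M => g • y))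
    (hγ : ∀ (g : G) (x : M) (v w : TangentSpace (𝓡 n) x),
      γ.inner (g • x) (mfderiv (𝓡 n) (𝓡 n) (fun y : M => g • y) x v)
        (mfderiv (𝓡 n) (𝓡 n) (fun y : M => g • y) x w) = γ.inner x v w)
    (f : M → ℝ) (μ : RoughForm n M) (h : G) :
    pullback h (avgForm m f μ) = avgForm m f μ := by
  funext x
  rw [pullback_apply, avgForm, map_smul, pullbackFiber_integral γ hd hγ]
  simp only [pullbackFiber_projIntegrand m hd]
  rw [integral_smul, integral_mul_right_eq_self (projIntegrand m f μ x) h, massFn_smul_sq,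
    smul_smul, mul_inv, inv_inv, mul_right_comm, mul_inv_cancel₀ (modularFn_pos m h).ne', one_mul]
  rfl

/-- Invariance takes `s(x)` out of the orbit integral, and what remains is `A(x)²`. -/
theorem projForm_mulForm_of_invariant {f : M → ℝ} (hA : ∀ x, 0 < massFn m f x)
    {s : RoughForm n M} (hs : ∀ g : G, pullback g s = s) :
    projForm m f (mulForm f s) = mulForm f s := by
  funext x
  have h1 : ∀ g, projIntegrand m f (mulForm f s) x g =
      (modularFn m g * f (g • x) ^ 2) • s x := fun g => by
    have : pullback g (mulForm f s) x = f (g • x) • s x := by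
      rw [pullback_apply]
      change pullbackFiber g x (f (g • x) • s (g • x)) = _
      rw [map_smul, ← pullback_apply, hs]
    rw [projIntegrand, this, smul_smul]
    congr 1
    ring
  simp only [projForm, h1, mulForm]
  rw [integral_smul_const, ← massFn_sq, smul_smul, div_mul_cancel₀ _ (pow_pos (hA x) 2).ne']

end Average
end EquivariantForms

namespace EquivariantForms

/-! ### Smooth dependence of integrals over compact sets on a parameter -/

section Parametric

variable {E : Type} [NormedAddCommGroup E] [NormedSpace ℝ E] {d : ℕ} {G : Type*}
  [TopologicalSpace G] [ChartedSpace (EuclideanSpace ℝ (Fin d)) G] [IsManifold (𝓡 d) ∞ G]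

/-- The manifold statement for derivatives of parametrised families, in which the tangent coordinate
changes are trivial because source and target are vector spaces. -/
theorem contMDiffAt_fderiv_snd {F' : Type*} [NormedAddCommGroup F'] [NormedSpace ℝ F']
    {F : G × E → F'} {p : G × E} (hF : ContMDiffAt ((𝓡 d).prod 𝓘(ℝ, E)) 𝓘(ℝ, F') ∞ F p) :
    ContMDiffAt ((𝓡 d).prod 𝓘(ℝ, E)) 𝓘(ℝ, E →L[ℝ] F') ∞
      (fun q : G × E => fderiv ℝ (fun z => F (q.1, z)) q.2) p := by
  have h1 : ContMDiffAt (((𝓡 d).prod 𝓘(ℝ, E)).prod 𝓘(ℝ, E)) 𝓘(ℝ, F') ∞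
      (Function.uncurry fun (q : G × E) (z : E) => F (q.1, z)) (p, p.2) := by
    have h2 : ContMDiffAt (((𝓡 d).prod 𝓘(ℝ, E)).prod 𝓘(ℝ, E)) ((𝓡 d).prod 𝓘(ℝ, E)) ∞
        (fun r : (G × E) × E => (r.1.1, r.2)) (p, p.2) :=
      (contMDiffAt_fst.comp _ contMDiffAt_fst).prodMk contMDiffAt_snd
    exact ContMDiffAt.comp (p, p.2) (g := F) hF h2
  have h := ContMDiffAt.mfderiv (m := ∞) (fun (q : G × E) (z : E) => F (q.1, z))
    (fun q : G × E => q.2) h1 contMDiffAt_snd (by simp)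
  simp only [mfderiv_eq_fderiv] at h
  have e := inTangentCoordinates_model_space (I := 𝓘(ℝ, E)) (I' := 𝓘(ℝ, F')) (fun q : G × E => q.2)
    (fun q : G × E => F (q.1, q.2)) (fun q => fderiv ℝ (fun z => F (q.1, z)) q.2) p
  exact Eq.subst (motive := fun φ : G × E → E →L[ℝ] F' =>
    ContMDiffAt ((𝓡 d).prod 𝓘(ℝ, E)) 𝓘(ℝ, E →L[ℝ] F') ∞ φ p) e h

variable [FiniteDimensional ℝ E] [MeasurableSpace G] [BorelSpace G] [T2Space G]
  (m : Measure G) [IsFiniteMeasureOnCompacts m]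

/-- Differentiation under the integral yields an integral of the same shape with values in `E →L[ℝ]
F'`; the induction on `r` therefore quantifies over all target spaces. The weight `a` does not
involve the parameter, so its continuity suffices, and that is all that is known of `χ`. -/
theorem contDiffOn_setIntegral_nat {K : Set G} (hK : IsCompact K) {a : G → ℝ} (ha : Continuous a)
    {Ω : Set E} (hΩ : IsOpen Ω) (r : ℕ) :
    ∀ {F' : Type} [NormedAddCommGroup F'] [NormedSpace ℝ F'] [CompleteSpace F'] {F : G × E → F'}
      (_ : ∀ g, ∀ y ∈ Ω, ContMDiffAt ((𝓡 d).prod 𝓘(ℝ, E)) 𝓘(ℝ, F') ∞ F (g, y)),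
      ContDiffOn ℝ r (fun y => ∫ g in K, a g • F (g, y) ∂m) Ω := by
  have hderiv : ∀ {F' : Type} [NormedAddCommGroup F'] [NormedSpace ℝ F'] [CompleteSpace F']
      {F : G × E → F'}
      (_ : ∀ g, ∀ y ∈ Ω, ContMDiffAt ((𝓡 d).prod 𝓘(ℝ, E)) 𝓘(ℝ, F') ∞ F (g, y)),
      ∀ y ∈ Ω, HasFDerivAt (fun y => ∫ g in K, a g • F (g, y) ∂m)
        (∫ g in K, a g • fderiv ℝ (fun z => F (g, z)) y ∂m) y := by
    intro F' _ _ _ F hF y₀ hy₀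
    have hD := fun g y hy => contMDiffAt_fderiv_snd (hF g y hy)
    have hslice : ∀ y ∈ Ω, Continuous fun g => F (g, y) := fun y hy =>
      continuous_iff_continuousAt.2 fun g => 
        ContinuousAt.comp (g := F) (f := fun g => (g, y)) (hF g y hy).continuousAt (by fun_prop)
    have hsliceD : ∀ y ∈ Ω, Continuous fun g => fderiv ℝ (fun z => F (g, z)) y := fun y hy =>
      continuous_iff_continuousAt.2 fun g =>
        ContinuousAt.comp (g := fun q : G × E => fderiv ℝ (fun z => F (q.1, z)) q.2)
          (f := fun g => (g, y)) (hD g y hy).continuousAt (by fun_prop)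
    obtain ⟨ε, hε, hball⟩ := Metric.isOpen_iff.1 hΩ y₀ hy₀
    have hcb : Metric.closedBall y₀ (ε / 2) ⊆ Ω :=
      (Metric.closedBall_subset_ball (half_lt_self hε)).trans hball
    have : ProperSpace E := FiniteDimensional.proper_real E
    have hcont : ContinuousOn (fun q : G × E => a q.1 • fderiv ℝ (fun z => F (q.1, z)) q.2)
        (K ×ˢ Metric.closedBall y₀ (ε / 2)) := fun q hq =>
      ((ha.comp continuous_fst).continuousAt.smul
        (hD q.1 q.2 (hcb hq.2)).continuousAt).continuousWithinAt
    -- The integrable majorant is a constant: the derivative is jointly continuous on the compact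
    -- product of `K` with a closed ball.
    obtain ⟨C, hC⟩ := (hK.prod (isCompact_closedBall y₀ (ε / 2))).exists_bound_of_continuousOn hcont
    have hKm := hK.measurableSet
    have hmeas : ∀ y ∈ Ω, AEStronglyMeasurable (fun g => a g • F (g, y)) (m.restrict K) :=
      fun y hy => (ha.smul (hslice y hy)).continuousOn.aestronglyMeasurable_of_isCompact hK hKm
    refine hasFDerivAt_integral_of_dominated_of_fderiv_le (𝕜 := ℝ)
      (F := fun y g => a g • F (g, y))
      (F' := fun y g => a g • fderiv ℝ (fun z => F (g, z)) y) (bound := fun _ => C)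
      (s := Metric.ball y₀ (ε / 2)) (Metric.ball_mem_nhds y₀ (half_pos hε)) ?_ ?_ ?_ ?_ ?_ ?_
    · filter_upwards [hΩ.mem_nhds hy₀] with y hy using hmeas y hy
    · exact (ha.smul (hslice y₀ hy₀)).continuousOn.integrableOn_compact hK
    · exact (ha.smul (hsliceD y₀ hy₀)).continuousOn.aestronglyMeasurable_of_isCompact hK hKm
    · filter_upwards [ae_restrict_mem hKm] with g hg y hy
      exact hC (g, y) ⟨hg, Metric.ball_subset_closedBall hy⟩
    · exact integrableOn_const hK.measure_lt_top.ne
    · filter_upwards [ae_restrict_mem hKm] with g hg y hy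
      have hy' : y ∈ Ω := hcb (Metric.ball_subset_closedBall hy)
      have h1 : ContMDiffAt 𝓘(ℝ, E) 𝓘(ℝ, F') ∞ (fun z => F (g, z)) y :=
        ContMDiffAt.comp y (g := F) (hF g y hy')
          (contMDiffAt_const.prodMk contMDiffAt_id)
      exact ((h1.contDiffAt.differentiableAt (by simp)).hasFDerivAt).const_smul (a g)
  induction r with
  | zero =>
    intro F' _ _ _ F hF
    rw [Nat.cast_zero, contDiffOn_zero]
    exact fun y hy => (hderiv hF y hy).continuousAt.continuousWithinAt
  | succ r ih =>
    intro F' _ _ _ F hF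
    rw [Nat.cast_succ, contDiffOn_succ_iff_fderiv_of_isOpen hΩ]
    refine ⟨fun y hy => (hderiv hF y hy).differentiableAt.differentiableWithinAt, by simp, ?_⟩
    refine (ih (F := fun q : G × E => fderiv ℝ (fun z => F (q.1, z)) q.2)
      fun g y hy => contMDiffAt_fderiv_snd (hF g y hy)).congr fun y hy => ?_
    exact (hderiv hF y hy).fderiv

theorem contDiffOn_setIntegral {K : Set G} (hK : IsCompact K) {a : G → ℝ} (ha : Continuous a)
    {Ω : Set E} (hΩ : IsOpen Ω) {F' : Type} [NormedAddCommGroup F'] [NormedSpace ℝ F']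
    [CompleteSpace F'] {F : G × E → F'}
    (hF : ∀ g, ∀ y ∈ Ω, ContMDiffAt ((𝓡 d).prod 𝓘(ℝ, E)) 𝓘(ℝ, F') ∞ F (g, y)) :
    ContDiffOn ℝ ∞ (fun y => ∫ g in K, a g • F (g, y) ∂m) Ω :=
  contDiffOn_infty.2 fun r => contDiffOn_setIntegral_nat m hK ha hΩ r hF

end Parametric

/-! ### Joint smoothness of pulled-back coefficients -/

section SmoothAction

variable {d n : ℕ} {G : Type*} [Group G] [TopologicalSpace G]
  [ChartedSpace (EuclideanSpace ℝ (Fin d)) G] [IsManifold (𝓡 d) ∞ G]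
  {M : Type*} [TopologicalSpace M] [ChartedSpace (EuclideanSpace ℝ (Fin n)) M]
  [IsManifold (𝓡 n) ∞ M] [MulAction G M]

theorem contMDiffAt_smul_chart_symm
    (hact : ContMDiff ((𝓡 d).prod (𝓡 n)) (𝓡 n) ∞ fun p : G × M => p.1 • p.2) (c : M) (g : G)
    {y : EuclideanSpace ℝ (Fin n)} (hy : y ∈ (chartAt (EuclideanSpace ℝ (Fin n)) c).target) :
    ContMDiffAt ((𝓡 d).prod 𝓘(ℝ, EuclideanSpace ℝ (Fin n))) (𝓡 n) ∞
      (fun q : G × EuclideanSpace ℝ (Fin n) =>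
        q.1 • (chartAt (EuclideanSpace ℝ (Fin n)) c).symm q.2) (g, y) := by
  have h1 : ContMDiffAt 𝓘(ℝ, EuclideanSpace ℝ (Fin n)) (𝓡 n) ∞
      (chartAt (EuclideanSpace ℝ (Fin n)) c).symm y :=
    contMDiffOn_chart_symm.contMDiffAt
      ((chartAt (EuclideanSpace ℝ (Fin n)) c).open_target.mem_nhds hy)
  have h2 : ContMDiffAt ((𝓡 d).prod 𝓘(ℝ, EuclideanSpace ℝ (Fin n))) ((𝓡 d).prod (𝓡 n)) ∞
      (fun q : G × EuclideanSpace ℝ (Fin n) =>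
        (q.1, (chartAt (EuclideanSpace ℝ (Fin n)) c).symm q.2)) (g, y) :=
    contMDiffAt_fst.prodMk (ContMDiffAt.comp (g, y) h1 contMDiffAt_snd)
  exact ContMDiffAt.comp (g, y) (hact _) h2

theorem contMDiffAt_jacobian
    (hact : ContMDiff ((𝓡 d).prod (𝓡 n)) (𝓡 n) ∞ fun p : G × M => p.1 • p.2) (c c' : M) (g : G)
    {y : EuclideanSpace ℝ (Fin n)} (hy : y ∈ (chartAt (EuclideanSpace ℝ (Fin n)) c).target)
    (hgy : g • (chartAt (EuclideanSpace ℝ (Fin n)) c).symm y ∈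
      (chartAt (EuclideanSpace ℝ (Fin n)) c').source) (i j : Fin n) :
    ContMDiffAt ((𝓡 d).prod 𝓘(ℝ, EuclideanSpace ℝ (Fin n))) 𝓘(ℝ, ℝ) ∞
      (fun q : G × EuclideanSpace ℝ (Fin n) => jacobian (fun x : M => q.1 • x) c c'
        ((chartAt (EuclideanSpace ℝ (Fin n)) c).symm q.2) i j) (g, y) := by
  set e := chartAt (EuclideanSpace ℝ (Fin n)) c
  set e' := chartAt (EuclideanSpace ℝ (Fin n)) c'
  have h1 : ContMDiffAt (𝓡 n) 𝓘(ℝ, EuclideanSpace ℝ (Fin n)) ∞ e' (g • e.symm y) :=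
    contMDiffOn_chart.contMDiffAt (e'.open_source.mem_nhds hgy)
  have h2 : ContMDiffAt ((𝓡 d).prod 𝓘(ℝ, EuclideanSpace ℝ (Fin n)))
      𝓘(ℝ, EuclideanSpace ℝ (Fin n)) ∞
      (fun q : G × EuclideanSpace ℝ (Fin n) => e' (q.1 • e.symm q.2)) (g, y) :=
    ContMDiffAt.comp (g, y) h1 (contMDiffAt_smul_chart_symm hact c g hy)
  have h3 := contMDiffAt_fderiv_snd h2
  let ev : (EuclideanSpace ℝ (Fin n) →L[ℝ] EuclideanSpace ℝ (Fin n)) →L[ℝ] ℝ :=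
    (EuclideanSpace.proj i).comp
      (ContinuousLinearMap.apply ℝ (EuclideanSpace ℝ (Fin n)) (EuclideanSpace.basisFun (Fin n) ℝ j))
  have h4 := ContMDiffAt.comp (g, y) (ev.contMDiff (n := ∞)).contMDiffAt h3
  refine h4.congr_of_eventuallyEq ?_
  have hev : ∀ᶠ q : G × EuclideanSpace ℝ (Fin n) in nhds (g, y), q.2 ∈ e.target :=
    continuousAt_snd.eventually (e.open_target.mem_nhds hy)
  filter_upwards [hev] with q hq
  simp only [jacobian, Matrix.of_apply]
  change (fderiv ℝ (e' ∘ (fun x : M => q.1 • x) ∘ e.symm) (e (e.symm q.2)) _) i = _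
  rw [e.right_inv hq]
  rfl

/-- Locally the pulled-back coefficients are polynomials in the Jacobian entries times coefficients
of `η` at the moved point, and each of these is smooth in the pair `(g, y)`. -/
theorem contMDiffAt_coeff_pullback
    (hact : ContMDiff ((𝓡 d).prod (𝓡 n)) (𝓡 n) ∞ fun p : G × M => p.1 • p.2) (c c' : M) (g : G)
    {y : EuclideanSpace ℝ (Fin n)} (hy : y ∈ (chartAt (EuclideanSpace ℝ (Fin n)) c).target)
    (hgy : g • (chartAt (EuclideanSpace ℝ (Fin n)) c).symm y ∈
      (chartAt (EuclideanSpace ℝ (Fin n)) c').source) {η : RoughForm n M}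
    (hη : ∀ k J, ContMDiffAt (𝓡 n) 𝓘(ℝ, ℝ) ∞ (coeff η c' k J)
      (g • (chartAt (EuclideanSpace ℝ (Fin n)) c).symm y)) (k : Fin (n + 1)) (I : Fin k → Fin n) :
    ContMDiffAt ((𝓡 d).prod 𝓘(ℝ, EuclideanSpace ℝ (Fin n))) 𝓘(ℝ, ℝ) ∞
      (fun q : G × EuclideanSpace ℝ (Fin n) => coeff (pullback q.1 η) c k I
        ((chartAt (EuclideanSpace ℝ (Fin n)) c).symm q.2)) (g, y) := by
  set e := chartAt (EuclideanSpace ℝ (Fin n)) c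
  set e' := chartAt (EuclideanSpace ℝ (Fin n)) c'
  have hs := contMDiffAt_smul_chart_symm hact c g hy
  have h1 : ContMDiffAt ((𝓡 d).prod 𝓘(ℝ, EuclideanSpace ℝ (Fin n))) 𝓘(ℝ, ℝ) ∞
      (fun q : G × EuclideanSpace ℝ (Fin n) => ∑ J : Fin k → Fin n,
        (∏ a, jacobian (fun x : M => q.1 • x) c c' (e.symm q.2) (J a) (I a)) *
          coeff η c' k J (q.1 • e.symm q.2)) (g, y) := by
    refine ContMDiffAt.sum fun J _ => ContMDiffAt.mul (ContMDiffAt.prod fun a _ => ?_) ?_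
    · exact contMDiffAt_jacobian hact c c' g hy hgy _ _
    · exact ContMDiffAt.comp (g, y) (hη k J) hs
  refine h1.congr_of_eventuallyEq ?_
  have hev : ∀ᶠ q : G × EuclideanSpace ℝ (Fin n) in nhds (g, y), q.2 ∈ e.target :=
    continuousAt_snd.eventually (e.open_target.mem_nhds hy)
  filter_upwards [hev, hs.continuousAt.eventually (e'.open_source.mem_nhds hgy)] with q hq hq'
  have hd : MDifferentiableAt (𝓡 n) (𝓡 n) (fun x : M => q.1 • x) (e.symm q.2) :=
    (ContMDiffAt.comp (e.symm q.2) (g := fun p : G × M => p.1 • p.2) (hact _)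
      (contMDiffAt_const.prodMk contMDiffAt_id)).mdifferentiableAt (by simp)
  exact coeff_comp_mfderiv η (e.map_target hq) hq' hd k I

end SmoothAction
end EquivariantForms

namespace EquivariantForms

/-! ### Averages of smooth forms are smooth -/

section SmoothAverage

variable {d n : ℕ} {G : Type*} [Group G] [TopologicalSpace G]
  [ChartedSpace (EuclideanSpace ℝ (Fin d)) G] [IsManifold (𝓡 d) ∞ G]
  [MeasurableSpace G] [IsTopologicalGroup G]
  [T2Space G] [LocallyCompactSpace G] [SecondCountableTopology G] [BorelSpace G]
  (m : Measure G) [m.IsMulRightInvariant] [IsFiniteMeasureOnCompacts m] [m.IsOpenPosMeasure]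
  {M : Type*} [TopologicalSpace M] [T2Space M] [ChartedSpace (EuclideanSpace ℝ (Fin n)) M]
  [IsManifold (𝓡 n) ∞ M] [MulAction G M] [ProperSMul G M]

/-- For `x` in a compact neighbourhood `L`, the integrand vanishes unless `gL` meets `S`. By
properness such `g` form a compact set independent of `x`, so the parametric integral over a compact
set applies. -/
theorem contMDiffOn_integral_modularFn (c : M) {S : Set M} (hS : IsCompact S) {H : G → M → ℝ}
    (hsupp : ∀ g x, H g x ≠ 0 → g • x ∈ S)
    (hH : ∀ g, ∀ y ∈ (chartAt (EuclideanSpace ℝ (Fin n)) c).target,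
      ContMDiffAt ((𝓡 d).prod 𝓘(ℝ, EuclideanSpace ℝ (Fin n))) 𝓘(ℝ, ℝ) ∞
        (fun q : G × EuclideanSpace ℝ (Fin n) =>
          H q.1 ((chartAt (EuclideanSpace ℝ (Fin n)) c).symm q.2)) (g, y)) :
    ContMDiffOn (𝓡 n) 𝓘(ℝ, ℝ) ∞ (fun x => ∫ g, modularFn m g * H g x ∂m)
      (chartAt (EuclideanSpace ℝ (Fin n)) c).source := by
  intro x₀ hx₀
  set e := chartAt (EuclideanSpace ℝ (Fin n)) c
  have : LocallyCompactSpace M := Manifold.locallyCompact_of_finiteDimensional (𝓡 n)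
  obtain ⟨L, hLx, hLs, hL⟩ := local_compact_nhds (e.open_source.mem_nhds hx₀)
  have hK := ProperSMul.isCompact_setOfPred_inter_nonempty (G := G) hL hS
  have h1 := contDiffOn_setIntegral (d := d) m hK (continuous_modularFn m) e.open_target
    (F := fun q : G × EuclideanSpace ℝ (Fin n) => H q.1 (e.symm q.2)) hH
  have h2 : ContMDiffAt (𝓡 n) 𝓘(ℝ, EuclideanSpace ℝ (Fin n)) ∞ e x₀ :=
    contMDiffOn_chart.contMDiffAt (e.open_source.mem_nhds hx₀)
  have h3 := ContMDiffAt.comp x₀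
    (h1.contDiffAt (e.open_target.mem_nhds (e.map_source hx₀))).contMDiffAt h2
  refine (h3.congr_of_eventuallyEq ?_).contMDiffWithinAt
  filter_upwards [hLx] with x hx
  simp only [Function.comp_apply, e.left_inv (hLs hx), smul_eq_mul]
  refine (setIntegral_eq_integral_of_forall_compl_eq_zero fun g hg => ?_).symm
  by_contra h
  exact hg ⟨g • x, Set.smul_mem_smul_set hx, hsupp g x (right_ne_zero_of_mul h)⟩

theorem contMDiff_massFn_sq
    (hact : ContMDiff ((𝓡 d).prod (𝓡 n)) (𝓡 n) ∞ fun p : G × M => p.1 • p.2) {f : M → ℝ}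
    (hf : ContMDiff (𝓡 n) 𝓘(ℝ, ℝ) ∞ f) (hfc : HasCompactSupport f) :
    ContMDiff (𝓡 n) 𝓘(ℝ, ℝ) ∞ fun x => massFn m f x ^ 2 := by
  simp only [massFn_sq]
  intro x
  refine (contMDiffOn_integral_modularFn (d := d) m x hfc (H := fun g x => f (g • x) ^ 2)
    (fun g x h => subset_tsupport f fun h0 => h (by simp [h0])) fun g y hy => ?_).contMDiffAt
      (chart_source_mem_nhds _ x)
  exact (ContMDiffAt.comp (g, y) hf.contMDiffAt (contMDiffAt_smul_chart_symm hact x g hy)).pow 2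

theorem contMDiffAt_cutoff_coeff
    (hact : ContMDiff ((𝓡 d).prod (𝓡 n)) (𝓡 n) ∞ fun p : G × M => p.1 • p.2) {f : M → ℝ}
    (hf : ContMDiff (𝓡 n) 𝓘(ℝ, ℝ) ∞ f) {μ : RoughForm n M} (hμ : IsSmoothForm μ) (c : M)
    (k : Fin (n + 1)) (I : Fin k → Fin n) (g : G) {y : EuclideanSpace ℝ (Fin n)}
    (hy : y ∈ (chartAt (EuclideanSpace ℝ (Fin n)) c).target) :
    ContMDiffAt ((𝓡 d).prod 𝓘(ℝ, EuclideanSpace ℝ (Fin n))) 𝓘(ℝ, ℝ) ∞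
        (fun q : G × EuclideanSpace ℝ (Fin n) =>
          f (q.1 • (chartAt (EuclideanSpace ℝ (Fin n)) c).symm q.2) *
          coeff (pullback q.1 μ) c k I ((chartAt (EuclideanSpace ℝ (Fin n)) c).symm q.2))
        (g, y) := by
  have hgy := mem_chart_source (EuclideanSpace ℝ (Fin n))
    (g • (chartAt (EuclideanSpace ℝ (Fin n)) c).symm y)
  refine ContMDiffAt.mul
    (ContMDiffAt.comp (g, y) hf.contMDiffAt (contMDiffAt_smul_chart_symm hact c g hy))
    (contMDiffAt_coeff_pullback hact c _ g hy hgy (fun k J => ?_) k I)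
  exact (hμ _ k J).contMDiffAt (chart_source_mem_nhds _ _)

theorem integrable_projIntegrand_of_isSmoothForm
    (hact : ContMDiff ((𝓡 d).prod (𝓡 n)) (𝓡 n) ∞ fun p : G × M => p.1 • p.2) {f : M → ℝ}
    (hf : ContMDiff (𝓡 n) 𝓘(ℝ, ℝ) ∞ f) (hfc : HasCompactSupport f) {μ : RoughForm n M}
    (hμ : IsSmoothForm μ) (x : M) : Integrable (projIntegrand m f μ x) m := by
  refine (integrable_fiber_iff (mem_chart_source (EuclideanSpace ℝ (Fin n)) x)).2 fun i => ?_
  have hχ := continuous_modularFn m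
  have hxx := mem_chart_source (EuclideanSpace ℝ (Fin n)) x
  have hc : Continuous fun g : G => f (g • x) * coeff (pullback g μ) x i.1 i.2 x := by
    refine continuous_iff_continuousAt.2 fun g => ?_
    have h := (contMDiffAt_cutoff_coeff hact hf hμ x i.1 i.2 g
      (mem_chart_target (EuclideanSpace ℝ (Fin n)) x)).continuousAt
    have h2 := ContinuousAt.comp (f := fun g : G => (g, chartAt (EuclideanSpace ℝ (Fin n)) x x))
      (x := g) h (by fun_prop)
    simpa [Function.comp_def, (chartAt (EuclideanSpace ℝ (Fin n)) x).left_inv hxx] using h2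
  have hcs : HasCompactSupport fun g : G => f (g • x) * coeff (pullback g μ) x i.1 i.2 x :=
    (hasCompactSupport_comp_smul hfc x).mul_right
  refine ((hχ.mul hc).integrable_of_hasCompactSupport hcs.mul_left).congr
    (Filter.Eventually.of_forall fun g => ?_)
  simp only [projIntegrand, map_smul, Pi.smul_apply, smul_eq_mul, mul_assoc]
  rfl

/-- Taking coefficients commutes with the orbit integral, which converges at every point for smooth
`μ`. The factor `f(gx)` supplies the compact support, so none is needed for `μ`. -/
theorem isSmoothForm_avgForm
    (hact : ContMDiff ((𝓡 d).prod (𝓡 n)) (𝓡 n) ∞ fun p : G × M => p.1 • p.2) {f : M → ℝ}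
    (hf : ContMDiff (𝓡 n) 𝓘(ℝ, ℝ) ∞ f) (hfc : HasCompactSupport f)
    (hA : ∀ x, 0 < massFn m f x) {μ : RoughForm n M}
    (hμ : IsSmoothForm μ) : IsSmoothForm (avgForm m f μ) := by
  intro c k I
  have h1 := contMDiffOn_integral_modularFn (d := d) m c hfc
    (H := fun g x => f (g • x) * coeff (pullback g μ) c k I x)
    (fun g x h => subset_tsupport f (left_ne_zero_of_mul h))
    fun g y hy => contMDiffAt_cutoff_coeff hact hf hμ c k I g hy
  have h2 : ContMDiff (𝓡 n) 𝓘(ℝ, ℝ) ∞ fun x => (massFn m f x ^ 2)⁻¹ :=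
    (contMDiff_massFn_sq m hact hf hfc).inv₀ fun x => (pow_pos (hA x) 2).ne'
  refine (h2.contMDiffOn.mul h1).congr fun x _ => ?_
  have h3 := fiberCoeff_integral c x
    (integrable_projIntegrand_of_isSmoothForm m hact hf hfc hμ x) ⟨k, I⟩
  have h4 : coeff (avgForm m f μ) c k I x =
      (massFn m f x ^ 2)⁻¹ * fiberCoeff c x (∫ g, projIntegrand m f μ x g ∂m) ⟨k, I⟩ := rfl
  rw [h4, h3]
  congr 1
  refine integral_congr_ae (Filter.Eventually.of_forall fun g => ?_)
  simp only [projIntegrand, map_smul, Pi.smul_apply, smul_eq_mul, mul_assoc]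
  rfl

theorem continuousOn_jacobian
    (hact : ContMDiff ((𝓡 d).prod (𝓡 n)) (𝓡 n) ∞ fun p : G × M => p.1 • p.2) (c c' : M)
    (i j : Fin n) :
    ContinuousOn (fun p : M × G => jacobian (fun y : M => p.2 • y) c c' p.1 i j)
      {p | p.1 ∈ (chartAt (EuclideanSpace ℝ (Fin n)) c).source ∧
        p.2 • p.1 ∈ (chartAt (EuclideanSpace ℝ (Fin n)) c').source} := by
  rintro ⟨x, g⟩ ⟨hx, hgx⟩
  set e := chartAt (EuclideanSpace ℝ (Fin n)) c
  have h := (contMDiffAt_jacobian hact c c' g (e.map_source hx)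
    (by rwa [e.left_inv hx]) i j).continuousAt
  have h2 := ContinuousAt.comp (f := fun p : M × G => (p.2, e p.1)) (x := (x, g)) h
    (continuousAt_snd.prodMk ((e.continuousAt hx).comp continuousAt_fst))
  refine (h2.continuousWithinAt).congr (fun p hp => ?_) ?_
  · simp [e.left_inv hp.1, ← show e = chartAt (EuclideanSpace ℝ (Fin n)) c from rfl]
  · simp [e.left_inv hx, ← show e = chartAt (EuclideanSpace ℝ (Fin n)) c from rfl]

end SmoothAverage
end EquivariantForms

namespace EquivariantForms

/-! ### Continuity of the pointwise inner product in charts -/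

section Weights

variable {n : ℕ} {M : Type*} [TopologicalSpace M] [ChartedSpace (EuclideanSpace ℝ (Fin n)) M]
  [IsManifold (𝓡 n) ∞ M]

/-- The coefficient of `α_I β_J` in the pointwise inner product, in the chart centred at `c`. -/
def metricWeight (γ : Metric n M) (c : M) (k : Fin (n + 1)) (I J : Fin k → Fin n) (x : M) : ℝ :=
  (Nat.factorial k : ℝ)⁻¹ *
    ∏ a, (gram (fun v w => γ.inner x v w) (coordVec c x))⁻¹ (I a) (J a)

theorem formInner_eq_sum (γ : Metric n M) {c x : M}
    (hx : x ∈ (chartAt (EuclideanSpace ℝ (Fin n)) c).source) (α β : FormFiber n x) :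
    formInner γ x α β = ∑ k : Fin (n + 1), ∑ I : Fin k → Fin n, ∑ J : Fin k → Fin n,
      metricWeight γ c k I J x * α k (fun a => coordVec c x (I a)) *
        β k (fun a => coordVec c x (J a)) := by
  rw [formInner_eq γ hx]
  refine Finset.sum_congr rfl fun k _ => ?_
  simp only [altInner, metricWeight, Finset.mul_sum]
  refine Finset.sum_congr rfl fun I _ => Finset.sum_congr rfl fun J _ => ?_
  ring

/-- Cramer's rule: the inverse Gram matrix is the adjugate over a determinant that is positive on
the chart domain. -/
theorem continuousOn_metricWeight (γ : Metric n M) (c : M) (k : Fin (n + 1))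
    (I J : Fin k → Fin n) :
    ContinuousOn (metricWeight γ c k I J) (chartAt (EuclideanSpace ℝ (Fin n)) c).source := by
  have hA : ContinuousOn (fun x => gram (fun v w => γ.inner x v w) (coordVec c x))
      (chartAt (EuclideanSpace ℝ (Fin n)) c).source :=
    continuousOn_pi.2 fun i => continuousOn_pi.2 fun j => continuousOn_metric γ c i j
  refine continuousOn_const.mul (continuousOn_finsetProd _ fun a _ => ?_)
  have h1 : ContinuousOn (fun x => (gram (fun v w => γ.inner x v w) (coordVec c x)).det)
      (chartAt (EuclideanSpace ℝ (Fin n)) c).source :=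
    (Continuous.matrix_det continuous_id).comp_continuousOn hA
  have h2 : ContinuousOn
      (fun x => (gram (fun v w => γ.inner x v w) (coordVec c x)).adjugate (I a) (J a))
      (chartAt (EuclideanSpace ℝ (Fin n)) c).source :=
    ((Continuous.matrix_adjugate continuous_id).matrix_elem (I a) (J a)).comp_continuousOn hA
  refine ((h1.inv₀ fun x hx => ?_).mul h2).congr fun x _ => ?_
  · obtain ⟨b, hb⟩ := coordVec_eq hx
    rw [hb]
    exact (gram_posDef γ x b.linearIndependent).det_pos.ne'
  · simp [Matrix.inv_def, Ring.inverse_eq_inv']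

theorem continuousOn_coeff {η : RoughForm n M} (hη : IsSmoothForm η) (c : M) (k : Fin (n + 1))
    (I : Fin k → Fin n) :
    ContinuousOn (coeff η c k I) (chartAt (EuclideanSpace ℝ (Fin n)) c).source :=
  (hη c k I).continuousOn

theorem continuous_formInner_of_isSmoothForm (γ : Metric n M) {α β : RoughForm n M}
    (hα : IsSmoothForm α) (hβ : IsSmoothForm β) :
    Continuous fun x => formInner γ x (α x) (β x) := by
  refine continuous_iff_continuousAt.2 fun c => ?_
  have h : ContinuousOn (fun x => formInner γ x (α x) (β x))
      (chartAt (EuclideanSpace ℝ (Fin n)) c).source := by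
    refine ContinuousOn.congr (f := fun x => ∑ k : Fin (n + 1), ∑ I : Fin k → Fin n,
      ∑ J : Fin k → Fin n, metricWeight γ c k I J x * coeff α c k I x * coeff β c k J x) ?_
      fun x hx => formInner_eq_sum γ hx _ _
    refine continuousOn_finsetSum _ fun k _ => continuousOn_finsetSum _ fun I _ =>
      continuousOn_finsetSum _ fun J _ => ?_
    exact ((continuousOn_metricWeight γ c k I J).mul (continuousOn_coeff hα c k I)).mul
      (continuousOn_coeff hβ c k J)
  exact h.continuousAt (chart_source_mem_nhds _ c)

theorem isMeasurableForm_of_isSmoothForm [MeasurableSpace M] [BorelSpace M]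
    [SecondCountableTopology M] (γ : Metric n M)
    {η : RoughForm n M} (hη : IsSmoothForm η) : IsMeasurableForm γ η := fun c k I =>
  (continuousOn_coeff hη c k I).aestronglyMeasurable
    (chartAt (EuclideanSpace ℝ (Fin n)) c).open_source.measurableSet

theorem isSmoothForm_mulForm {f : M → ℝ} (hf : ContMDiff (𝓡 n) 𝓘(ℝ, ℝ) ∞ f) {s : RoughForm n M}
    (hs : IsSmoothForm s) : IsSmoothForm (mulForm f s) := fun c k I =>
  (hf.contMDiffOn.mul (hs c k I)).congr fun _ _ => rfl

theorem formInner_mulForm (γ : Metric n M) (f : M → ℝ) (s : RoughForm n M) (x : M) :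
    formInner γ x (mulForm f s x) (mulForm f s x) = f x ^ 2 * formInner γ x (s x) (s x) := by
  rw [mulForm, formInner_smul_left, formInner_comm, formInner_smul_left]
  ring

theorem mulForm_mem_squareIntegrable [MeasurableSpace M] [BorelSpace M]
    [SecondCountableTopology M] [T2Space M] (γ : Metric n M) {f : M → ℝ}
    (hf : ContMDiff (𝓡 n) 𝓘(ℝ, ℝ) ∞ f) (hfc : HasCompactSupport f) {s : RoughForm n M}
    (hs : IsSmoothForm s) : mulForm f s ∈ squareIntegrable γ := by
  have h := isSmoothForm_mulForm hf hs
  refine ⟨isMeasurableForm_of_isSmoothForm γ h, ?_⟩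
  refine (continuous_formInner_of_isSmoothForm γ h h).integrable_of_hasCompactSupport ?_
  refine hfc.mono fun x hx => ?_
  simp only [Function.mem_support, formInner_mulForm] at hx ⊢
  exact fun h0 => hx (by simp [h0])

end Weights

/-! ### Measurability of pulled-back forms on the product with the group -/

section ActionMeasurable

variable {n : ℕ} {G : Type*} [Group G] [TopologicalSpace G] [MeasurableSpace G]
  [IsTopologicalGroup G]
  [T2Space G] [LocallyCompactSpace G] [SecondCountableTopology G] [BorelSpace G]
  (m : Measure G) [m.IsMulRightInvariant] [IsFiniteMeasureOnCompacts m] [m.IsOpenPosMeasure]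
  {M : Type*} [TopologicalSpace M] [T2Space M] [SecondCountableTopology M]
  [ChartedSpace (EuclideanSpace ℝ (Fin n)) M]
  [IsManifold (𝓡 n) ∞ M] [MeasurableSpace M] [BorelSpace M] [MulAction G M] [ProperSMul G M]

variable (G) in
/-- An isometric action with continuous Jacobians. -/
structure IsometricAction (γ : Metric n M) : Prop where
  mdifferentiable : ∀ g : G, MDifferentiable (𝓡 n) (𝓡 n) (fun y : M => g • y)
  inner_eq : ∀ (g : G) (x : M) (v w : TangentSpace (𝓡 n) x),
      γ.inner (g • x) (mfderiv (𝓡 n) (𝓡 n) (fun y : M => g • y) x v)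
        (mfderiv (𝓡 n) (𝓡 n) (fun y : M => g • y) x w) = γ.inner x v w
  continuousOn_jacobian : ∀ (c c' : M) (i j : Fin n),
    ContinuousOn (fun p : M × G => jacobian (fun y : M => p.2 • y) c c' p.1 i j)
      {p | p.1 ∈ (chartAt (EuclideanSpace ℝ (Fin n)) c).source ∧
        p.2 • p.1 ∈ (chartAt (EuclideanSpace ℝ (Fin n)) c').source}

variable {γ : Metric n M}

theorem IsometricAction.measurePreserving (hγ : IsometricAction G γ) (g : G) :
    MeasurePreserving (fun x : M => g • x) (riemVolume γ) (riemVolume γ) :=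
  measurePreserving_isometry γ (Homeomorph.smul g) (hγ.mdifferentiable g) (hγ.inner_eq g)

/-- The map `(x, g) ↦ gx` is the first coordinate of the involution. This allows sections that are
only almost everywhere measurable to be composed with the action. -/
theorem IsometricAction.quasiMeasurePreserving (hγ : IsometricAction G γ) :
    Measure.QuasiMeasurePreserving (fun p : M × G => p.2 • p.1) ((riemVolume γ).prod m)
      (riemVolume γ) :=
  Measure.quasiMeasurePreserving_fst.comp
    (measurePreserving_smulInv m (riemVolume γ) hγ.measurePreserving).quasiMeasurePreserving

/-- The set of `(x, g)` with `x` in the chart at `c` is covered by countably many open sets on which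
`gx` lies in one chart; there the coefficients are continuous Jacobian entries times composed
measurable coefficients. -/
theorem IsometricAction.aestronglyMeasurable_coeff_pullback (hγ : IsometricAction G γ)
    {μ : RoughForm n M} (hμ : IsMeasurableForm γ μ) (c : M) (k : Fin (n + 1))
    (I : Fin k → Fin n) :
    AEStronglyMeasurable (fun p : M × G => coeff (pullback p.2 μ) c k I p.1)
      (((riemVolume γ).restrict (chartAt (EuclideanSpace ℝ (Fin n)) c).source).prod m) := by
  obtain ⟨s, hs, hU⟩ := TopologicalSpace.countable_cover_nhds
    (f := fun c : M => (chartAt (EuclideanSpace ℝ (Fin n)) c).source)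
    (fun c => chart_source_mem_nhds _ c)
  have : Countable s := hs.to_subtype
  rw [Set.biUnion_eq_iUnion] at hU
  let W : s → Set (M × G) := fun c' => {p | p.1 ∈ (chartAt (EuclideanSpace ℝ (Fin n)) c).source ∧
        p.2 • p.1 ∈ (chartAt (EuclideanSpace ℝ (Fin n)) c'.1).source}
  have hW : (chartAt (EuclideanSpace ℝ (Fin n)) c).source ×ˢ (Set.univ : Set G) = ⋃ c', W c' := by
    ext p
    have hp : p.2 • p.1 ∈ ⋃ x : s, (chartAt (EuclideanSpace ℝ (Fin n)) x.1).source :=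
      hU ▸ Set.mem_univ _
    simp only [Set.mem_iUnion] at hp
    obtain ⟨i, hi⟩ := hp
    simpa [W] using fun _ => ⟨i.1, i.2, hi⟩
  have hWm : ∀ c', MeasurableSet (W c') := fun c' => IsOpen.measurableSet
    (((chartAt (EuclideanSpace ℝ (Fin n)) c).open_source.preimage continuous_fst).inter
      ((chartAt (EuclideanSpace ℝ (Fin n)) c'.1).open_source.preimage (by fun_prop)))
  rw [show ((riemVolume γ).restrict (chartAt (EuclideanSpace ℝ (Fin n)) c).source).prod m =
    ((riemVolume γ).prod m).restrict
      ((chartAt (EuclideanSpace ℝ (Fin n)) c).source ×ˢ (Set.univ : Set G)) by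
    rw [← Measure.prod_restrict, Measure.restrict_univ], hW, aestronglyMeasurable_iUnion_iff]
  intro c'
  have h1 : AEStronglyMeasurable (fun p : M × G => ∑ J : Fin k → Fin n,
      (∏ a, jacobian (fun x : M => p.2 • x) c c'.1 p.1 (J a) (I a)) *
        coeff μ c'.1 k J (p.2 • p.1)) (((riemVolume γ).prod m).restrict (W c')) := by
    refine Finset.aestronglyMeasurable_fun_sum _ fun J _ => AEStronglyMeasurable.mul ?_ ?_
    · exact Finset.aestronglyMeasurable_fun_prod _ fun a _ =>
        (hγ.continuousOn_jacobian c c'.1 _ _).aestronglyMeasurable (hWm c')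
    · exact (hμ c'.1 k J).comp_quasiMeasurePreserving
        ((hγ.quasiMeasurePreserving m).restrict fun p hp => hp.2)
  refine h1.congr ?_
  filter_upwards [ae_restrict_mem (hWm c')] with p hp
  exact (coeff_comp_mfderiv μ hp.1 hp.2 (hγ.mdifferentiable p.2 p.1) k I).symm

theorem IsometricAction.aestronglyMeasurable_formInner_pullback (hγ : IsometricAction G γ)
    {μ ν : RoughForm n M} (hμ : IsMeasurableForm γ μ) (hν : IsMeasurableForm γ ν) :
    AEStronglyMeasurable (fun p : M × G => formInner γ p.1 (pullback p.2 μ p.1) (ν p.1))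
      ((riemVolume γ).prod m) := by
  obtain ⟨s, hs, hU⟩ := TopologicalSpace.countable_cover_nhds
    (f := fun c : M => (chartAt (EuclideanSpace ℝ (Fin n)) c).source)
    (fun c => chart_source_mem_nhds _ c)
  have : Countable s := hs.to_subtype
  rw [Set.biUnion_eq_iUnion] at hU
  have hW : (Set.univ : Set (M × G)) =
      ⋃ c : s, (chartAt (EuclideanSpace ℝ (Fin n)) c.1).source ×ˢ (Set.univ : Set G) := by
    rw [← Set.iUnion_prod_const, hU, Set.univ_prod_univ]
  rw [← Measure.restrict_univ (μ := (riemVolume γ).prod m), hW, aestronglyMeasurable_iUnion_iff]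
  intro c
  have hm := (chartAt (EuclideanSpace ℝ (Fin n)) c.1).open_source.measurableSet
  rw [← Measure.prod_restrict, Measure.restrict_univ]
  have h1 : AEStronglyMeasurable (fun p : M × G => ∑ k : Fin (n + 1), ∑ I : Fin k → Fin n,
      ∑ J : Fin k → Fin n, metricWeight γ c.1 k I J p.1 * coeff (pullback p.2 μ) c.1 k I p.1 *
        coeff ν c.1 k J p.1)
      (((riemVolume γ).restrict (chartAt (EuclideanSpace ℝ (Fin n)) c.1).source).prod m) := by
    refine Finset.aestronglyMeasurable_fun_sum _ fun k _ =>
      Finset.aestronglyMeasurable_fun_sum _ fun I _ =>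
      Finset.aestronglyMeasurable_fun_sum _ fun J _ => ?_
    refine AEStronglyMeasurable.mul (AEStronglyMeasurable.mul ?_ ?_) ?_
    · exact ((continuousOn_metricWeight γ c.1 k I J).aestronglyMeasurable hm).comp_fst
    · exact hγ.aestronglyMeasurable_coeff_pullback m hμ c.1 k I
    · exact (hν c.1 k J).comp_fst
  refine h1.congr ?_
  have h2 : ∀ᵐ p ∂(((riemVolume γ).restrict
      (chartAt (EuclideanSpace ℝ (Fin n)) c.1).source).prod m),
      p.1 ∈ (chartAt (EuclideanSpace ℝ (Fin n)) c.1).source :=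
    Measure.quasiMeasurePreserving_fst.ae (ae_restrict_mem hm)
  filter_upwards [h2] with p hp
  exact (formInner_eq_sum γ hp _ _).symm

end ActionMeasurable
end EquivariantForms

namespace EquivariantForms

/-! ### Convergence of the orbit integral and the contraction estimate -/

section Operator

variable {n : ℕ} {G : Type*} [Group G] [TopologicalSpace G] [MeasurableSpace G]
  [IsTopologicalGroup G]
  [T2Space G] [LocallyCompactSpace G] [SecondCountableTopology G] [BorelSpace G]
  (m : Measure G) [m.IsMulRightInvariant] [IsFiniteMeasureOnCompacts m] [m.IsOpenPosMeasure]
  {M : Type*} [TopologicalSpace M] [T2Space M] [SecondCountableTopology M]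
  [ChartedSpace (EuclideanSpace ℝ (Fin n)) M]
  [IsManifold (𝓡 n) ∞ M] [MeasurableSpace M] [BorelSpace M] [MulAction G M] [ProperSMul G M]

variable (G) in
/-- Continuous functions with compact support which do not vanish on any orbit. -/
structure IsCutoff (f : M → ℝ) : Prop where
  continuous : Continuous f
  hasCompactSupport : HasCompactSupport f
  exists_ne_zero : ∀ x, ∃ g : G, f (g • x) ≠ 0

variable {γ : Metric n M} {f : M → ℝ}

theorem IsCutoff.massFn_pos (hf : IsCutoff G f) (x : M) : 0 < massFn m f x := by
  obtain ⟨g, hg⟩ := hf.exists_ne_zero x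
  exact EquivariantForms.massFn_pos m hf.continuous hf.hasCompactSupport hg

theorem IsCutoff.massFn_sq_pos (hf : IsCutoff G f) (x : M) : 0 < massFn m f x ^ 2 :=
  pow_pos (hf.massFn_pos m x) 2

/-- The measure `χ(g) A(x)⁻² dx dg` on `M × G`. -/
def kernelMeasure (γ : Metric n M) (f : M → ℝ) : Measure (M × G) :=
  weightedProd m (riemVolume γ) fun x => massFn m f x ^ 2

theorem measurePreserving_smulInv_kernelMeasure (hγ : IsometricAction G γ) (hf : IsCutoff G f) :
    MeasurePreserving (smulInv : M × G → M × G) (kernelMeasure m γ f) (kernelMeasure m γ f) :=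
  measurePreserving_smulInv_weightedProd m (riemVolume γ) hγ.measurePreserving
    (measurable_massFn_sq m hf.continuous) (massFn_smul_sq m f)

variable (G M) in
theorem measurableEmbedding_smulInv : MeasurableEmbedding (smulInv : M × G → M × G) :=
  MeasurableEquiv.measurableEmbedding
    { toFun := smulInv, invFun := smulInv, left_inv := smulInv_smulInv,
      right_inv := smulInv_smulInv, measurable_toFun := measurable_smulInv,
      measurable_invFun := measurable_smulInv }

theorem lintegral_kernelMeasure (hf : IsCutoff G f)
    {Φ : M × G → ENNReal} (hΦ : AEMeasurable Φ ((riemVolume γ).prod m)) :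
    ∫⁻ p, Φ p ∂kernelMeasure m γ f = ∫⁻ x, ∫⁻ g,
      ENNReal.ofReal (modularFn m g / massFn m f x ^ 2) * Φ (x, g) ∂m ∂riemVolume γ :=
  lintegral_weightedProd m (riemVolume γ) (measurable_massFn_sq m hf.continuous) hΦ

theorem lintegral_cutoff_sq (hf : IsCutoff G f) (x : M) :
    ∫⁻ g, ENNReal.ofReal (modularFn m g / massFn m f x ^ 2) * ENNReal.ofReal (f (g • x) ^ 2) ∂m
      = 1 := by
  have ha := hf.massFn_sq_pos m x
  have hi := integrable_modularFn_mul m hf.continuous hf.hasCompactSupport x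
  have h1 : ∀ g, ENNReal.ofReal (modularFn m g / massFn m f x ^ 2) *
      ENNReal.ofReal (f (g • x) ^ 2) =
      ENNReal.ofReal ((massFn m f x ^ 2)⁻¹ * (modularFn m g * f (g • x) ^ 2)) := fun g => by
    rw [← ENNReal.ofReal_mul (div_nonneg (modularFn_pos m g).le ha.le)]
    congr 1
    ring
  simp only [h1]
  rw [← ofReal_integral_eq_lintegral_ofReal (hi.const_mul _), integral_const_mul, ← massFn_sq,
    inv_mul_cancel₀ ha.ne', ENNReal.ofReal_one]
  exact Filter.Eventually.of_forall fun g => mul_nonneg (inv_nonneg.2 ha.le)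
    (mul_nonneg (modularFn_pos m g).le (sq_nonneg _))

/-- Tonelli: for fixed `x` the weight `χ(g) A(x)⁻² f(gx)²` has total mass one. -/
theorem lintegral_kernelMeasure_fst (hf : IsCutoff G f) {u : M → ENNReal}
    (hu : AEMeasurable u (riemVolume γ)) :
    ∫⁻ p : M × G, ENNReal.ofReal (f (p.2 • p.1) ^ 2) * u p.1 ∂kernelMeasure m γ f =
      ∫⁻ x, u x ∂riemVolume γ := by
  have hfc := hf.continuous
  have hχ := continuous_modularFn m
  have hc : Continuous fun p : M × G => f (p.2 • p.1) ^ 2 := by fun_prop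
  rw [lintegral_kernelMeasure m hf (Φ := fun p => ENNReal.ofReal (f (p.2 • p.1) ^ 2) * u p.1)
    (hc.measurable.ennreal_ofReal.aemeasurable.mul
    (hu.comp_quasiMeasurePreserving Measure.quasiMeasurePreserving_fst))]
  refine lintegral_congr fun x => ?_
  simp only [← mul_assoc]
  have hc2 : Continuous fun g : G => f (g • x) ^ 2 := by fun_prop
  have hm : Measurable fun g : G => ENNReal.ofReal (modularFn m g / massFn m f x ^ 2) *
      ENNReal.ofReal (f (g • x) ^ 2) :=
    (hχ.measurable.div_const _).ennreal_ofReal.mul hc2.measurable.ennreal_ofReal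
  rw [lintegral_mul_const _ hm, lintegral_cutoff_sq m hf, one_mul]

/-- The image of the preceding identity under the measure-preserving involution, which exchanges `x`
and `gx`. -/
theorem lintegral_kernelMeasure_smul (hγ : IsometricAction G γ) (hf : IsCutoff G f)
    {u : M → ENNReal} (hu : AEMeasurable u (riemVolume γ)) :
    ∫⁻ p : M × G, ENNReal.ofReal (f p.1 ^ 2) * u (p.2 • p.1) ∂kernelMeasure m γ f =
      ∫⁻ x, u x ∂riemVolume γ := by
  rw [← lintegral_kernelMeasure_fst m hf hu,
    ← (measurePreserving_smulInv_kernelMeasure m hγ hf).lintegral_comp_emb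
      (measurableEmbedding_smulInv G M)]
  simp [smulInv]

theorem aemeasurable_comp_smul (hγ : IsometricAction G γ) {u : M → ENNReal}
    (hu : AEMeasurable u (riemVolume γ)) :
    AEMeasurable (fun p : M × G => u (p.2 • p.1)) ((riemVolume γ).prod m) :=
  hu.comp_quasiMeasurePreserving (hγ.quasiMeasurePreserving m)

theorem lintegral_kernelMeasure_smul' (hγ : IsometricAction G γ) (hf : IsCutoff G f)
    {u : M → ENNReal} (hu : AEMeasurable u (riemVolume γ)) :
    ∫⁻ x, ENNReal.ofReal (f x ^ 2 / massFn m f x ^ 2) *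
      ∫⁻ g, ENNReal.ofReal (modularFn m g) * u (g • x) ∂m ∂riemVolume γ =
      ∫⁻ x, u x ∂riemVolume γ := by
  have hfc := hf.continuous
  have hc : Continuous fun p : M × G => f p.1 ^ 2 := by fun_prop
  rw [← lintegral_kernelMeasure_smul m hγ hf hu, lintegral_kernelMeasure m hf
    (Φ := fun p => ENNReal.ofReal (f p.1 ^ 2) * u (p.2 • p.1))
    (hc.measurable.ennreal_ofReal.aemeasurable.mul (aemeasurable_comp_smul m hγ hu))]
  refine lintegral_congr fun x => ?_
  rw [← lintegral_const_mul' _ _ ENNReal.ofReal_ne_top]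
  refine lintegral_congr fun g => ?_
  have ha := hf.massFn_sq_pos m x
  rw [← mul_assoc, ← mul_assoc, ← ENNReal.ofReal_mul (by positivity),
    ← ENNReal.ofReal_mul (div_nonneg (modularFn_pos m g).le ha.le)]
  congr 2
  ring

theorem lintegral_orbit_smul (u : M → ENNReal) (h : G) (x : M) :
    ∫⁻ g, ENNReal.ofReal (modularFn m g) * u (g • h • x) ∂m =
      ENNReal.ofReal (modularFn m h)⁻¹ * ∫⁻ g, ENNReal.ofReal (modularFn m g) * u (g • x) ∂m := by
  rw [← lintegral_const_mul' _ _ ENNReal.ofReal_ne_top,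
    ← lintegral_mul_right_eq_self (fun g => ENNReal.ofReal (modularFn m h)⁻¹ *
      (ENNReal.ofReal (modularFn m g) * u (g • x))) h]
  refine lintegral_congr fun g => ?_
  have hh := (modularFn_pos m h).ne'
  rw [← mul_assoc, ← ENNReal.ofReal_mul (inv_nonneg.2 (modularFn_pos m h).le), modularFn_mul,
    mul_smul]
  congr 2
  field_simp

/-- The integral of `f² A⁻²` times the orbit integral is finite, which gives finiteness almost
everywhere on `{f ≠ 0}`. The translates of that set cover `M`, and along an orbit the orbit integral
changes only by a positive factor. -/
theorem ae_lintegral_orbit_lt_top (hγ : IsometricAction G γ) (hf : IsCutoff G f)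
    {u : M → ENNReal} (hu : AEMeasurable u (riemVolume γ))
    (hfin : ∫⁻ x, u x ∂riemVolume γ ≠ ⊤) :
    ∀ᵐ x ∂riemVolume γ, ∫⁻ g, ENNReal.ofReal (modularFn m g) * u (g • x) ∂m < ⊤ := by
  have hfc := hf.continuous
  have hχ := continuous_modularFn m
  have hJ : AEMeasurable (fun x => ∫⁻ g, ENNReal.ofReal (modularFn m g) * u (g • x) ∂m)
      (riemVolume γ) := by
    refine AEMeasurable.lintegral_prod_right'
      (f := fun p : M × G => ENNReal.ofReal (modularFn m p.2) * u (p.2 • p.1)) ?_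
    exact (hχ.measurable.comp measurable_snd).ennreal_ofReal.aemeasurable.mul
      (aemeasurable_comp_smul m hγ hu)
  have hw : AEMeasurable (fun x => ENNReal.ofReal (f x ^ 2 / massFn m f x ^ 2)) (riemVolume γ) :=
    ((hfc.measurable.pow_const 2).div
      (measurable_massFn_sq m hf.continuous)).ennreal_ofReal.aemeasurable
  have h1 := ae_lt_top' (hw.mul hJ) (by
    have := lintegral_kernelMeasure_smul' m hγ hf hu
    simp only [Pi.mul_apply]
    rw [this]
    exact hfin)
  have h2 : riemVolume γ {x | f x ≠ 0 ∧
      ¬ ∫⁻ g, ENNReal.ofReal (modularFn m g) * u (g • x) ∂m < ⊤} = 0 := by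
    refine measure_mono_null (fun x hx => ?_) h1
    have hx2 := not_lt_top_iff.1 hx.2
    have hpos : 0 < f x ^ 2 / massFn m f x ^ 2 :=
      div_pos (by have := hx.1; positivity) (hf.massFn_sq_pos m x)
    simp only [Set.mem_compl_iff, Set.mem_ofPred_eq, Pi.mul_apply, hx2]
    rw [ENNReal.mul_top (ENNReal.ofReal_pos.2 hpos).ne']
    exact lt_irrefl _
  refine measure_null_of_locally_null _ fun x _ => ?_
  obtain ⟨g₀, hg₀⟩ := hf.exists_ne_zero x
  have hcont : Continuous fun y : M => f (g₀ • y) := by fun_prop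
  have hV : IsOpen {y : M | f (g₀ • y) ≠ 0} := isOpen_ne.preimage hcont
  refine ⟨_, inter_mem_nhdsWithin _ (hV.mem_nhds hg₀), ?_⟩
  -- Near `x` the element `g₀` carries exceptional points into the exceptional part of `{f ≠ 0}`,
  -- and preimages of null sets under the action of `g₀` are null.
  refine measure_mono_null (t := (fun y : M => g₀ • y) ⁻¹' _) (fun y hy => ?_)
    ((hγ.measurePreserving g₀).quasiMeasurePreserving.preimage_null h2)
  refine ⟨hy.2, ?_⟩
  rw [lintegral_orbit_smul, not_lt_top_iff]
  have hy1 : ∫⁻ g, ENNReal.ofReal (modularFn m g) * u (g • y) ∂m = ⊤ := not_lt_top_iff.1 hy.1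
  rw [hy1, ENNReal.mul_top (ENNReal.ofReal_pos.2 (inv_pos.2 (modularFn_pos m g₀))).ne']

/-- The density `|μ|²` as a function with values in `[0, ∞]`. -/
def normSqFn (γ : Metric n M) (μ : RoughForm n M) (x : M) : ENNReal :=
  ENNReal.ofReal (formInner γ x (μ x) (μ x))

theorem aemeasurable_normSqFn {μ : RoughForm n M} (hμ : IsMeasurableForm γ μ) :
    AEMeasurable (normSqFn γ μ) (riemVolume γ) :=
  (aestronglyMeasurable_formInner γ hμ hμ).aemeasurable.ennreal_ofReal

theorem lintegral_normSqFn_ne_top {μ : RoughForm n M} (hμ : μ ∈ squareIntegrable γ) :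
    ∫⁻ x, normSqFn γ μ x ∂riemVolume γ ≠ ⊤ := by
  have h := (hasFiniteIntegral_iff_ofReal
    (Filter.Eventually.of_forall fun x => formInner_self_nonneg γ x (μ x))).1 hμ.2.hasFiniteIntegral
  exact h.ne

theorem IsometricAction.formInner_pullback (hγ : IsometricAction G γ) (g : G) (x : M)
    (α β : RoughForm n M) :
    formInner γ x (pullback g α x) (pullback g β x) =
      formInner γ (g • x) (α (g • x)) (β (g • x)) :=
  EquivariantForms.formInner_pullback γ hγ.mdifferentiable hγ.inner_eq g x α β

theorem ae_integrable_orbit (hγ : IsometricAction G γ) (hf : IsCutoff G f) {μ : RoughForm n M}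
    (hμ : μ ∈ squareIntegrable γ) :
    ∀ᵐ x ∂riemVolume γ, Integrable
      (fun g => modularFn m g * formInner γ (g • x) (μ (g • x)) (μ (g • x))) m := by
  have hχ := continuous_modularFn m
  have h1 : ∀ᵐ x ∂riemVolume γ, AEStronglyMeasurable
      (fun g : G => formInner γ (g • x) (μ (g • x)) (μ (g • x))) m :=
    ((aestronglyMeasurable_formInner γ hμ.1 hμ.1).comp_quasiMeasurePreserving
      (hγ.quasiMeasurePreserving m)).prodMk_left
  filter_upwards [h1, ae_lintegral_orbit_lt_top m hγ hf (aemeasurable_normSqFn hμ.1)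
    (lintegral_normSqFn_ne_top hμ)] with x hx1 hx2
  refine ⟨hχ.aestronglyMeasurable.mul hx1, ?_⟩
  rw [hasFiniteIntegral_iff_ofReal (Filter.Eventually.of_forall fun g =>
    mul_nonneg (modularFn_pos m g).le (formInner_self_nonneg γ _ _))]
  simp only [ENNReal.ofReal_mul (modularFn_pos m _).le]
  exact hx2

/-- Each coefficient of the integrand is at most `χ(g) (f(gx)² + B(x) |μ(gx)|²)`, where `B(x)` is
the Hadamard bound and `|μ(gx)|` is the norm of the pullback because `g` acts isometrically. Both
terms are integrable for almost every `x`. -/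
theorem ae_integrable_projIntegrand (hγ : IsometricAction G γ) (hf : IsCutoff G f)
    {μ : RoughForm n M} (hμ : μ ∈ squareIntegrable γ) :
    ∀ᵐ x ∂riemVolume γ, Integrable (projIntegrand m f μ x) m := by
  have hχ := continuous_modularFn m
  have hfc := hf.continuous
  obtain ⟨s, hs, hU⟩ := TopologicalSpace.countable_cover_nhds
    (f := fun c : M => (chartAt (EuclideanSpace ℝ (Fin n)) c).source)
    (fun c => chart_source_mem_nhds _ c)
  have h1 : ∀ᵐ x ∂riemVolume γ, ∀ c ∈ s, x ∈ (chartAt (EuclideanSpace ℝ (Fin n)) c).source →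
      ∀ (k : Fin (n + 1)) (I : Fin k → Fin n),
        AEStronglyMeasurable (fun g : G => coeff (pullback g μ) c k I x) m := by
    refine (ae_ball_iff hs).2 fun c _ => ?_
    have := fun k I => (hγ.aestronglyMeasurable_coeff_pullback m hμ.1 c k I).prodMk_left
    have h2 := ae_all_iff.2 fun k => ae_all_iff.2 fun I => this k I
    exact (ae_restrict_iff'
      (chartAt (EuclideanSpace ℝ (Fin n)) c).open_source.measurableSet).1 h2
  filter_upwards [h1, ae_integrable_orbit m hγ hf hμ] with x hx1 hx2
  have hxU : x ∈ ⋃ c ∈ s, (chartAt (EuclideanSpace ℝ (Fin n)) c).source := hU ▸ Set.mem_univ x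
  simp only [Set.mem_iUnion] at hxU
  obtain ⟨c, hcs, hc⟩ := hxU
  refine (integrable_fiber_iff hc).2 fun i => ?_
  have hcx : Continuous fun g : G => f (g • x) := by fun_prop
  have hi := integrable_modularFn_mul m hf.continuous hf.hasCompactSupport x
  refine (hi.add (hx2.const_mul (coeffBound γ c i.1 i.2 x))).mono'
    (((hχ.mul hcx).aestronglyMeasurable.mul (hx1 c hcs hc i.1 i.2))) ?_
  refine Filter.Eventually.of_forall fun g => ?_
  have hb := sq_coeff_le γ (pullback g μ) c i.1 i.2 x
  rw [hγ.formInner_pullback] at hb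
  have hχg := modularFn_pos m g
  change |modularFn m g * f (g • x) * coeff (pullback g μ) c i.1 i.2 x| ≤ _
  rw [mul_assoc, abs_mul, abs_of_pos hχg]
  simp only [Pi.add_apply]
  have h2 : |f (g • x) * coeff (pullback g μ) c i.1 i.2 x| ≤
      f (g • x) ^ 2 + coeff (pullback g μ) c i.1 i.2 x ^ 2 := by
    rw [abs_le]
    constructor <;>
      nlinarith [sq_nonneg (f (g • x) + coeff (pullback g μ) c i.1 i.2 x),
        sq_nonneg (f (g • x) - coeff (pullback g μ) c i.1 i.2 x), sq_nonneg (f (g • x)),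
        sq_nonneg (coeff (pullback g μ) c i.1 i.2 x)]
  calc modularFn m g * |f (g • x) * coeff (pullback g μ) c i.1 i.2 x|
      ≤ modularFn m g * (f (g • x) ^ 2 + coeffBound γ c i.1 i.2 x *
        formInner γ (g • x) (μ (g • x)) (μ (g • x))) :=
        mul_le_mul_of_nonneg_left (h2.trans (by gcongr)) hχg.le
    _ = _ := by ring

theorem isMeasurableForm_projForm (hγ : IsometricAction G γ) (hf : IsCutoff G f)
    {μ : RoughForm n M} (hμ : μ ∈ squareIntegrable γ) : IsMeasurableForm γ (projForm m f μ) := by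
  intro c k I
  have hχ := continuous_modularFn m
  have hfc := hf.continuous
  have hcont : Continuous fun p : M × G => modularFn m p.2 * f (p.2 • p.1) := by fun_prop
  have h1 : AEStronglyMeasurable (fun x => ∫ g, modularFn m g * f (g • x) *
      coeff (pullback g μ) c k I x ∂m)
      ((riemVolume γ).restrict (chartAt (EuclideanSpace ℝ (Fin n)) c).source) :=
    (hcont.aestronglyMeasurable.mul
      (hγ.aestronglyMeasurable_coeff_pullback m hμ.1 c k I)).integral_prod_right'
  have h2 : Measurable fun x => f x / massFn m f x ^ 2 :=
    hfc.measurable.div (measurable_massFn_sq m hf.continuous)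
  refine (h2.aestronglyMeasurable.mul h1).congr ?_
  filter_upwards [ae_restrict_of_ae (ae_integrable_projIntegrand m hγ hf hμ)] with x hx
  have h3 := fiberCoeff_integral c x hx ⟨k, I⟩
  have h4 : coeff (projForm m f μ) c k I x =
      (f x / massFn m f x ^ 2) * fiberCoeff c x (∫ g, projIntegrand m f μ x g ∂m) ⟨k, I⟩ := rfl
  rw [h4, h3]
  rfl

/-- Expand `|s v - p|² ≥ 0`. -/
theorem formInner_young (γ : Metric n M) (x : M) (v p : FormFiber n x) (s : ℝ) :
    2 * (s * formInner γ x p v) ≤ s ^ 2 * formInner γ x v v + formInner γ x p p := by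
  have h0 := formInner_self_nonneg γ x (s • v + (-1 : ℝ) • p)
  rw [formInner_add_self, formInner_smul_left, formInner_comm γ x v (s • v), formInner_smul_left,
    formInner_smul_left, formInner_comm γ x v ((-1 : ℝ) • p), formInner_smul_left,
    formInner_smul_left, formInner_comm γ x p ((-1 : ℝ) • p), formInner_smul_left] at h0
  linarith

/-- The Cauchy–Schwarz inequality for the fibre integral. -/
theorem formInner_integral_projIntegrand_le (hγ : IsometricAction G γ) (hf : IsCutoff G f)
    {μ : RoughForm n M} {x : M} (hx : Integrable (projIntegrand m f μ x) m)
    (hx' : Integrable (fun g => modularFn m g * formInner γ (g • x) (μ (g • x)) (μ (g • x))) m) :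
    formInner γ x (∫ g, projIntegrand m f μ x g ∂m) (∫ g, projIntegrand m f μ x g ∂m) ≤
      massFn m f x ^ 2 * ∫ g, modularFn m g * formInner γ (g • x) (μ (g • x)) (μ (g • x)) ∂m := by
  set v := ∫ g, projIntegrand m f μ x g ∂m with hv
  have ha := hf.massFn_sq_pos m x
  have hi := integrable_modularFn_mul m hf.continuous hf.hasCompactSupport x
  -- Young's inequality against the integral `v` itself, with `s = f(gx) / A(x)²`, multiplied by
  -- `χ(g) A(x)²`. On integration the first term on the right becomes `|v|²` and is absorbed by `2
  -- |v|²` on the left.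
  have hpt : ∀ g, 2 * formInner γ x (projIntegrand m f μ x g) v ≤
      (massFn m f x ^ 2)⁻¹ * formInner γ x v v * (modularFn m g * f (g • x) ^ 2) +
      massFn m f x ^ 2 * (modularFn m g * formInner γ (g • x) (μ (g • x)) (μ (g • x))) := by
    intro g
    have h0 := formInner_young γ x v (pullback g μ x) ((massFn m f x ^ 2)⁻¹ * f (g • x))
    have hp := hγ.formInner_pullback g x μ μ
    have hl : formInner γ x (projIntegrand m f μ x g) v = modularFn m g * f (g • x) *
        formInner γ x (pullback g μ x) v := formInner_smul_left γ x _ _ _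
    rw [hl]
    have hχg := modularFn_pos m g
    generalize massFn m f x ^ 2 = b at *
    have hb : b⁻¹ * b = 1 := inv_mul_cancel₀ ha.ne'
    generalize formInner γ x (pullback g μ x) v = q at *
    rw [hp] at h0
    generalize formInner γ x v v = w at *
    generalize formInner γ (g • x) (μ (g • x)) (μ (g • x)) = r at *
    generalize f (g • x) = t at *
    have h1 := mul_le_mul_of_nonneg_left h0 (mul_nonneg hχg.le ha.le)
    have h2 : modularFn m g * b * (2 * (b⁻¹ * t * q)) =
      (b⁻¹ * b) * (2 * (modularFn m g * t * q)) := by ring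
    have h3 : modularFn m g * b * ((b⁻¹ * t) ^ 2 * w + r) =
        (b⁻¹ * b) * (b⁻¹ * w * (modularFn m g * t ^ 2)) + b * (modularFn m g * r) := by ring
    rwa [h2, h3, hb, one_mul, one_mul] at h1
  have hint := integral_mono (g := fun g => (massFn m f x ^ 2)⁻¹ * formInner γ x v v *
      (modularFn m g * f (g • x) ^ 2) +
      massFn m f x ^ 2 * (modularFn m g * formInner γ (g • x) (μ (g • x)) (μ (g • x))))
    ((integrable_formInner_left γ x hx v).const_mul 2)
    ((hi.const_mul ((massFn m f x ^ 2)⁻¹ * formInner γ x v v)).add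
      (hx'.const_mul (massFn m f x ^ 2))) hpt
  rw [integral_const_mul, ← formInner_integral γ x hx v, ← hv, integral_add (hi.const_mul _)
    (hx'.const_mul _), integral_const_mul, integral_const_mul, ← massFn_sq] at hint
  have h3 : (massFn m f x ^ 2)⁻¹ * formInner γ x v v * massFn m f x ^ 2 = formInner γ x v v := by
    rw [mul_right_comm, inv_mul_cancel₀ ha.ne', one_mul]
  linarith

theorem lintegral_normSqFn_projForm_le (hγ : IsometricAction G γ) (hf : IsCutoff G f)
    {μ : RoughForm n M} (hμ : μ ∈ squareIntegrable γ) :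
    ∫⁻ x, normSqFn γ (projForm m f μ) x ∂riemVolume γ ≤ ∫⁻ x, normSqFn γ μ x ∂riemVolume γ := by
  rw [← lintegral_kernelMeasure_smul' m hγ hf (aemeasurable_normSqFn hμ.1)]
  refine lintegral_mono_ae ?_
  filter_upwards [ae_integrable_projIntegrand m hγ hf hμ, ae_integrable_orbit m hγ hf hμ]
    with x hx hx'
  have hle := formInner_integral_projIntegrand_le m hγ hf hx hx'
  have ha := hf.massFn_sq_pos m x
  have hnn : ∀ g, 0 ≤ modularFn m g * formInner γ (g • x) (μ (g • x)) (μ (g • x)) := fun g =>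
    mul_nonneg (modularFn_pos m g).le (formInner_self_nonneg γ _ _)
  have h1 : ∫⁻ g, ENNReal.ofReal (modularFn m g) * normSqFn γ μ (g • x) ∂m =
      ENNReal.ofReal (∫ g, modularFn m g * formInner γ (g • x) (μ (g • x)) (μ (g • x)) ∂m) := by
    rw [ofReal_integral_eq_lintegral_ofReal hx' (Filter.Eventually.of_forall hnn)]
    simp only [normSqFn, ENNReal.ofReal_mul (modularFn_pos m _).le]
  rw [h1, ← ENNReal.ofReal_mul (by positivity)]
  refine ENNReal.ofReal_le_ofReal ?_
  rw [projForm, formInner_smul_left, formInner_comm, formInner_smul_left]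
  set v := formInner γ x (∫ g, projIntegrand m f μ x g ∂m) (∫ g, projIntegrand m f μ x g ∂m)
  set J := ∫ g, modularFn m g * formInner γ (g • x) (μ (g • x)) (μ (g • x)) ∂m
  calc f x / massFn m f x ^ 2 * (f x / massFn m f x ^ 2 * v)
      = (f x / massFn m f x ^ 2) ^ 2 * v := by ring
    _ ≤ (f x / massFn m f x ^ 2) ^ 2 * (massFn m f x ^ 2 * J) :=
        mul_le_mul_of_nonneg_left hle (sq_nonneg _)
    _ = f x ^ 2 / massFn m f x ^ 2 * J := by
        set b := massFn m f x ^ 2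
        field_simp

theorem projForm_mem_squareIntegrable (hγ : IsometricAction G γ) (hf : IsCutoff G f)
    {μ : RoughForm n M} (hμ : μ ∈ squareIntegrable γ) : projForm m f μ ∈ squareIntegrable γ := by
  have hm := isMeasurableForm_projForm m hγ hf hμ
  refine ⟨hm, aestronglyMeasurable_formInner γ hm hm, ?_⟩
  refine (hasFiniteIntegral_iff_ofReal (Filter.Eventually.of_forall fun x =>
    formInner_self_nonneg γ x (projForm m f μ x))).2 ?_
  exact (lintegral_normSqFn_projForm_le m hγ hf hμ).trans_lt
    (lintegral_normSqFn_ne_top hμ).lt_top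

end Operator
end EquivariantForms

namespace EquivariantForms


/-! ### Norms and classes of square integrable sections -/

section L2

variable {n : ℕ} {M : Type*} [TopologicalSpace M] [SecondCountableTopology M]
  [ChartedSpace (EuclideanSpace ℝ (Fin n)) M]
  [IsManifold (𝓡 n) ∞ M] [MeasurableSpace M] [BorelSpace M] {γ : Metric n M}

theorem inner_squareIntegrable (α β : squareIntegrable γ) :
    inner ℝ α β = ∫ x, formInner γ x (α.1 x) (β.1 x) ∂riemVolume γ := rfl

theorem norm_sq_squareIntegrable (α : squareIntegrable γ) :
    ‖α‖ ^ 2 = ∫ x, formInner γ x (α.1 x) (α.1 x) ∂riemVolume γ := by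
  rw [← real_inner_self_eq_norm_sq, inner_squareIntegrable]

theorem norm_sq_eq_toReal_lintegral (α : squareIntegrable γ) :
    ‖α‖ ^ 2 = (∫⁻ x, normSqFn γ α.1 x ∂riemVolume γ).toReal := by
  rw [norm_sq_squareIntegrable, integral_eq_lintegral_of_nonneg_ae
    (Filter.Eventually.of_forall fun x => formInner_self_nonneg γ x _) α.2.2.aestronglyMeasurable]
  rfl

theorem toL2_eq_of_ae {α β : RoughForm n M} (hα : α ∈ squareIntegrable γ)
    (hβ : β ∈ squareIntegrable γ) (h : ∀ᵐ x ∂riemVolume γ, α x = β x) :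
    toL2 γ α hα = toL2 γ β hβ := by
  refine SeparationQuotient.mk_eq_mk.2 (Metric.inseparable_iff.2 ?_)
  rw [dist_eq_norm, ← sq_eq_zero_iff, norm_sq_squareIntegrable]
  refine integral_eq_zero_of_ae ?_
  filter_upwards [h] with x hx
  have h0 : (α - β) x = (0 : ℝ) • (0 : FormFiber n x) := by
    have : (α - β) x = α x - β x := rfl
    rw [this, hx, sub_self, smul_zero]
  have h1 := formInner_smul_left γ x 0 0 ((0 : ℝ) • (0 : FormFiber n x))
  rw [zero_mul] at h1
  have h2 : ((⟨α, hα⟩ - ⟨β, hβ⟩ : squareIntegrable γ)).1 x = (0 : ℝ) • (0 : FormFiber n x) := h0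
  exact (congrArg (fun v => formInner γ x v v) h2).trans h1

end L2

/-! ### The operator on classes, its symmetry and idempotence -/

section Operator

variable {n : ℕ} {G : Type*} [Group G] [TopologicalSpace G] [MeasurableSpace G]
  [IsTopologicalGroup G]
  [T2Space G] [LocallyCompactSpace G] [SecondCountableTopology G] [BorelSpace G]
  (m : Measure G) [m.IsMulRightInvariant] [IsFiniteMeasureOnCompacts m] [m.IsOpenPosMeasure]
  {M : Type*} [TopologicalSpace M] [T2Space M] [SecondCountableTopology M]
  [ChartedSpace (EuclideanSpace ℝ (Fin n)) M]
  [IsManifold (𝓡 n) ∞ M] [MeasurableSpace M] [BorelSpace M] [MulAction G M] [ProperSMul G M]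
  {γ : Metric n M} {f : M → ℝ}

/-- The function `f(x) f(gx) ⟨μ(gx), ν(x)⟩` on `M × G`. -/
def orbitPairing (γ : Metric n M) (f : M → ℝ) (μ ν : RoughForm n M) (p : M × G) : ℝ :=
  f p.1 * f (p.2 • p.1) * formInner γ p.1 (pullback p.2 μ p.1) (ν p.1)

/-- Pulling the pairing at `gx` back to `x` by the isometry `g` removes `g⁻¹` from `μ` and puts `g`
on `ν`; the scalar factors are symmetric. -/
theorem orbitPairing_smulInv (hγ : IsometricAction G γ) (μ ν : RoughForm n M) (p : M × G) :
    orbitPairing γ f μ ν (smulInv p) = orbitPairing γ f ν μ p := by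
  obtain ⟨x, g⟩ := p
  have h1 := hγ.formInner_pullback g x (pullback g⁻¹ μ) ν
  rw [pullback_pullback hγ.mdifferentiable, inv_mul_cancel, pullback_one, formInner_comm] at h1
  simp only [orbitPairing, smulInv, inv_smul_smul]
  rw [h1]
  ring

theorem formInner_smul_smul (γ : Metric n M) (x : M) (a b : ℝ) (v w : FormFiber n x) :
    formInner γ x (a • v) (b • w) = a * b * formInner γ x v w := by
  rw [formInner_smul_left, formInner_comm, formInner_smul_left, formInner_comm]
  ring

/-- The cutoff factors are distributed crosswise, `f(x)` to `μ(gx)` and `f(gx)` to `ν(x)`, so that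
the two terms integrate by `lintegral_kernelMeasure_smul` and `lintegral_kernelMeasure_fst`. -/
theorem abs_orbitPairing_le (hγ : IsometricAction G γ) (μ ν : RoughForm n M) (p : M × G) :
    |orbitPairing γ f μ ν p| ≤
      f p.1 ^ 2 * formInner γ (p.2 • p.1) (μ (p.2 • p.1)) (μ (p.2 • p.1)) +
      f (p.2 • p.1) ^ 2 * formInner γ p.1 (ν p.1) (ν p.1) := by
  obtain ⟨x, g⟩ := p
  have h := abs_formInner_le γ x (f x • pullback g μ x) (f (g • x) • ν x)
  have e1 := formInner_smul_smul γ x (f x) (f (g • x)) (pullback g μ x) (ν x)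
  have e2 := formInner_smul_smul γ x (f x) (f x) (pullback g μ x) (pullback g μ x)
  have e3 := formInner_smul_smul γ x (f (g • x)) (f (g • x)) (ν x) (ν x)
  have e4 := hγ.formInner_pullback g x μ μ
  rw [e4] at e2
  rw [e1, e2, e3, ← sq, ← sq] at h
  exact h

theorem measurable_kernelDensity (hf : IsCutoff G f) :
    Measurable fun p : M × G => ENNReal.ofReal (modularFn m p.2 / massFn m f p.1 ^ 2) := by
  have hχ := (continuous_modularFn m).measurable
  have ha := measurable_massFn_sq m hf.continuous
  exact ((hχ.comp measurable_snd).div (ha.comp measurable_fst)).ennreal_ofReal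

theorem integrable_orbitPairing (hγ : IsometricAction G γ) (hf : IsCutoff G f) {μ ν : RoughForm n M}
    (hμ : μ ∈ squareIntegrable γ) (hν : ν ∈ squareIntegrable γ) :
    Integrable (orbitPairing γ f μ ν) (kernelMeasure m γ f) := by
  have hfc := hf.continuous
  have hc : Continuous fun p : M × G => f p.1 * f (p.2 • p.1) := by fun_prop
  refine ⟨(hc.aestronglyMeasurable.mul
    (hγ.aestronglyMeasurable_formInner_pullback m hμ.1 hν.1)).mono_ac
    (withDensity_absolutelyContinuous _ _), ?_⟩
  rw [hasFiniteIntegral_iff_norm]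
  have hu := aemeasurable_normSqFn hμ.1
  have hv := aemeasurable_normSqFn hν.1
  calc ∫⁻ p, ENNReal.ofReal ‖orbitPairing γ f μ ν p‖ ∂kernelMeasure m γ f
      ≤ ∫⁻ p : M × G, (ENNReal.ofReal (f p.1 ^ 2) * normSqFn γ μ (p.2 • p.1) +
        ENNReal.ofReal (f (p.2 • p.1) ^ 2) * normSqFn γ ν p.1) ∂kernelMeasure m γ f := by
        refine lintegral_mono fun p => ?_
        have h1 := mul_nonneg (sq_nonneg (f p.1))
          (formInner_self_nonneg γ (p.2 • p.1) (μ (p.2 • p.1)))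
        have h2 := mul_nonneg (sq_nonneg (f (p.2 • p.1))) (formInner_self_nonneg γ p.1 (ν p.1))
        simp only [normSqFn]
        rw [← ENNReal.ofReal_mul (sq_nonneg _), ← ENNReal.ofReal_mul (sq_nonneg _),
          ← ENNReal.ofReal_add h1 h2]
        exact ENNReal.ofReal_le_ofReal (abs_orbitPairing_le hγ μ ν p)
    _ = ∫⁻ x, normSqFn γ μ x ∂riemVolume γ + ∫⁻ x, normSqFn γ ν x ∂riemVolume γ := by
        have hc1 : Continuous fun p : M × G => f p.1 ^ 2 := by fun_prop
        rw [lintegral_add_left', lintegral_kernelMeasure_smul m hγ hf hu,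
          lintegral_kernelMeasure_fst m hf hv]
        exact (hc1.measurable.ennreal_ofReal.aemeasurable.mul
          (aemeasurable_comp_smul m hγ hu)).mono_ac (withDensity_absolutelyContinuous _ _)
    _ < ⊤ := ENNReal.add_lt_top.2
        ⟨(lintegral_normSqFn_ne_top hμ).lt_top, (lintegral_normSqFn_ne_top hν).lt_top⟩

theorem integral_orbitPairing (hγ : IsometricAction G γ) (hf : IsCutoff G f) {μ ν : RoughForm n M}
    (hμ : μ ∈ squareIntegrable γ) (hν : ν ∈ squareIntegrable γ) :
    ∫ p, orbitPairing γ f μ ν p ∂kernelMeasure m γ f =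
      ∫ x, formInner γ x (projForm m f μ x) (ν x) ∂riemVolume γ := by
  have hw := measurable_kernelDensity (M := M) m hf
  have hlt : ∀ᵐ p ∂(riemVolume γ).prod m,
      ENNReal.ofReal (modularFn m p.2 / massFn m f p.1 ^ 2) < ⊤ :=
    Filter.Eventually.of_forall fun p => ENNReal.ofReal_lt_top
  have hi := (integrable_withDensity_iff_integrable_smul' hw hlt).1
    (integrable_orbitPairing m hγ hf hμ hν)
  have h1 : ∫ p, orbitPairing γ f μ ν p ∂kernelMeasure m γ f = _ :=
    integral_withDensity_eq_integral_toReal_smul hw hlt (orbitPairing γ f μ ν)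
  rw [h1, integral_prod _ hi]
  refine integral_congr_ae ?_
  filter_upwards [ae_integrable_projIntegrand m hγ hf hμ] with x hx
  have ha := hf.massFn_sq_pos m x
  have h2 : formInner γ x (projForm m f μ x) (ν x) = (f x / massFn m f x ^ 2) *
      ∫ g, formInner γ x (projIntegrand m f μ x g) (ν x) ∂m :=
    (formInner_smul_left γ x _ _ _).trans (congrArg _ (formInner_integral γ x hx (ν x)))
  rw [h2, ← integral_const_mul]
  refine integral_congr_ae (Filter.Eventually.of_forall fun g => ?_)
  have h3 : formInner γ x (projIntegrand m f μ x g) (ν x) = modularFn m g * f (g • x) *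
      formInner γ x (pullback g μ x) (ν x) := formInner_smul_left γ x _ _ _
  simp only [h3, orbitPairing, smul_eq_mul,
    ENNReal.toReal_ofReal (div_nonneg (modularFn_pos m g).le ha.le)]
  ring

theorem integral_formInner_projForm_comm (hγ : IsometricAction G γ) (hf : IsCutoff G f)
    {μ ν : RoughForm n M} (hμ : μ ∈ squareIntegrable γ) (hν : ν ∈ squareIntegrable γ) :
    ∫ x, formInner γ x (projForm m f μ x) (ν x) ∂riemVolume γ =
      ∫ x, formInner γ x (μ x) (projForm m f ν x) ∂riemVolume γ := by
  have h1 : ∀ x, formInner γ x (μ x) (projForm m f ν x) =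
      formInner γ x (projForm m f ν x) (μ x) := fun x => formInner_comm γ x _ _
  simp only [h1]
  rw [← integral_orbitPairing m hγ hf hμ hν, ← integral_orbitPairing m hγ hf hν hμ,
    ← (measurePreserving_smulInv_kernelMeasure m hγ hf).integral_comp
      (measurableEmbedding_smulInv G M)]
  simp only [orbitPairing_smulInv hγ]

/-- `P_f` on square integrable sections. -/
def projLinear (hγ : IsometricAction G γ) (hf : IsCutoff G f) :
    squareIntegrable γ →ₗ[ℝ] L2Forms γ where
  toFun μ := toL2 γ (projForm m f μ.1) (projForm_mem_squareIntegrable m hγ hf μ.2)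
  map_add' μ ν := by
    have h := toL2_eq_of_ae (projForm_mem_squareIntegrable m hγ hf (μ + ν).2)
      ((squareIntegrable γ).add_mem (projForm_mem_squareIntegrable m hγ hf μ.2)
        (projForm_mem_squareIntegrable m hγ hf ν.2)) ?_
    · exact h
    filter_upwards [ae_integrable_projIntegrand m hγ hf μ.2,
      ae_integrable_projIntegrand m hγ hf ν.2] with x hx hx'
    have h0 : ∀ g, projIntegrand m f (μ + ν).1 x g =
        projIntegrand m f μ.1 x g + projIntegrand m f ν.1 x g := fun g =>
      smul_add (modularFn m g * f (g • x)) (pullback g μ.1 x) (pullback g ν.1 x)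
    have h1 : projForm m f (μ + ν).1 x = (f x / massFn m f x ^ 2) •
        ∫ g, (projIntegrand m f μ.1 x g + projIntegrand m f ν.1 x g) ∂m := by
      simp only [projForm, h0]
    refine h1.trans ?_
    rw [integral_add hx hx', smul_add]
    rfl
  map_smul' r μ := by
    have h := toL2_eq_of_ae (projForm_mem_squareIntegrable m hγ hf (r • μ).2)
      ((squareIntegrable γ).smul_mem r (projForm_mem_squareIntegrable m hγ hf μ.2))
      (Filter.Eventually.of_forall fun x => ?_)
    · exact h
    have h0 : ∀ g, projIntegrand m f (r • μ).1 x g = r • projIntegrand m f μ.1 x g := fun g =>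
      smul_comm (modularFn m g * f (g • x)) r (pullback g μ.1 x)
    have h1 : projForm m f (r • μ).1 x = (f x / massFn m f x ^ 2) •
        ∫ g, r • projIntegrand m f μ.1 x g ∂m := by
      simp only [projForm, h0]
    refine h1.trans ?_
    rw [integral_smul, smul_comm]
    rfl

theorem norm_projLinear_le (hγ : IsometricAction G γ) (hf : IsCutoff G f) (μ : squareIntegrable γ) :
    ‖projLinear m hγ hf μ‖ ≤ 1 * ‖μ‖ := by
  have h : ‖projLinear m hγ hf μ‖ =
    ‖(⟨_, projForm_mem_squareIntegrable m hγ hf μ.2⟩ : squareIntegrable γ)‖ := rfl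
  rw [one_mul, h]
  refine le_of_sq_le_sq ?_ (norm_nonneg _)
  rw [norm_sq_eq_toReal_lintegral, norm_sq_eq_toReal_lintegral]
  exact ENNReal.toReal_mono (lintegral_normSqFn_ne_top μ.2)
    (lintegral_normSqFn_projForm_le m hγ hf μ.2)

/-- The bounded operator `P_f` on `L²(M, Λ*)`. -/
def projL2 (hγ : IsometricAction G γ) (hf : IsCutoff G f) : L2Forms γ →L[ℝ] L2Forms γ :=
  SeparationQuotient.liftCLM
    -- Sections with the same class are inseparable for the seminorm, and a continuous map into a
    -- Hausdorff space identifies them; hence the operator descends to classes.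
    ((projLinear m hγ hf).mkContinuous 1 (norm_projLinear_le m hγ hf)) fun _ _ h =>
      (h.map ((projLinear m hγ hf).mkContinuous 1 (norm_projLinear_le m hγ hf)).continuous).eq

theorem projL2_toL2 (hγ : IsometricAction G γ) (hf : IsCutoff G f) {μ : RoughForm n M}
    (hμ : μ ∈ squareIntegrable γ) : projL2 m hγ hf (toL2 γ μ hμ) =
      toL2 γ (projForm m f μ) (projForm_mem_squareIntegrable m hγ hf hμ) := rfl

theorem isSymmetricProjection_projL2 (hγ : IsometricAction G γ) (hf : IsCutoff G f) :
    (projL2 m hγ hf : L2Forms γ →ₗ[ℝ] L2Forms γ).IsSymmetricProjection := by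
  constructor
  · refine LinearMap.ext fun u => ?_
    obtain ⟨μ, rfl⟩ := SeparationQuotient.surjective_mk u
    -- Idempotence holds for sections at every point, since the average is invariant everywhere and
    -- `P_f` fixes `f` times an invariant form.
    have h : projForm m f (projForm m f μ.1) = projForm m f μ.1 := by
      rw [projForm_eq_mulForm m f μ.1]
      exact projForm_mulForm_of_invariant m (hf.massFn_pos m)
        (pullback_avgForm m γ hγ.mdifferentiable hγ.inner_eq f μ.1)
    exact toL2_eq_of_ae
      (projForm_mem_squareIntegrable m hγ hf (projForm_mem_squareIntegrable m hγ hf μ.2))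
      (projForm_mem_squareIntegrable m hγ hf μ.2)
      (Filter.Eventually.of_forall fun x => congrFun h x)
  · intro u v
    obtain ⟨μ, rfl⟩ := SeparationQuotient.surjective_mk u
    obtain ⟨ν, rfl⟩ := SeparationQuotient.surjective_mk v
    exact integral_formInner_projForm_comm m hγ hf μ.2 ν.2

end Operator
end EquivariantForms

namespace EquivariantForms


/-! ### Local frames of forms and smoothness in a single chart -/

section Frames

variable {n : ℕ} {M : Type*} [TopologicalSpace M] [ChartedSpace (EuclideanSpace ℝ (Fin n)) M]
  [IsManifold (𝓡 n) ∞ M]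

theorem exists_fiberCoeff_eq_modelCoeff {c x : M}
    (hx : x ∈ (chartAt (EuclideanSpace ℝ (Fin n)) c).source)
    (w₀ : ∀ k : Fin (n + 1), EuclideanSpace ℝ (Fin n) [⋀^Fin k]→L[ℝ] ℝ) :
    ∃ w : FormFiber n x, fiberCoeff c x w = modelCoeff n w₀ := by
  obtain ⟨b, hb⟩ := coordVec_eq hx
  have : FiniteDimensional ℝ (TangentSpace (𝓡 n) x) := b.finiteDimensional_of_finite
  have : T2Space (TangentSpace (𝓡 n) x) := inferInstanceAs (T2Space (EuclideanSpace ℝ (Fin n)))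
  let L : TangentSpace (𝓡 n) x →L[ℝ] EuclideanSpace ℝ (Fin n) :=
    LinearMap.toContinuousLinearMap (b.constr ℝ (EuclideanSpace.basisFun (Fin n) ℝ))
  refine ⟨fun k => (w₀ k).compContinuousLinearMap L, funext fun i => ?_⟩
  have h : ∀ j, L (coordVec c x j) = EuclideanSpace.basisFun (Fin n) ℝ j := fun j => by
    rw [hb]
    exact b.constr_basis ℝ (EuclideanSpace.basisFun (Fin n) ℝ) j
  change w₀ i.1 (fun a => L (coordVec c x (i.2 a))) = _
  simp only [h]
  rfl

theorem exists_modelCoeff_eq_fiberCoeff {c x : M} (w : FormFiber n x) :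
    ∃ w₀, modelCoeff n w₀ = fiberCoeff c x w := by
  let L : EuclideanSpace ℝ (Fin n) →L[ℝ] TangentSpace (𝓡 n) x :=
    LinearMap.toContinuousLinearMap
      ((EuclideanSpace.basisFun (Fin n) ℝ).toBasis.constr ℝ (coordVec c x))
  refine ⟨fun k => (w k).compContinuousLinearMap L, funext fun i => ?_⟩
  have h : ∀ j, L (EuclideanSpace.basisFun (Fin n) ℝ j) = coordVec c x j := fun j => by
    have := (EuclideanSpace.basisFun (Fin n) ℝ).toBasis.constr_basis ℝ (coordVec c x) j
    rwa [OrthonormalBasis.coe_toBasis] at this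
  change w i.1 (fun a => L (EuclideanSpace.basisFun (Fin n) ℝ (i.2 a))) = _
  simp only [h]
  rfl

/-- A finite family of forms over a chart domain with constant coefficients, with respect to which
every form is the combination of its coefficients. -/
theorem exists_frameForm (c : M) :
    ∃ (τ : (Σ k : Fin (n + 1), Fin k → Fin n) → RoughForm n M)
      (a : (Σ k : Fin (n + 1), Fin k → Fin n) → (Σ k : Fin (n + 1), Fin k → Fin n) → ℝ),
      ∀ x ∈ (chartAt (EuclideanSpace ℝ (Fin n)) c).source,
        (∀ i j, coeff (τ i) c j.1 j.2 x = a i j) ∧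
        ∀ η : RoughForm n M, η x = ∑ i, coeff η c i.1 i.2 x • τ i x := by
  classical
  -- A family that is one at a single multi-index and zero elsewhere need not come from an
  -- alternating form. Composing `R` with `modelCoeff` projects onto the families that do, so the `τ
  -- i` form an overcomplete system, and linearity of `R` still gives the expansion.
  obtain ⟨R, hR⟩ := (modelCoeff n).exists_leftInverse_of_injective
    (LinearMap.ker_eq_bot.2 modelCoeff_injective)
  have hR' : ∀ w, R (modelCoeff n w) = w := fun w => LinearMap.congr_fun hR w
  have hex : ∀ (i : Σ k : Fin (n + 1), Fin k → Fin n) (x : M), ∃ w : FormFiber n x,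
      x ∈ (chartAt (EuclideanSpace ℝ (Fin n)) c).source →
        fiberCoeff c x w = modelCoeff n (R (Pi.single i 1)) := fun i x => by
    by_cases hx : x ∈ (chartAt (EuclideanSpace ℝ (Fin n)) c).source
    · obtain ⟨w, hw⟩ := exists_fiberCoeff_eq_modelCoeff hx (R (Pi.single i 1))
      exact ⟨w, fun _ => hw⟩
    · exact ⟨0, fun h => absurd h hx⟩
  choose τ hτ using hex
  refine ⟨τ, fun i => modelCoeff n (R (Pi.single i 1)), fun x hx =>
    ⟨fun i j => congrFun (hτ i x hx) j, fun η => ?_⟩⟩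
  apply fiberCoeff_injective hx
  obtain ⟨w₀, hw₀⟩ := exists_modelCoeff_eq_fiberCoeff (c := c) (η x)
  have h1 : fiberCoeff c x (∑ i, coeff η c i.1 i.2 x • τ i x) =
      ∑ i, coeff η c i.1 i.2 x • modelCoeff n (R (Pi.single i 1)) := by
    rw [map_sum]
    refine Finset.sum_congr rfl fun i _ => ?_
    rw [map_smul, hτ i x hx]
  have h2 : ∑ i : (Σ k : Fin (n + 1), Fin k → Fin n), coeff η c i.1 i.2 x •
      modelCoeff n (R (Pi.single i 1)) = modelCoeff n (R (fiberCoeff c x (η x))) := by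
    conv_rhs => rw [pi_eq_sum_univ' (fiberCoeff c x (η x))]
    rw [map_sum, map_sum]
    refine Finset.sum_congr rfl fun i _ => ?_
    rw [map_smul, map_smul]
    congr 3
  rw [h1, h2, ← hw₀, hR']

variable {d : ℕ} {G : Type*} [Group G] [MulAction G M] [TopologicalSpace G]
  [ChartedSpace (EuclideanSpace ℝ (Fin d)) G] [IsManifold (𝓡 d) ∞ G]

/-- A change of charts is the pullback by the identity element of `G`, so the smoothness result for
pullbacks applies. -/
theorem contMDiffAt_coeff_of_chart
    (hact : ContMDiff ((𝓡 d).prod (𝓡 n)) (𝓡 n) ∞ fun p : G × M => p.1 • p.2) {c c' x : M}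
    (hx : x ∈ (chartAt (EuclideanSpace ℝ (Fin n)) c).source)
    (hx' : x ∈ (chartAt (EuclideanSpace ℝ (Fin n)) c').source) {η : RoughForm n M}
    (hη : ∀ k J, ContMDiffAt (𝓡 n) 𝓘(ℝ, ℝ) ∞ (coeff η c' k J) x) (k : Fin (n + 1))
    (I : Fin k → Fin n) : ContMDiffAt (𝓡 n) 𝓘(ℝ, ℝ) ∞ (coeff η c k I) x := by
  set e := chartAt (EuclideanSpace ℝ (Fin n)) c with he
  have hex : (1 : G) • e.symm (e x) = x := by rw [one_smul, e.left_inv hx]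
  have h := contMDiffAt_coeff_pullback hact c c' 1 (e.map_source hx) (η := η)
    (by rw [← he, hex]; exact hx') (by rw [← he, hex]; exact hη) k I
  have h1 : ContMDiffAt (𝓡 n) ((𝓡 d).prod 𝓘(ℝ, EuclideanSpace ℝ (Fin n))) ∞
      (fun x : M => ((1 : G), e x)) x :=
    contMDiffAt_const.prodMk (contMDiffOn_chart.contMDiffAt (e.open_source.mem_nhds hx))
  refine (ContMDiffAt.comp x h h1).congr_of_eventuallyEq ?_
  filter_upwards [e.open_source.mem_nhds hx] with y hy
  simp only [Function.comp_apply]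
  rw [← he, e.left_inv hy, pullback_one]

/-- A form which is smooth in the chart centred at `c` becomes a smooth form when multiplied by a
smooth function supported in the domain of that chart. -/
theorem isSmoothForm_mulForm_of_tsupport
    (hact : ContMDiff ((𝓡 d).prod (𝓡 n)) (𝓡 n) ∞ fun p : G × M => p.1 • p.2) {c : M}
    {θ : M → ℝ} (hθ : ContMDiff (𝓡 n) 𝓘(ℝ, ℝ) ∞ θ)
    (hsupp : tsupport θ ⊆ (chartAt (EuclideanSpace ℝ (Fin n)) c).source) {η : RoughForm n M}
    (hη : ∀ k I, ContMDiffOn (𝓡 n) 𝓘(ℝ, ℝ) ∞ (coeff η c k I)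
      (chartAt (EuclideanSpace ℝ (Fin n)) c).source) : IsSmoothForm (mulForm θ η) := by
  intro c' k I x hx'
  refine ContMDiffAt.contMDiffWithinAt ?_
  by_cases hx : x ∈ tsupport θ
  · have hxs := hsupp hx
    refine contMDiffAt_coeff_of_chart hact hx' hxs (fun k J => ?_) k I
    exact hθ.contMDiffAt.mul ((hη k J).contMDiffAt
      ((chartAt (EuclideanSpace ℝ (Fin n)) c).open_source.mem_nhds hxs))
  · refine (contMDiffAt_const (c := (0 : ℝ))).congr_of_eventuallyEq ?_
    filter_upwards [(isClosed_tsupport θ).isOpen_compl.mem_nhds hx] with y hy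
    change θ y * coeff η c' k I y = 0
    rw [image_eq_zero_of_notMem_tsupport hy, zero_mul]

end Frames

/-! ### Density of smooth forms -/

section Density

variable {n : ℕ} {M : Type*} [TopologicalSpace M] [T2Space M] [SecondCountableTopology M]
  [ChartedSpace (EuclideanSpace ℝ (Fin n)) M]
  [IsManifold (𝓡 n) ∞ M] [MeasurableSpace M] [BorelSpace M] {γ : Metric n M}

/-- Approximate first by a continuous function of compact support, then uniformly by a smooth
function whose support is no larger. -/
theorem exists_contMDiff_eLpNorm_sub_le (ν : Measure M) [IsLocallyFiniteMeasure ν] {h : M → ℝ}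
    (hh : MemLp h 2 ν) {ε : ℝ} (hε : 0 < ε) :
    ∃ g : M → ℝ, ContMDiff (𝓡 n) 𝓘(ℝ, ℝ) ∞ g ∧ HasCompactSupport g ∧
      eLpNorm (h - g) 2 ν ≤ ENNReal.ofReal ε := by
  have : LocallyCompactSpace M := ChartedSpace.locallyCompactSpace (EuclideanSpace ℝ (Fin n)) M
  let _ := TopologicalSpace.metrizableSpaceMetric M
  have hε2 : ((ε / 2).toNNReal : ENNReal) ≠ 0 :=
    ENNReal.coe_ne_zero.2 (Real.toNNReal_pos.2 (half_pos hε)).ne'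
  obtain ⟨g, hgc, hg, hgcont, hgL⟩ := hh.exists_hasCompactSupport_eLpNorm_sub_le
    (by simp) (ε := (ε / 2).toNNReal) hε2
  obtain ⟨δ, hδ, hδ'⟩ : ∃ δ : ℝ, 0 < δ ∧
      ENNReal.ofReal δ * ν (tsupport g) ^ (1 / (2 : ENNReal).toReal) ≤ ENNReal.ofReal (ε / 2) := by
    set r := ν (tsupport g) ^ (1 / (2 : ENNReal).toReal)
    have hr : r ≠ ⊤ := ENNReal.rpow_ne_top_of_nonneg (by positivity) hgc.measure_lt_top.ne
    -- A uniform error `δ` on the support costs at most `δ r` in the `L²` norm; adding one avoids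
    -- division by zero when the support is null.
    refine ⟨ε / 2 / (r.toReal + 1), by positivity, ?_⟩
    rw [← ENNReal.ofReal_toReal hr, ← ENNReal.ofReal_mul (by positivity)]
    refine ENNReal.ofReal_le_ofReal ?_
    rw [ENNReal.toReal_ofReal ENNReal.toReal_nonneg, div_mul_eq_mul_div,
      div_le_iff₀ (by positivity)]
    have := ENNReal.toReal_nonneg (a := r)
    nlinarith
  obtain ⟨g', hg', hsub⟩ := hgcont.exists_contMDiff_approx (𝓡 n) ⊤ (ε := fun _ => δ)
    continuous_const fun _ => hδ
  refine ⟨g', g'.contMDiff, hgc.mono hsub, ?_⟩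
  have h1 : eLpNorm (g - ⇑g') 2 ν ≤ ENNReal.ofReal (ε / 2) := by
    refine (eLpNorm_sub_le_of_dist_bdd ν (by simp) hgc.measurableSet hδ.le (fun x => ?_)
      (subset_tsupport g) (hsub.trans (subset_tsupport g))).trans hδ'
    rw [dist_comm]
    exact (hg' x).le
  have h2 : h - ⇑g' = (h - g) + (g - ⇑g') := by simp
  rw [h2]
  refine (eLpNorm_add_le (hh.aestronglyMeasurable.sub hgcont.aestronglyMeasurable)
    (hgcont.aestronglyMeasurable.sub g'.contMDiff.continuous.aestronglyMeasurable)
    (by norm_num)).trans ?_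
  refine (add_le_add hg h1).trans_eq ?_
  change ENNReal.ofReal (ε / 2) + _ = _
  rw [← ENNReal.ofReal_add (by positivity) (by positivity), add_halves]

end Density
end EquivariantForms

namespace EquivariantForms


section Density

variable {n : ℕ} {M : Type*} [TopologicalSpace M] [T2Space M] [SecondCountableTopology M]
  [ChartedSpace (EuclideanSpace ℝ (Fin n)) M]
  [IsManifold (𝓡 n) ∞ M] [MeasurableSpace M] [BorelSpace M] {γ : Metric n M}

theorem mulForm_mem_squareIntegrable_of_integrable {h : M → ℝ} {η : RoughForm n M}
    (hh : AEStronglyMeasurable h (riemVolume γ)) (hη : IsMeasurableForm γ η)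
    (hi : Integrable (fun x => h x ^ 2 * formInner γ x (η x) (η x)) (riemVolume γ)) :
    mulForm h η ∈ squareIntegrable γ := by
  refine ⟨fun c k I => hh.restrict.mul (hη c k I), ?_⟩
  simpa only [formInner_mulForm] using hi

theorem mulForm_mem_squareIntegrable_of_memLp {h : M → ℝ} {η : RoughForm n M}
    (hh : MemLp h 2 (riemVolume γ)) (hη : IsMeasurableForm γ η) {C : ℝ}
    (hC : ∀ x, formInner γ x (η x) (η x) ≤ C) : mulForm h η ∈ squareIntegrable γ := by
  refine mulForm_mem_squareIntegrable_of_integrable hh.aestronglyMeasurable hη ?_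
  refine (hh.integrable_sq.mul_const C).mono'
    ((hh.aestronglyMeasurable.pow 2).mul (aestronglyMeasurable_formInner γ hη hη))
    (Filter.Eventually.of_forall fun x => ?_)
  rw [Real.norm_of_nonneg (mul_nonneg (sq_nonneg _) (formInner_self_nonneg γ x _))]
  exact mul_le_mul_of_nonneg_left (hC x) (sq_nonneg _)

theorem norm_toL2_sub_sq {α β : RoughForm n M} (hα : α ∈ squareIntegrable γ)
    (hβ : β ∈ squareIntegrable γ) : ‖toL2 γ α hα - toL2 γ β hβ‖ ^ 2 =
      ∫ x, formInner γ x (α x - β x) (α x - β x) ∂riemVolume γ := by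
  have h : ‖toL2 γ α hα - toL2 γ β hβ‖ = ‖(⟨α, hα⟩ - ⟨β, hβ⟩ : squareIntegrable γ)‖ := rfl
  rw [h, norm_sq_squareIntegrable]
  rfl

theorem toL2_finsetSum {ι : Type*} (s : Finset ι) (α : ι → RoughForm n M)
    (hα : ∀ i, α i ∈ squareIntegrable γ) :
    toL2 γ (∑ i ∈ s, α i) (Submodule.sum_mem _ fun i _ => hα i) = ∑ i ∈ s, toL2 γ (α i) (hα i) := by
  have h : (⟨∑ i ∈ s, α i, Submodule.sum_mem _ fun i _ => hα i⟩ : squareIntegrable γ) =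
      ∑ i ∈ s, ⟨α i, hα i⟩ := Subtype.ext (by simp)
  exact (congrArg (SeparationQuotient.mkCLM ℝ (squareIntegrable γ)) h).trans
    (map_sum (SeparationQuotient.mkCLM ℝ (squareIntegrable γ)) _ s)

theorem toL2_congr {α β : RoughForm n M} (h : α = β) (hβ : β ∈ squareIntegrable γ) :
    toL2 γ α (h ▸ hβ) = toL2 γ β hβ := by
  subst h; rfl

variable {V : Submodule ℝ (L2Forms γ)}

/-- A closed subspace which contains the smooth forms contains the products of square integrable
functions with smooth forms of compact support. -/
theorem toL2_mulForm_mem (hV : IsClosed (V : Set (L2Forms γ)))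
    (hsm : ∀ s (h : s ∈ squareIntegrable γ), IsSmoothForm s → toL2 γ s h ∈ V)
    {h : M → ℝ} (hh : MemLp h 2 (riemVolume γ)) {η : RoughForm n M} (hη : IsSmoothForm η) {C : ℝ}
    (hC : ∀ x, formInner γ x (η x) (η x) ≤ C) (hmem : mulForm h η ∈ squareIntegrable γ) :
    toL2 γ (mulForm h η) hmem ∈ V := by
  rw [← SetLike.mem_coe, ← hV.closure_eq, Metric.mem_closure_iff]
  intro ε hε
  have hC0 : 0 ≤ |C| := abs_nonneg C
  -- With this `δ` the squared error is at most `δ² (|C| + 1) = ε² / (4 (|C| + 1))`, which is below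
  -- `ε²`.
  have hδ : 0 < ε / (2 * (|C| + 1)) := by positivity
  obtain ⟨g, hg, hgc, hgh⟩ := exists_contMDiff_eLpNorm_sub_le (n := n) (riemVolume γ) hh hδ
  have hgm := mulForm_mem_squareIntegrable γ hg hgc hη
  refine ⟨_, hsm _ hgm (isSmoothForm_mulForm hg hη), ?_⟩
  have hgL : MemLp g 2 (riemVolume γ) := hg.continuous.memLp_of_hasCompactSupport hgc
  have hd := hh.sub hgL
  have h1 : ∫ x, (h - g) x ^ 2 ∂riemVolume γ ≤ (ε / (2 * (|C| + 1))) ^ 2 := by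
    have e1 : ∫ x, (h - g) x ^ 2 ∂riemVolume γ = (eLpNorm (h - g) 2 (riemVolume γ)).toReal ^ 2 := by
      rw [← Lp.norm_toLp (h - g) hd, ← real_inner_self_eq_norm_sq, L2.inner_def]
      refine integral_congr_ae ?_
      filter_upwards [hd.coeFn_toLp] with x hx
      rw [hx]
      simp [sq]
    rw [e1]
    exact pow_le_pow_left₀ ENNReal.toReal_nonneg (ENNReal.toReal_le_of_le_ofReal hδ.le hgh) 2
  rw [dist_eq_norm]
  refine lt_of_pow_lt_pow_left₀ 2 hε.le ?_
  rw [norm_toL2_sub_sq]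
  have hpt : ∀ x, formInner γ x (mulForm h η x - mulForm g η x) (mulForm h η x - mulForm g η x) =
      (h - g) x ^ 2 * formInner γ x (η x) (η x) := fun x => by
    have e : mulForm h η x - mulForm g η x = mulForm (h - g) η x := (sub_smul _ _ _).symm
    rw [e, formInner_mulForm]
  simp only [hpt]
  have hle : ∫ x, (h - g) x ^ 2 * formInner γ x (η x) (η x) ∂riemVolume γ ≤
      ∫ x, (h - g) x ^ 2 * (|C| + 1) ∂riemVolume γ := by
    refine integral_mono_of_nonneg (Filter.Eventually.of_forall fun x =>
      mul_nonneg (sq_nonneg _) (formInner_self_nonneg γ x _)) (hd.integrable_sq.mul_const _)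
      (Filter.Eventually.of_forall fun x => ?_)
    exact mul_le_mul_of_nonneg_left ((hC x).trans (by linarith [le_abs_self C])) (sq_nonneg _)
  rw [integral_mul_const] at hle
  refine hle.trans_lt ((mul_le_mul_of_nonneg_right h1 (by positivity)).trans_lt ?_)
  have hC1 : (1 : ℝ) ≤ |C| + 1 := by linarith
  have e : (ε / (2 * (|C| + 1))) ^ 2 * (|C| + 1) = ε ^ 2 / (4 * (|C| + 1)) := by
    field_simp
    ring
  rw [e, div_lt_iff₀ (by positivity)]
  nlinarith [sq_pos_of_pos hε]

/-- The restriction of a form to a measurable set, extended by zero. -/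
theorem indicator_mem_squareIntegrable {E : Set M} (hE : MeasurableSet E) {μ : RoughForm n M}
    (hμ : μ ∈ squareIntegrable γ) : mulForm (E.indicator 1) μ ∈ squareIntegrable γ := by
  refine mulForm_mem_squareIntegrable_of_integrable
    (measurable_one.indicator hE).aestronglyMeasurable hμ.1 ?_
  refine (hμ.2.indicator hE).congr (Filter.Eventually.of_forall fun x => ?_)
  by_cases hx : x ∈ E <;> simp [hx]

variable {d : ℕ} {G : Type*} [Group G] [MulAction G M] [TopologicalSpace G]
  [ChartedSpace (EuclideanSpace ℝ (Fin d)) G] [IsManifold (𝓡 d) ∞ G]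

/-- With `θ` a bump function equal to one on `K`, the restricted form is the finite sum of `(1_E
μ_I)(θ τ_I)`. The functions `1_E μ_I` are in `L²` by the Hadamard bound on `K`, and the forms `θ
τ_I` are smooth and bounded. -/
theorem toL2_indicator_mem_of_chart
    (hact : ContMDiff ((𝓡 d).prod (𝓡 n)) (𝓡 n) ∞ fun p : G × M => p.1 • p.2)
    (hV : IsClosed (V : Set (L2Forms γ)))
    (hsm : ∀ s (h : s ∈ squareIntegrable γ), IsSmoothForm s → toL2 γ s h ∈ V)
    {c : M} {K E : Set M} (hK : IsCompact K)
    (hKc : K ⊆ (chartAt (EuclideanSpace ℝ (Fin n)) c).source) (hE : MeasurableSet E) (hEK : E ⊆ K)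
    {μ : RoughForm n M} (hμ : μ ∈ squareIntegrable γ) :
    toL2 γ (mulForm (E.indicator 1) μ) (indicator_mem_squareIntegrable hE hμ) ∈ V := by
  have : LocallyCompactSpace M := ChartedSpace.locallyCompactSpace (EuclideanSpace ℝ (Fin n)) M
  have hopen := (chartAt (EuclideanSpace ℝ (Fin n)) c).open_source
  obtain ⟨L, hL, hKL, hLc⟩ := exists_compact_between hK hopen hKc
  obtain ⟨θ, hθ1, hθ0, -⟩ := exists_contMDiffMap_one_nhds_of_subset_interior (n := ⊤) (𝓡 n)
    hK.isClosed hKL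
  have hsuppL : tsupport θ ⊆ L := closure_minimal (fun x hx => by
    by_contra hxL
    exact hx (hθ0 x hxL)) hL.isClosed
  have hθc : HasCompactSupport θ := HasCompactSupport.of_support_subset_isCompact hL
    ((subset_tsupport θ).trans hsuppL)
  obtain ⟨τ, a, hτ⟩ := exists_frameForm (n := n) c
  have hsmooth : ∀ i, IsSmoothForm (mulForm θ (τ i)) := fun i =>
    isSmoothForm_mulForm_of_tsupport hact θ.contMDiff (hsuppL.trans hLc) fun k I =>
      contMDiffOn_const.congr fun x hx => (hτ x hx).1 i ⟨k, I⟩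
  have hbd : ∀ i, ∃ C, ∀ x, formInner γ x (mulForm θ (τ i) x) (mulForm θ (τ i) x) ≤ C := fun i => by
    have hcs : HasCompactSupport fun x =>
        formInner γ x (mulForm θ (τ i) x) (mulForm θ (τ i) x) := by
      refine hθc.mono fun x hx => ?_
      simp only [Function.mem_support, formInner_mulForm] at hx ⊢
      exact fun h0 => hx (by simp [h0])
    obtain ⟨C, hC⟩ := hcs.exists_bound_of_continuous
      (continuous_formInner_of_isSmoothForm γ (hsmooth i) (hsmooth i))
    exact ⟨C, fun x => (le_abs_self _).trans (hC x)⟩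
  choose C hC using hbd
  have hcoef : ∀ i : Σ k : Fin (n + 1), Fin k → Fin n,
      MemLp (E.indicator (coeff μ c i.1 i.2)) 2 (riemVolume γ) := fun i => by
    have hm : AEStronglyMeasurable (E.indicator (coeff μ c i.1 i.2)) (riemVolume γ) :=
      (aestronglyMeasurable_indicator_iff hE).2
        ((hμ.1 c i.1 i.2).mono_measure (Measure.restrict_mono (hEK.trans hKc) le_rfl))
    obtain ⟨B, hB⟩ := hK.exists_bound_of_continuousOn
      ((continuousOn_coeffBound γ c i.1 i.2).mono hKc)
    refine (memLp_two_iff_integrable_sq hm).2 ((hμ.2.const_mul |B|).mono' (hm.pow 2)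
      (Filter.Eventually.of_forall fun x => ?_))
    have hnn := formInner_self_nonneg γ x (μ x)
    rw [Real.norm_of_nonneg (sq_nonneg _)]
    by_cases hx : x ∈ E
    · rw [Set.indicator_of_mem hx]
      exact (sq_coeff_le γ μ c i.1 i.2 x).trans (mul_le_mul_of_nonneg_right
        (((le_abs_self _).trans (hB x (hEK hx))).trans (le_abs_self B)) hnn)
    · rw [Set.indicator_of_notMem hx, zero_pow two_ne_zero]
      exact mul_nonneg (abs_nonneg B) hnn
  have hmem := fun i => mulForm_mem_squareIntegrable_of_memLp (hcoef i)
    (isMeasurableForm_of_isSmoothForm γ (hsmooth i)) (hC i)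
  have hsum : mulForm (E.indicator 1) μ =
      ∑ i, mulForm (E.indicator (coeff μ c i.1 i.2)) (mulForm θ (τ i)) := by
    funext x
    have e : (∑ i, mulForm (E.indicator (coeff μ c i.1 i.2)) (mulForm θ (τ i))) x =
        ∑ i, mulForm (E.indicator (coeff μ c i.1 i.2)) (mulForm θ (τ i)) x :=
      Finset.sum_apply x _ _
    refine Eq.trans ?_ e.symm
    by_cases hx : x ∈ E
    · have h1 : θ x = 1 := hθ1.self_of_nhdsSet x (hEK hx)
      simp only [mulForm, Set.indicator_of_mem hx, h1, one_smul, Pi.one_apply]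
      exact (hτ x (hKc (hEK hx))).2 μ
    · simp [mulForm, hx]
  have h2 := (toL2_congr hsum (Submodule.sum_mem _ fun i _ => hmem i)).trans
    (toL2_finsetSum Finset.univ _ hmem)
  exact h2 ▸ V.sum_mem fun i _ => toL2_mulForm_mem hV hsm (hcoef i) (hsmooth i) (hC i) (hmem i)

/-- The smooth square integrable forms are dense in `L²(M, Λ*)`. -/
theorem toL2_mem_of_isClosed
    (hact : ContMDiff ((𝓡 d).prod (𝓡 n)) (𝓡 n) ∞ fun p : G × M => p.1 • p.2)
    (hV : IsClosed (V : Set (L2Forms γ)))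
    (hsm : ∀ s (h : s ∈ squareIntegrable γ), IsSmoothForm s → toL2 γ s h ∈ V)
    {μ : RoughForm n M} (hμ : μ ∈ squareIntegrable γ) : toL2 γ μ hμ ∈ V := by
  have : LocallyCompactSpace M := ChartedSpace.locallyCompactSpace (EuclideanSpace ℝ (Fin n)) M
  -- Asking for all measurable subsets makes the property stable under unions: a subset of `K ∪ L`
  -- splits into its parts inside and outside `K`.
  let p : Set M → Prop := fun K => MeasurableSet K ∧ ∀ E (hE : MeasurableSet E), E ⊆ K →
    toL2 γ (mulForm (E.indicator 1) μ) (indicator_mem_squareIntegrable hE hμ) ∈ V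
  have hp0 : p ∅ := by
    refine ⟨MeasurableSet.empty, fun E hE hE0 => ?_⟩
    obtain rfl := Set.subset_empty_iff.1 hE0
    have h0 : mulForm ((∅ : Set M).indicator 1) μ = 0 := by
      funext x
      simp only [mulForm, Set.indicator_empty, zero_smul]
      rfl
    have h1 := toL2_congr h0 (squareIntegrable γ).zero_mem
    exact h1 ▸ V.zero_mem
  have hpU : ∀ K L, p K → p L → p (K ∪ L) := by
    rintro K L ⟨hK, hK'⟩ ⟨hL, hL'⟩
    refine ⟨hK.union hL, fun E hE hEU => ?_⟩
    have h1 := indicator_mem_squareIntegrable (hE.inter hK) hμ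
    have h2 := indicator_mem_squareIntegrable (hE.diff hK) hμ
    have h3 : mulForm (E.indicator 1) μ =
        mulForm ((E ∩ K).indicator 1) μ + mulForm ((E \ K).indicator 1) μ := by
      funext x
      change E.indicator (1 : M → ℝ) x • μ x =
        (E ∩ K).indicator (1 : M → ℝ) x • μ x + (E \ K).indicator (1 : M → ℝ) x • μ x
      by_cases hx : x ∈ E <;> by_cases hxK : x ∈ K <;> simp [hx, hxK]
    have h4 := toL2_congr h3 ((squareIntegrable γ).add_mem h1 h2)
    exact h4 ▸ V.add_mem (hK' _ (hE.inter hK) Set.inter_subset_right)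
      (hL' _ (hE.diff hK) fun x hx => (hEU hx.1).resolve_left hx.2)
  obtain ⟨K, hKp, hKU⟩ : ∃ K : ℕ → Set M, (∀ i, p (K i)) ∧ ⋃ i, K i = Set.univ := by
    refine (Set.exists_seq_cover_iff_countable ⟨∅, hp0⟩).2 ?_
    have hnb : ∀ c : M, ∃ N ∈ nhds c, N ⊆ (chartAt (EuclideanSpace ℝ (Fin n)) c).source ∧
        IsCompact N := fun c => local_compact_nhds (chart_source_mem_nhds _ c)
    choose N hN hNs hNc using hnb
    obtain ⟨s, hs, hsU⟩ := TopologicalSpace.countable_cover_nhds hN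
    refine ⟨N '' s, hs.image N, ?_, by rw [Set.sUnion_image, hsU]⟩
    rintro _ ⟨c, -, rfl⟩
    exact ⟨(hNc c).measurableSet, fun E hE hEN =>
      toL2_indicator_mem_of_chart hact hV hsm (hNc c) (hNs c) hE hEN hμ⟩
  have hacc : ∀ i, p (Set.accumulate K i) := fun i => by
    induction i with
    | zero => simpa using hKp 0
    | succ i ih => rw [Set.accumulate_succ]; exact hpU _ _ ih (hKp _)
  have hmem := fun i => indicator_mem_squareIntegrable (hacc i).1 hμ
  refine hV.mem_of_tendsto (b := Filter.atTop) (f := fun i => toL2 γ _ (hmem i)) ?_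
    (Filter.Eventually.of_forall fun i => (hacc i).2 _ (hacc i).1 subset_rfl)
  rw [tendsto_iff_norm_sub_tendsto_zero]
  -- The error is the tail of `∫ |μ|²` over the complements of an increasing exhaustion of `M`,
  -- which decrease to the empty set.
  have hsq : ∀ i, ‖toL2 γ _ (hmem i) - toL2 γ μ hμ‖ ^ 2 =
      ∫ x in (Set.accumulate K i)ᶜ, formInner γ x (μ x) (μ x) ∂riemVolume γ := fun i => by
    rw [norm_toL2_sub_sq, ← integral_indicator (hacc i).1.compl]
    refine integral_congr_ae (Filter.Eventually.of_forall fun x => ?_)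
    have e : mulForm ((Set.accumulate K i).indicator 1) μ x - μ x =
        ((Set.accumulate K i).indicator (1 : M → ℝ) x - 1) • μ x := by
      rw [sub_smul, one_smul]
      rfl
    simp only [e, formInner_smul_smul]
    by_cases hx : x ∈ Set.accumulate K i <;> simp [hx]
  have hlim : Filter.Tendsto (fun i => ‖toL2 γ _ (hmem i) - toL2 γ μ hμ‖ ^ 2) Filter.atTop
      (nhds 0) := by
    simp only [hsq]
    have h := tendsto_setIntegral_of_antitone (μ := riemVolume γ)
      (f := fun x => formInner γ x (μ x) (μ x)) (s := fun i => (Set.accumulate K i)ᶜ)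
      (fun i => (hacc i).1.compl)
      (fun i j hij => Set.compl_subset_compl.2 (Set.monotone_accumulate hij))
      ⟨0, hμ.2.integrableOn⟩
    rwa [← Set.compl_iUnion, Set.iUnion_accumulate, hKU, Set.compl_univ, setIntegral_empty] at h
  have := hlim.sqrt
  simpa only [Real.sqrt_sq (norm_nonneg _), Real.sqrt_zero] using this

end Density
end EquivariantForms

namespace EquivariantForms


/-! ### The range of the projection -/

section Range

variable {d n : ℕ} {G : Type*} [Group G] [TopologicalSpace G] [MeasurableSpace G]
  [ChartedSpace (EuclideanSpace ℝ (Fin d)) G] [IsManifold (𝓡 d) ∞ G]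
  [IsTopologicalGroup G]
  [T2Space G] [LocallyCompactSpace G] [SecondCountableTopology G] [BorelSpace G]
  (m : Measure G) [m.IsMulRightInvariant] [IsFiniteMeasureOnCompacts m] [m.IsOpenPosMeasure]
  {M : Type*} [TopologicalSpace M] [T2Space M] [SecondCountableTopology M]
  [ChartedSpace (EuclideanSpace ℝ (Fin n)) M]
  [IsManifold (𝓡 n) ∞ M] [MeasurableSpace M] [BorelSpace M] [MulAction G M] [ProperSMul G M]
  {γ : Metric n M} {f : M → ℝ}

theorem range_projL2
    (hact : ContMDiff ((𝓡 d).prod (𝓡 n)) (𝓡 n) ∞ fun p : G × M => p.1 • p.2)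
    (hγ : IsometricAction G γ) (hf : IsCutoff G f) (hsm : ContMDiff (𝓡 n) 𝓘(ℝ, ℝ) ∞ f) :
    LinearMap.range (projL2 m hγ hf : L2Forms γ →ₗ[ℝ] L2Forms γ) = cutoffInvariant G γ f := by
  set P := projL2 m hγ hf
  have hidem : ∀ u, P (P u) = P u := fun u =>
    LinearMap.congr_fun (isSymmetricProjection_projL2 m hγ hf).isIdempotentElem u
  apply le_antisymm
  -- The preimage of `H⁰_f` under `P` is a closed subspace, so by density only smooth forms need to
  -- be tested; for these `P` gives `f` times a smooth invariant form.
  · have hV : IsClosed (((cutoffInvariant G γ f).comap (P : L2Forms γ →ₗ[ℝ] L2Forms γ) :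
        Submodule ℝ (L2Forms γ)) : Set (L2Forms γ)) :=
      (Submodule.isClosed_topologicalClosure _).preimage P.continuous
    rintro _ ⟨u, rfl⟩
    obtain ⟨μ, rfl⟩ := SeparationQuotient.surjective_mk u
    refine toL2_mem_of_isClosed hact hV (fun s hs hsmooth => ?_) μ.2
    refine Submodule.le_topologicalClosure _ (Submodule.subset_span ?_)
    have hmem := projForm_mem_squareIntegrable m hγ hf hs
    rw [projForm_eq_mulForm] at hmem
    refine ⟨avgForm m f s, ⟨isSmoothForm_avgForm m hact hsm hf.hasCompactSupport (hf.massFn_pos m)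
      hsmooth, pullback_avgForm m γ hγ.mdifferentiable hγ.inner_eq f s⟩, hmem, ?_⟩
    exact toL2_congr (projForm_eq_mulForm m f s) hmem
  -- Since `P` is idempotent, its range is its fixed space, which is closed; so it suffices that
  -- each generator `f s` is fixed.
  · have hcl : IsClosed ((LinearMap.range (P : L2Forms γ →ₗ[ℝ] L2Forms γ) :
        Submodule ℝ (L2Forms γ)) : Set (L2Forms γ)) := by
      have h : ((LinearMap.range (P : L2Forms γ →ₗ[ℝ] L2Forms γ) :
          Submodule ℝ (L2Forms γ)) : Set (L2Forms γ)) = {u | P u = u} := by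
        ext u
        exact ⟨fun ⟨v, hv⟩ => by subst hv; exact hidem v, fun hu => ⟨u, hu⟩⟩
      rw [h]
      exact isClosed_eq P.continuous continuous_id
    refine Submodule.topologicalClosure_minimal _ (Submodule.span_le.2 ?_) hcl
    rintro _ ⟨s, hs, h, rfl⟩
    exact ⟨toL2 γ (mulForm f s) h,
      toL2_congr (projForm_mulForm_of_invariant m (hf.massFn_pos m) hs.2) h⟩

end Range
end EquivariantForms

theorem mainTheorem8 {d n : ℕ} {G M : Type*}
    -- a Lie group `G` with a right Haar measure `m`
    [Group G] [TopologicalSpace G] [T2Space G] [SecondCountableTopology G]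
    [ChartedSpace (EuclideanSpace ℝ (Fin d)) G] [LieGroup (𝓡 d) ∞ G]
    [MeasurableSpace G] [BorelSpace G]
    (m : Measure G) [m.IsMulRightInvariant] [IsFiniteMeasureOnCompacts m] [m.IsOpenPosMeasure]
    -- a smooth manifold `M` with a smooth proper action of `G`
    [TopologicalSpace M] [T2Space M] [SecondCountableTopology M]
    [ChartedSpace (EuclideanSpace ℝ (Fin n)) M] [IsManifold (𝓡 n) ∞ M]
    [MeasurableSpace M] [BorelSpace M]
    [MulAction G M] [ContMDiffSMul (𝓡 d) (𝓡 n) ∞ G M] [ProperSMul G M]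
    -- a `G`-invariant Riemannian metric
    (γ : EquivariantForms.Metric n M)
    (hγ : ∀ (g : G) (x : M) (v w : TangentSpace (𝓡 n) x),
      γ.inner (g • x) (mfderiv (𝓡 n) (𝓡 n) (fun y : M => g • y) x v)
        (mfderiv (𝓡 n) (𝓡 n) (fun y : M => g • y) x w) = γ.inner x v w)
    -- a compact set `Y` with `G Y = M`, and neighbourhoods `U`, `U'` of it
    (Y U U' : Set M) (hY : IsCompact Y) (hGY : ⋃ g : G, (fun y : M => g • y) '' Y = Set.univ)
    (hU : IsOpen U) (hU' : IsOpen U') (hYU : Y ⊆ U) (hUU' : closure U ⊆ U')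
    (hUc : IsCompact (closure U)) (hUc' : IsCompact (closure U'))
    -- the cut-off function
    (f : M → ℝ) (hf : ContMDiff (𝓡 n) 𝓘(ℝ, ℝ) ∞ f) (hf01 : ∀ x, f x ∈ Set.Icc (0 : ℝ) 1)
    (hfU : ∀ x ∈ U, f x = 1) (hfU' : tsupport f ⊆ U') :
    -- `A` is well defined, strictly positive and equivariant
    (∀ x : M, Integrable (fun g : G => EquivariantForms.modularFn m g * f (g • x) ^ 2) m) ∧
    (∀ x : M, 0 < EquivariantForms.massFn m f x) ∧
    (∀ (g : G) (x : M), EquivariantForms.massFn m f (g • x) ^ 2 =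
      (EquivariantForms.modularFn m g)⁻¹ * EquivariantForms.massFn m f x ^ 2) ∧
    -- `f s` is in `L²` for every smooth invariant form `s`
    (∀ s : EquivariantForms.RoughForm n M, EquivariantForms.IsInvariantForm G s →
      EquivariantForms.mulForm f s ∈ EquivariantForms.squareIntegrable γ) ∧
    -- `P_f` is a well defined operator on `L²`, and the orthogonal projection onto `H⁰_f`
    ∃ P : EquivariantForms.L2Forms γ →L[ℝ] EquivariantForms.L2Forms γ,
      (∀ (μ : EquivariantForms.RoughForm n M) (hμ : μ ∈ EquivariantForms.squareIntegrable γ),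
        (∀ᵐ x ∂EquivariantForms.riemVolume γ,
          Integrable (EquivariantForms.projIntegrand m f μ x) m) ∧
        ∃ h : EquivariantForms.projForm m f μ ∈ EquivariantForms.squareIntegrable γ,
          P (EquivariantForms.toL2 γ μ hμ) =
            EquivariantForms.toL2 γ (EquivariantForms.projForm m f μ) h) ∧
      (P : EquivariantForms.L2Forms γ →ₗ[ℝ] EquivariantForms.L2Forms γ).IsSymmetricProjection ∧
      LinearMap.range (P : EquivariantForms.L2Forms γ →ₗ[ℝ] EquivariantForms.L2Forms γ) =
        EquivariantForms.cutoffInvariant G γ f := by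
  open EquivariantForms in
  have := topologicalGroup_of_lieGroup (𝓡 d) ∞ (G := G)
  have : LocallyCompactSpace G := ChartedSpace.locallyCompactSpace (EuclideanSpace ℝ (Fin d)) G
  have hact : ContMDiff ((𝓡 d).prod (𝓡 n)) (𝓡 n) ∞ fun p : G × M => p.1 • p.2 :=
    ContMDiffSMul.contMDiff_smul
  have hiso : IsometricAction G γ :=
    { mdifferentiable := fun g => (hact.comp
        (contMDiff_const.prodMk contMDiff_id)).mdifferentiable (by simp)
      inner_eq := hγ
      continuousOn_jacobian := continuousOn_jacobian hact }
  have hfc : HasCompactSupport f :=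
    hUc'.of_isClosed_subset (isClosed_tsupport f) (hfU'.trans subset_closure)
  have hcut : IsCutoff G f := by
    refine ⟨hf.continuous, hfc, fun x => ?_⟩
    -- Every `x` is `g y` with `y ∈ Y ⊆ U`, so `f(g⁻¹ x) = f(y) = 1`; this is how the cutoff is
    -- nonzero somewhere on each orbit.
    obtain ⟨g, y, hy, hx⟩ := Set.mem_iUnion.1 (hGY ▸ Set.mem_univ x)
    refine ⟨g⁻¹, ?_⟩
    simp only at hx
    rw [← hx, inv_smul_smul, hfU y (hYU hy)]
    exact one_ne_zero
  refine ⟨integrable_modularFn_mul m hf.continuous hfc, hcut.massFn_pos m, massFn_smul_sq m f,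
    fun s hs => mulForm_mem_squareIntegrable γ hf hfc hs.1, projL2 m hiso hcut, fun μ hμ =>
      ⟨ae_integrable_projIntegrand m hiso hcut hμ, projForm_mem_squareIntegrable m hiso hcut hμ,
        projL2_toL2 m hiso hcut hμ⟩, isSymmetricProjection_projL2 m hiso hcut,
      range_projL2 m hact hiso hcut hf⟩
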